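/- Write $\mathbb R_+=(0,\infty)$, $X_{0,m}=L_1(\mathbb R_+,(1+x^m)\,dx)$ and $\|f\|_{[0,m]}=\int_0^\infty|f(x)|(1+x^m)\,dx$. Consider the growth--fragmentation equation $$\partial_t f(x,t)=-\partial_x[r(x)f(x,t)]-(a(x)+a_1(x))f(x,t)+\int_x^\infty a(y)b(x,y)f(y,t)\,dy,\qquad x,t>0,$$ under the following assumptions. - $1/r\in L_{1,loc}(\mathbb R_+)$ and $0<r(x)\le r_0+r_1x$ on $\mathbb R_+$, with constants $r_0,r_1\ge 0$. - $0\le a,a_1\in L_{\infty,loc}([0,\infty))$, and $a_1(x)/a(x)$ remains bounded as $x\to\infty$. - $b\ge 0$ is measurable, $b(x,y)=0$ for $x>y$, and $\int_0^y x\,b(x,y)\,dx=y$ for every $y>0$. - With $n_m(y)=\int_0^y x^m b(x,y)\,dx$, there are $b_0>0$ and $l\ge 0$ such that $n_0(y)\le b_0(1+y^l)$ for all $y>0$, and there is $m_0>1$ such that $\liminf_{y\to\infty}\big(y^{m_0}-n_{m_0}(y)\big)/y^{m_0}>0$. - There are positive constants $a_0,\gamma_0,x_0$ such that $a(x)\ge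 a_0x^{\gamma_0}$ for all $x\ge x_0$. For $p>\max\{1,l\}$ let $G_{0,p}$ be the operator in $X_{0,p}$ given by $$(G_{0,p}f)(x)=-\frac{d}{dx}(r(x)f(x))-(a(x)+a_1(x))f(x)+\int_x^\infty a(y)b(x,y)f(y)\,dy$$ on the domain of all $f\in X_{0,p}$ such that $rf$ is absolutely continuous on compact subintervals of $\mathbb R_+$, $\frac{d}{dx}(rf)\in X_{0,p}$, $(a+a_1)f\in X_{0,p}$ and, if $1/r$ is integrable near $0$, moreover $r(x)f(x)\to 0$ as $x\to 0^+$. Then, for every $p>\max\{1,l\}$, $G_{0,p}$ generates a strongly continuous semigroup $(S_{G_{0,p}}(t))_{t\ge 0}$ on $X_{0,p}$. Moreover, for all $n,p,m$ with $\max\{1,l\}<n<p<m$ there are constants $C=C(m,n,p)>0$ and $\theta=\theta(m,n)>0$, the latter independent of $p$, such that $$\|S_{G_{0,p}}(t)f\|_{[0,m]}\le C\,e^{\theta t}\,t^{\frac{n-m}{\gamma_0}}\,\|f\|_{[0,p]}\qquad\text{for all } f\in X_{0,p} \text{ and } t>0;$$ in particular $S_{G_{0,p}}(t)f\in X_{0,m}$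 for all $t>0$. -/

import Mathlib

open MeasureTheory Filter Set
open scoped Topology ENNReal

noncomputable section

namespace GrowthFragmentation

/-- The measure `(1 + x ^ m) dx` on `(0, ∞)`. -/
def weightMeasure (m : ℝ) : Measure ℝ :=
  (volume.restrict (Ioi (0 : ℝ))).withDensity fun x => ENNReal.ofReal (1 + x ^ m)

/-- The Banach space `X_{0,m} = L₁((0, ∞), (1 + x ^ m) dx)`; its norm is `‖·‖_{[0,m]}`. -/
abbrev X (m : ℝ) : Type := Lp ℝ 1 (weightMeasure m)

/-- `‖f‖_{[0,m]} = ∫₀^∞ |f(x)| (1 + x ^ m) dx`, as an extended real, for a function `f` that need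
not belong to `X m`. -/
def momentNorm (m : ℝ) (f : ℝ → ℝ) : ℝ≥0∞ := eLpNorm f 1 (weightMeasure m)

/-- Membership in `L_{∞,loc}([0, ∞))`. -/
def LocEssBounded (a : ℝ → ℝ) : Prop :=
  ∀ R : ℝ, MemLp a ∞ (volume.restrict (Ioc 0 R))

/-- `n_m(y) = ∫₀^y b(x, y) x ^ m dx`, as an extended real. -/
def daughterMoment (b : ℝ → ℝ → ℝ) (m y : ℝ) : ℝ≥0∞ :=
  ∫⁻ x in Ioc 0 y, ENNReal.ofReal (b x y * x ^ m)

/-- `N_m(y) = y ^ m - n_m(y)`. It is used only for `m > 1`, where conservation of mass gives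
`n_m(y) ≤ y ^ m < ∞`. -/
def momentLoss (b : ℝ → ℝ → ℝ) (m y : ℝ) : ℝ :=
  y ^ m - (daughterMoment b m y).toReal

/-- `f` belongs to the domain of the transport operator `T_{0,m} f = -(r f)' - q f`, and `F` is the
locally absolutely continuous representative of `r f` on `(0, ∞)`. The boundary condition at `0` is
imposed exactly when `1 / r` is integrable near `0`. -/
structure IsTransportFlux (r q : ℝ → ℝ) (m : ℝ) (f : X m) (F : ℝ → ℝ) : Prop where
  rep : F =ᵐ[volume.restrict (Ioi (0 : ℝ))] fun x => r x * f x
  ac : ∀ x y : ℝ, 0 < x → x < y → AbsolutelyContinuousOnInterval F x y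
  deriv_mem : MemLp (deriv F) 1 (weightMeasure m)
  absorption_mem : MemLp (fun x => q x * f x) 1 (weightMeasure m)
  boundary : IntegrableAtFilter (fun x => 1 / r x) (𝓝[>] (0 : ℝ)) →
    Tendsto F (𝓝[>] (0 : ℝ)) (𝓝 0)

/-- The gain operator `(B f)(x) = ∫_x^∞ a(y) b(x, y) f(y) dy`. -/
def gain (a : ℝ → ℝ) (b : ℝ → ℝ → ℝ) (f : ℝ → ℝ) (x : ℝ) : ℝ :=
  ∫ y in Ioi x, a y * b x y * f y

/-- The graph of `G_{0,m} = T_{0,m} + B_{0,m}` in `X_{0,m} × X_{0,m}`: the pairs `(f, g)` with `f` in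
the domain of `T_{0,m}` and `g = -(r f)' - (a + a₁) f + B f` almost everywhere on `(0, ∞)`. -/
def generatorGraph (r a a₁ : ℝ → ℝ) (b : ℝ → ℝ → ℝ) (m : ℝ) : Set (X m × X m) :=
  {fg | ∃ F : ℝ → ℝ, IsTransportFlux r (fun x => a x + a₁ x) m fg.1 F ∧
    fg.2 =ᵐ[volume.restrict (Ioi (0 : ℝ))]
      fun x => -deriv F x - (a x + a₁ x) * fg.1 x + gain a b fg.1 x}

/-- `(S t)_{t ≥ 0}` is a strongly continuous semigroup of bounded operators on `E`
(the values at negative times play no role). -/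
structure IsC0Semigroup {E : Type*} [NormedAddCommGroup E] [NormedSpace ℝ E]
    (S : ℝ → E →L[ℝ] E) : Prop where
  zero : S 0 = ContinuousLinearMap.id ℝ E
  add : ∀ s t : ℝ, 0 ≤ s → 0 ≤ t → S (s + t) = (S s).comp (S t)
  cont : ∀ f : E, ContinuousOn (fun t => S t f) (Ici 0)

/-- `(S t)_{t ≥ 0}` is a strongly continuous semigroup whose infinitesimal generator, domain
included, is the operator with graph `G`. -/
def IsSemigroupGeneratedBy {E : Type*} [NormedAddCommGroup E] [NormedSpace ℝ E]
    (S : ℝ → E →L[ℝ] E) (G : Set (E × E)) : Prop :=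
  IsC0Semigroup S ∧
    ∀ f g : E, (f, g) ∈ G ↔ Tendsto (fun h : ℝ => h⁻¹ • (S h f - f)) (𝓝[>] 0) (𝓝 g)

end GrowthFragmentation

end

/-! Everything rests on one dissipation inequality. For `f` in the domain, multiply the resolvent
equation by `sign f` and by the weight `1 + x ^ m` and integrate. Transport raises the weight at
relative rate at most `m * (r₀ + r₁)`, because `r` grows at most linearly, and no mass enters at
`0`, because the flux `r f` vanishes there. Fragmentation of a particle of size `y` replaces its
weight by `n_0(y) + n_m(y)`. Since `m > max 1 l`, the term `n_0` is negligible against `y ^ m` for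
large `y`, while `n_m(y) ≤ (1 - δ) y ^ m`. So the gain is at most `(1 - c) a + C` times the weight
(`KernelData.exists_gain_weight_le`), and with `ω = m * (r₀ + r₁) + C` one gets `(k - ω) ‖f‖ + c ∫ a
|f| ≤ ‖k f - G f‖` (`ModelData.graph_dissipative`). The surplus `c ∫ a |f|` is what drives the
regularization.

Generation follows from a Hille–Yosida theorem for quasi-dissipative graphs
(`IsQuasiDissipativeGraph.exists_semigroup`). The transport resolvent is an explicit
integrating-factor formula (`TransportData.exists_flux`). For large `k` the gain composed with it is
a strict contraction, so `k - G` is onto (`ModelData.graph_range`). The quotients `φ / r`, with `φ`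
Lipschitz and compactly supported in `(0, ∞)`, lie in the domain and are dense.

For the moment estimate put `β = (m - n) / γ₀`. Since `a(x) ≥ a₀ x ^ γ₀` for large `x`, the surplus
dominates `(β + 1) / t` times the `m`-norm up to `D / t * (1 + t ^ (-β))` times the `n`-norm
(`exists_weight_interpolation`). Along an orbit, `t ^ (β + 1) * exp (-θ t) * ‖S t f‖` therefore
grows at most linearly, with slope proportional to the initial `n`-norm, and division by `t ^ (β +
1)` gives the singularity `t ^ (-β)`. This is proved for data in the domain in `X m`
(`ModelData.exists_norm_apply_le`), then carried to `X p` by consistency of the semigroups, density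
and lower semicontinuity of the `m`-norm (`ModelData.momentNorm_apply_le`). -/

noncomputable section

namespace GrowthFragmentation

/-! ### Norm growth along orbits of dissipative evolutions -/

section Abstract

variable {E : Type*} [NormedAddCommGroup E] [NormedSpace ℝ E]

/-- A backward Euler inequality for the left derivative bounds the growth of the norm. -/
theorem norm_le_add_mul_of_backward_step {v v' : ℝ → E} {T C : ℝ} (hT : 0 ≤ T)
    (hcont : ContinuousOn v (Icc 0 T))
    (hderiv : ∀ t ∈ Ioc 0 T, HasDerivWithinAt v (v' t) (Iic t) t)
    (hstep : ∀ t ∈ Ioc 0 T, ∀ᶠ k : ℝ in atTop, k * ‖v t‖ ≤ ‖k • v t - v' t‖ + C) :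
    ‖v T‖ ≤ ‖v 0‖ + C * T := by
  have hmaps : MapsTo (fun s : ℝ => T - s) (Icc 0 T) (Icc 0 T) := fun s hs =>
    ⟨by linarith [hs.2], by linarith [hs.1]⟩
  -- Reversing time turns the left derivative into a right one. The comparison principle then bounds
  -- `-‖v (T - s)‖` by `-‖v T‖ + C * s`, and `s = T` is the claim.
  have key := image_le_of_liminf_slope_right_le_deriv_boundary
    (f := fun s => -‖v (T - s)‖) (a := 0) (b := T) (B := fun s => -‖v T‖ + C * s)
    (B' := fun _ => C)
    ((hcont.comp (by fun_prop) hmaps).norm.neg) (by simp) (by fun_prop)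
    (fun s _ => by
      simpa using (((hasDerivWithinAt_id s (Ici s)).const_mul C).const_add (-‖v T‖))) ?_
    (right_mem_Icc.2 hT)
  · simp only [sub_self] at key
    linarith
  intro s hs r hr
  have ht : T - s ∈ Ioc 0 T := ⟨by linarith [hs.2], by linarith [hs.1]⟩
  set t := T - s with ht_def
  have hε : 0 < (r - C) / 2 := by linarith
  have h1 : ∀ᶠ x in 𝓝[≤] t, ‖v x - v t - (x - t) • v' t‖ ≤ (r - C) / 2 * ‖x - t‖ :=
    (hasDerivWithinAt_iff_isLittleO.1 (hderiv t ht)).def hε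
  have hlim : Tendsto (fun z : ℝ => T - z) (𝓝[>] s) (𝓝[≤] t) := by
    refine tendsto_nhdsWithin_iff.2 ⟨?_, ?_⟩
    · exact ((continuous_const.sub continuous_id).tendsto' s t rfl).mono_left nhdsWithin_le_nhds
    · filter_upwards [self_mem_nhdsWithin] with z hz
      simp only [mem_Ioi] at hz
      simp only [mem_Iic, ht_def]
      linarith
  have hlim2 : Tendsto (fun z : ℝ => (z - s)⁻¹) (𝓝[>] s) atTop := by
    refine tendsto_inv_nhdsGT_zero.comp (tendsto_nhdsWithin_iff.2 ⟨?_, ?_⟩)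
    · exact ((continuous_id.sub continuous_const).tendsto' s 0 (by simp)).mono_left
        nhdsWithin_le_nhds
    · filter_upwards [self_mem_nhdsWithin] with z hz
      simpa using hz
  refine Eventually.frequently ?_
  -- The hypothesis is used with `k = (z - s)⁻¹`, which makes it one implicit Euler step of length
  -- `z - s`.
  filter_upwards [hlim.eventually h1, hlim2.eventually (hstep t ht), self_mem_nhdsWithin]
    with z hz1 hz2 hz3
  have hpos : 0 < z - s := sub_pos.2 hz3
  have e1 : T - z - t = -(z - s) := by rw [ht_def]; ring
  rw [e1, norm_neg, Real.norm_of_nonneg hpos.le, neg_smul, sub_neg_eq_add] at hz1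
  have h3 : ‖v t‖ ≤ ‖v t - (z - s) • v' t‖ + (z - s) * C := by
    have h4 := mul_le_mul_of_nonneg_left hz2 hpos.le
    rw [mul_add, ← mul_assoc, mul_inv_cancel₀ hpos.ne', one_mul] at h4
    have h5 : (z - s) * ‖(z - s)⁻¹ • v t - v' t‖ = ‖v t - (z - s) • v' t‖ := by
      rw [← Real.norm_of_nonneg hpos.le, ← norm_smul, Real.norm_of_nonneg hpos.le, smul_sub,
        smul_smul, mul_inv_cancel₀ hpos.ne', one_smul]
    rwa [h5] at h4
  have h6 : ‖v t - (z - s) • v' t‖ ≤ ‖v (T - z)‖ + (r - C) / 2 * (z - s) := by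
    calc ‖v t - (z - s) • v' t‖
        = ‖v (T - z) - (v (T - z) - v t + (z - s) • v' t)‖ := by congr 1; abel
      _ ≤ ‖v (T - z)‖ + ‖v (T - z) - v t + (z - s) • v' t‖ := norm_sub_le _ _
      _ ≤ _ := by gcongr
  rw [slope_def_field, div_lt_iff₀ hpos]
  change -‖v (T - z)‖ - -‖v t‖ < _
  nlinarith

/-- Weighted form of `norm_le_add_mul_of_backward_step`. -/
theorem mul_norm_le_of_backward_step {v v' : ℝ → E} {ρ ρ' D : ℝ → ℝ} {T C : ℝ} (hT : 0 ≤ T)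
    (hcont : ContinuousOn v (Icc 0 T))
    (hderiv : ∀ t ∈ Ioc 0 T, HasDerivWithinAt v (v' t) (Iic t) t)
    (hρ0 : 0 ≤ ρ 0) (hρ : ∀ t ∈ Ioc 0 T, 0 < ρ t) (hρc : ContinuousOn ρ (Icc 0 T))
    (hρ' : ∀ t ∈ Ioc 0 T, HasDerivAt ρ (ρ' t) t)
    (hstep : ∀ t ∈ Ioc 0 T, ∀ᶠ k : ℝ in atTop, k * ‖v t‖ + D t ≤ ‖k • v t - v' t‖)
    (hD : ∀ t ∈ Ioc 0 T, ρ' t * ‖v t‖ ≤ ρ t * D t + C) :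
    ρ T * ‖v T‖ ≤ ρ 0 * ‖v 0‖ + C * T := by
  have key := norm_le_add_mul_of_backward_step (v := fun t => ρ t • v t)
    (v' := fun t => ρ t • v' t + ρ' t • v t) (C := C) hT (hρc.smul hcont)
    (fun t ht => ((hρ' t ht).hasDerivWithinAt.smul (hderiv t ht))) ?_
  · have hρT : 0 ≤ ρ T := by
      rcases hT.eq_or_lt with h | h
      · rwa [← h]
      · exact (hρ T ⟨h, le_rfl⟩).le
    simpa [norm_smul, abs_of_nonneg hρT, abs_of_nonneg hρ0] using key
  intro t ht
  have hpos := hρ t ht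
  -- The derivative of the weight is absorbed by shifting `k` to `k - ρ' / ρ`. This is possible
  -- because the step inequality is available for all large `k`.
  have hlim : Tendsto (fun k : ℝ => k - ρ' t / ρ t) atTop atTop :=
    tendsto_atTop_add_const_right atTop (-(ρ' t / ρ t)) tendsto_id
  filter_upwards [hlim.eventually (hstep t ht)] with k hk
  have e : k • ρ t • v t - (ρ t • v' t + ρ' t • v t)
      = ρ t • ((k - ρ' t / ρ t) • v t - v' t) := by
    have : ρ t * (k - ρ' t / ρ t) = k * ρ t - ρ' t := by field_simp
    rw [smul_sub, smul_smul, smul_smul, this, sub_smul]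
    abel
  rw [e, norm_smul, norm_smul, Real.norm_of_nonneg hpos.le]
  have h1 := mul_le_mul_of_nonneg_left hk hpos.le
  have h2 := hD t ht
  have h3 : ρ t * ((k - ρ' t / ρ t) * ‖v t‖ + D t)
      = k * (ρ t * ‖v t‖) - ρ' t * ‖v t‖ + ρ t * D t := by field_simp
  linarith

/-- Gronwall form: the weight `exp (-(c * t))` cancels the growth rate `c`. -/
theorem norm_le_exp_mul_of_backward_step {v v' : ℝ → E} {T c : ℝ} (hT : 0 ≤ T)
    (hcont : ContinuousOn v (Icc 0 T))
    (hderiv : ∀ t ∈ Ioc 0 T, HasDerivWithinAt v (v' t) (Iic t) t)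
    (hstep : ∀ t ∈ Ioc 0 T, ∀ᶠ k : ℝ in atTop, (k - c) * ‖v t‖ ≤ ‖k • v t - v' t‖) :
    ‖v T‖ ≤ Real.exp (c * T) * ‖v 0‖ := by
  have key := mul_norm_le_of_backward_step (ρ := fun t => Real.exp (-(c * t)))
    (ρ' := fun t => Real.exp (-(c * t)) * -c) (D := fun t => -(c * ‖v t‖)) (C := 0) hT hcont hderiv
    (Real.exp_pos _).le (fun t _ => Real.exp_pos _) (by fun_prop)
    (fun t _ => by simpa using (((hasDerivAt_id t).const_mul c).neg.exp))
    (fun t ht => by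
      filter_upwards [hstep t ht] with k hk
      linarith)
    (fun t _ => by linarith)
  simp only [mul_zero, neg_zero, Real.exp_zero, one_mul, zero_mul, add_zero] at key
  rwa [Real.exp_neg, inv_mul_le_iff₀ (Real.exp_pos _)] at key

variable {S : ℝ → E →L[ℝ] E} {G : Set (E × E)}

/-- Holds because `S t` is continuous and commutes with the difference quotients at zero. -/
theorem IsSemigroupGeneratedBy.apply_mem (hS : IsSemigroupGeneratedBy S G) {f g : E}
    (hfg : (f, g) ∈ G) {t : ℝ} (ht : 0 ≤ t) : (S t f, S t g) ∈ G := by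
  rw [hS.2]
  have h := ((S t).continuous.tendsto g).comp ((hS.2 f g).1 hfg)
  refine h.congr' ?_
  filter_upwards [self_mem_nhdsWithin] with h hh
  have hh : 0 ≤ h := le_of_lt hh
  have e : S h (S t f) = S t (S h f) := by
    rw [← ContinuousLinearMap.comp_apply, ← ContinuousLinearMap.comp_apply, ← hS.1.add h t hh ht,
      ← hS.1.add t h ht hh, add_comm]
  simp [e]

theorem IsC0Semigroup.exists_norm_le [CompleteSpace E] (hS : IsC0Semigroup S) (T : ℝ) :
    ∃ C : ℝ, ∀ t ∈ Icc 0 T, ‖S t‖ ≤ C := by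
  obtain ⟨C, hC⟩ := banach_steinhaus (g := fun t : Icc (0 : ℝ) T => S t) fun x => by
    obtain ⟨C, hC⟩ := isCompact_Icc.exists_bound_of_continuousOn
      ((hS.cont x).mono (fun t ht => ht.1 : Icc 0 T ⊆ Ici 0))
    exact ⟨C, fun t => hC t t.2⟩
  exact ⟨C, fun t ht => hC ⟨t, ht⟩⟩

/-- The left derivative is the one that dissipation estimates need, as `v t - h • v' t` approximates
the past value `v (t - h)`. The left quotient is `S s` applied to a quotient at zero. Local
boundedness of `S` allows the limit although `s` varies. -/
theorem IsSemigroupGeneratedBy.hasDerivWithinAt_Iic [CompleteSpace E]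
    (hS : IsSemigroupGeneratedBy S G) {f g : E} (hfg : (f, g) ∈ G) {t : ℝ} (ht : 0 < t) :
    HasDerivWithinAt (fun t => S t f) (S t g) (Iic t) t := by
  obtain ⟨C, hC⟩ := hS.1.exists_norm_le t
  have h0 := (hS.2 f g).1 hfg
  rw [hasDerivWithinAt_iff_tendsto_slope, Iic_sdiff_right]
  have hlim : Tendsto (fun s : ℝ => t - s) (𝓝[<] t) (𝓝[>] 0) := by
    refine tendsto_nhdsWithin_iff.2 ⟨?_, ?_⟩
    · exact ((continuous_const.sub continuous_id).tendsto' t 0 (by simp)).mono_left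
        nhdsWithin_le_nhds
    · filter_upwards [self_mem_nhdsWithin] with s hs
      simpa using hs
  have hpos : ∀ᶠ s in 𝓝[<] t, 0 < s := nhdsWithin_le_nhds (lt_mem_nhds ht)
  have hcont : Tendsto (fun s => S s g) (𝓝[<] t) (𝓝 (S t g)) :=
    ((hS.1.cont g).continuousAt (Ici_mem_nhds ht)).tendsto.mono_left nhdsWithin_le_nhds
  have hzero : Tendsto (fun s => S s ((t - s)⁻¹ • (S (t - s) f - f) - g)) (𝓝[<] t) (𝓝 0) := by
    refine squeeze_zero_norm' (a := fun s => C * ‖(t - s)⁻¹ • (S (t - s) f - f) - g‖) ?_ ?_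
    · filter_upwards [hpos, self_mem_nhdsWithin] with s hs hst
      exact ((S s).le_opNorm _).trans (mul_le_mul_of_nonneg_right
        (hC s ⟨hs.le, le_of_lt hst⟩) (norm_nonneg _))
    · simpa using ((tendsto_iff_norm_sub_tendsto_zero.1 (h0.comp hlim)).const_mul C)
  have := hzero.add hcont
  rw [zero_add] at this
  refine this.congr' ?_
  filter_upwards [hpos, self_mem_nhdsWithin] with s hs hst
  have hst : s < t := hst
  have e : S s (S (t - s) f) = S t f := by
    rw [← ContinuousLinearMap.comp_apply, ← hS.1.add s (t - s) hs.le (by linarith)]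
    congr 2; ring
  rw [map_sub, sub_add_cancel, map_smul, map_sub, e, slope_def_module, ← neg_sub t s, inv_neg,
    neg_smul, ← smul_neg, neg_sub]

end Abstract

/-! ### Quasi-dissipative graphs and their resolvents -/

section HilleYosida

variable {E : Type*} [NormedAddCommGroup E] [NormedSpace ℝ E]

/-- A graph in `E × E` is that of a densely defined linear operator `A` for which `A - ω` is
dissipative and `k - A` is onto for all `k ≥ k₀`. -/
structure IsQuasiDissipativeGraph (G : Set (E × E)) (ω k₀ : ℝ) : Prop where
  lincomb : ∀ (c d : ℝ) {f₁ g₁ f₂ g₂ : E}, (f₁, g₁) ∈ G → (f₂, g₂) ∈ G →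
    (c • f₁ + d • f₂, c • g₁ + d • g₂) ∈ G
  dissipative : ∀ {k : ℝ}, k₀ ≤ k → ∀ {f g : E}, (f, g) ∈ G → (k - ω) * ‖f‖ ≤ ‖k • f - g‖
  range : ∀ {k : ℝ}, k₀ ≤ k → ∀ h : E, ∃ f g, (f, g) ∈ G ∧ k • f - g = h
  dense : ∀ f : E, ∀ ε > 0, ∃ f' g', (f', g') ∈ G ∧ ‖f - f'‖ < ε

variable {G : Set (E × E)} {ω k₀ : ℝ}

theorem IsQuasiDissipativeGraph.sub_mem (hG : IsQuasiDissipativeGraph G ω k₀) {f₁ g₁ f₂ g₂ : E}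
    (h₁ : (f₁, g₁) ∈ G) (h₂ : (f₂, g₂) ∈ G) : (f₁ - f₂, g₁ - g₂) ∈ G := by
  simpa [sub_eq_add_neg] using hG.lincomb 1 (-1) h₁ h₂

theorem IsQuasiDissipativeGraph.eq_of_sub_eq (hG : IsQuasiDissipativeGraph G ω k₀) {k : ℝ}
    (hk : k₀ ≤ k) (hkω : ω < k) {f₁ g₁ f₂ g₂ : E} (h₁ : (f₁, g₁) ∈ G) (h₂ : (f₂, g₂) ∈ G)
    (h : k • f₁ - g₁ = k • f₂ - g₂) : f₁ = f₂ := by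
  have h3 := hG.dissipative hk (hG.sub_mem h₁ h₂)
  have e : k • (f₁ - f₂) - (g₁ - g₂) = 0 := by
    rw [smul_sub, sub_sub_sub_comm, h, sub_self]
  rw [e, norm_zero] at h3
  have h4 : ‖f₁ - f₂‖ ≤ 0 := by
    by_contra! hc
    exact absurd h3 (not_le.2 (mul_pos (by linarith) hc))
  exact sub_eq_zero.1 (norm_le_zero_iff.1 h4)

/-- The resolvent `(k - A)⁻¹` as a bounded operator. -/
theorem IsQuasiDissipativeGraph.exists_resolvent (hG : IsQuasiDissipativeGraph G ω k₀) {k : ℝ}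
    (hk : k₀ ≤ k) (hkω : ω < k) :
    ∃ R : E →L[ℝ] E, (∀ h, ‖R h‖ ≤ (k - ω)⁻¹ * ‖h‖) ∧ (∀ h, (R h, k • R h - h) ∈ G) ∧
      ∀ {f g}, (f, g) ∈ G → R (k • f - g) = f := by
  choose R g hR hRg using hG.range hk
  have hg : ∀ h, g h = k • R h - h := fun h => 
    eq_sub_of_add_eq (by rw [add_comm]; exact (sub_eq_iff_eq_add.1 (hRg h)).symm)
  have huniq : ∀ {f g h}, (f, g) ∈ G → k • f - g = h → R h = f := fun {f g' h} hf he =>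
    hG.eq_of_sub_eq hk hkω (hR h) hf (by rw [hRg, he])
  have hlin : ∀ (c d : ℝ) (x y : E), R (c • x + d • y) = c • R x + d • R y := fun c d x y => by
    refine huniq (hG.lincomb c d (hR x) (hR y)) ?_
    rw [hg, hg]
    module
  have hb : ∀ h, ‖R h‖ ≤ (k - ω)⁻¹ * ‖h‖ := fun h => by
    rw [← div_eq_inv_mul, le_div_iff₀ (by linarith), mul_comm]
    simpa [hRg] using hG.dissipative hk (hR h)
  let L : E →ₗ[ℝ] E :=
    { toFun := R
      map_add' := fun x y => by simpa using hlin 1 1 x y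
      map_smul' := fun c x => by simpa using hlin c 0 x 0 }
  refine ⟨L.mkContinuous _ hb, hb, fun h => ?_, fun {f g} hf => huniq hf rfl⟩
  change (R h, k • R h - h) ∈ G
  rw [← hg]
  exact hR h

end HilleYosida

/-! ### Exponentials of bounded operators and limits of such semigroups -/

section BoundedSemigroups

theorem commute_exp_smul {E : Type*} [NormedAddCommGroup E] [NormedSpace ℝ E]
    {A B : E →L[ℝ] E} (h : Commute A B) (t : ℝ) :
    Commute A (NormedSpace.exp (t • B)) := by
  let : NormedAlgebra ℚ (E →L[ℝ] E) := NormedAlgebra.restrictScalars ℚ ℝ _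
  exact (h.smul_right t).exp_right

variable {E : Type*} [NormedAddCommGroup E] [NormedSpace ℝ E] [CompleteSpace E]

theorem exp_smul_add (A : E →L[ℝ] E) (s t : ℝ) :
    NormedSpace.exp ((s + t) • A) = NormedSpace.exp (s • A) * NormedSpace.exp (t • A) := by
  let : NormedAlgebra ℚ (E →L[ℝ] E) := NormedAlgebra.restrictScalars ℚ ℝ _
  rw [add_smul, NormedSpace.exp_add_of_commute]
  exact ((Commute.refl A).smul_left s).smul_right t

theorem hasDerivAt_exp_smul_apply (A : E →L[ℝ] E) (f : E) (t : ℝ) :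
    HasDerivAt (fun t : ℝ => NormedSpace.exp (t • A) f) (A (NormedSpace.exp (t • A) f)) t := by
  have h := (hasDerivAt_exp_smul_const' (𝕂 := ℝ) A t).clm_apply (hasDerivAt_const t f)
  simpa using h

/-- Two commuting bounded generators with growth bound `c` generate semigroups whose difference is
controlled by the difference of the generators. -/
theorem norm_exp_smul_sub_le {A B : E →L[ℝ] E} (hAB : Commute A B) {c T : ℝ} (hc : 0 ≤ c)
    (hA : ∀ t, 0 ≤ t → ∀ f, ‖NormedSpace.exp (t • A) f‖ ≤ Real.exp (c * t) * ‖f‖)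
    (hB : ∀ t, 0 ≤ t → ∀ f, ‖NormedSpace.exp (t • B) f‖ ≤ Real.exp (c * t) * ‖f‖)
    {t : ℝ} (ht : t ∈ Icc 0 T) (f : E) :
    ‖NormedSpace.exp (t • A) f - NormedSpace.exp (t • B) f‖
      ≤ Real.exp (c * T) * ‖A f - B f‖ * T := by
  -- The path `exp ((t - s) B) exp (s A) f` joins the two vectors to be compared. Commutation lets
  -- its derivative be written with `A f - B f` innermost.
  have hd : ∀ s : ℝ, HasDerivAt
      (fun s => NormedSpace.exp ((t - s) • B) (NormedSpace.exp (s • A) f))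
      (NormedSpace.exp ((t - s) • B) (NormedSpace.exp (s • A) (A f - B f))) s := by
    intro s
    have h1 : HasDerivAt (fun s : ℝ => NormedSpace.exp ((t - s) • B))
        ((-1 : ℝ) • (NormedSpace.exp ((t - s) • B) * B)) s :=
      (hasDerivAt_exp_smul_const (𝕂 := ℝ) B (t - s)).scomp s ((hasDerivAt_id s).const_sub t)
    have h2 := h1.clm_apply (hasDerivAt_exp_smul_apply A f s)
    refine h2.congr_deriv ?_
    have c1 : A (NormedSpace.exp (s • A) f) = NormedSpace.exp (s • A) (A f) :=
      congrArg (fun L : E →L[ℝ] E => L f) (commute_exp_smul (Commute.refl A) s).eq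
    have c2 : B (NormedSpace.exp (s • A) f) = NormedSpace.exp (s • A) (B f) :=
      congrArg (fun L : E →L[ℝ] E => L f) (commute_exp_smul hAB.symm s).eq
    simp [c1, c2]
    abel
  have hb : ∀ s ∈ Ico 0 t,
      ‖NormedSpace.exp ((t - s) • B) (NormedSpace.exp (s • A) (A f - B f))‖
        ≤ Real.exp (c * T) * ‖A f - B f‖ := by
    intro s hs
    calc _ ≤ Real.exp (c * (t - s)) * (Real.exp (c * s) * ‖A f - B f‖) :=
          (hB _ (by linarith [hs.2]) _).trans (by gcongr; exact hA s hs.1 _)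
      _ = Real.exp (c * t) * ‖A f - B f‖ := by
          rw [← mul_assoc, ← Real.exp_add]; ring_nf
      _ ≤ _ := by gcongr; exact ht.2
  have key := norm_image_sub_le_of_norm_deriv_le_segment' (fun s _ => (hd s).hasDerivWithinAt) hb t
    (right_mem_Icc.2 ht.1)
  simp only [sub_self, zero_smul, NormedSpace.exp_zero, sub_zero,
    one_apply_eq_self] at key
  refine key.trans ?_
  gcongr
  exact ht.2

/-- A locally uniformly Cauchy sequence of norm continuous semigroups converges to a strongly
continuous semigroup. -/
theorem exists_limit_semigroup {A : ℕ → E →L[ℝ] E}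
    (hcauchy : ∀ f (T : ℝ), UniformCauchySeqOn (fun n t => NormedSpace.exp (t • A n) f) atTop (Icc 0 T)) :
    ∃ S : ℝ → E →L[ℝ] E, IsC0Semigroup S ∧ ∀ f (T : ℝ), TendstoUniformlyOn
      (fun n t => NormedSpace.exp (t • A n) f) (fun t => S t f) atTop (Icc 0 T) := by
  -- Cutting time off at `0` defines an operator for every real `t`. Its values at negative times
  -- are irrelevant.
  have hlim : ∀ (t : ℝ) f, ∃ y, Tendsto (fun n => NormedSpace.exp ((max t 0) • A n) f) atTop (𝓝 y) :=
    fun t f => cauchySeq_tendsto_of_complete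
      ((hcauchy f (max t 0)).cauchySeq ⟨le_max_right _ _, le_rfl⟩)
  choose S₀ hS₀ using hlim
  let S : ℝ → E →L[ℝ] E := fun t =>
    continuousLinearMapOfTendsto _ (tendsto_pi_nhds.2 (hS₀ t))
  have hS : ∀ {t : ℝ}, 0 ≤ t → ∀ f, Tendsto (fun n => NormedSpace.exp (t • A n) f) atTop (𝓝 (S t f)) :=
    fun {t} ht f => by
      have := hS₀ t f
      rwa [max_eq_left ht] at this
  have hunif : ∀ f (T : ℝ), TendstoUniformlyOn
      (fun n t => NormedSpace.exp (t • A n) f) (fun t => S t f) atTop (Icc 0 T) :=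
    fun f T => (hcauchy f T).tendstoUniformlyOn_of_tendsto fun t ht => hS ht.1 f
  have hcont : ∀ f, ContinuousOn (fun t => S t f) (Ici 0) := fun f t ht => by
    have h1 : ContinuousOn (fun t => S t f) (Icc 0 (t + 1)) :=
      (hunif f (t + 1)).continuousOn (Frequently.of_forall fun n =>
        (continuous_iff_continuousAt.2 fun s =>
          (hasDerivAt_exp_smul_apply (A n) f s).continuousAt).continuousOn)
    refine (h1 t ⟨ht, by linarith⟩).mono_of_mem_nhdsWithin ?_
    filter_upwards [self_mem_nhdsWithin, nhdsWithin_le_nhds (gt_mem_nhds (lt_add_one t))]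
      with s h1 h2 using ⟨h1, h2.le⟩
  refine ⟨S, ⟨?_, ?_, hcont⟩, hunif⟩
  · ext f
    refine tendsto_nhds_unique (hS le_rfl f) ?_
    simp
  · intro s t hs ht
    ext f
    refine tendsto_nhds_unique (hS (add_nonneg hs ht) f) ?_
    -- Uniform boundedness at the fixed time `s` is needed to pass to the limit in a product of two
    -- strongly convergent sequences.
    obtain ⟨C, hC⟩ := banach_steinhaus (g := fun n => NormedSpace.exp (s • A n)) fun x => by
      obtain ⟨C, hC⟩ := isBounded_iff_forall_norm_le.1 (Metric.isBounded_range_of_tendsto _ (hS hs x))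
      exact ⟨C, fun n => hC _ ⟨n, rfl⟩⟩
    have h0 : Tendsto (fun n => NormedSpace.exp (s • A n) (NormedSpace.exp (t • A n) f - S t f))
        atTop (𝓝 0) := by
      refine squeeze_zero_norm (a := fun n => C * ‖NormedSpace.exp (t • A n) f - S t f‖)
        (fun n => ((NormedSpace.exp (s • A n)).le_opNorm _).trans
          (mul_le_mul_of_nonneg_right (hC n) (norm_nonneg _))) ?_
      simpa using (tendsto_iff_norm_sub_tendsto_zero.1 (hS ht f)).const_mul C
    have h1 := h0.add (hS hs (S t f))
    rw [zero_add] at h1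
    refine h1.congr fun n => ?_
    rw [exp_smul_add, map_sub, sub_add_cancel]
    rfl

end BoundedSemigroups

/-! ### Generation theorem by Yosida approximation -/

section HilleYosidaTheorem

variable {E : Type*} [NormedAddCommGroup E] [NormedSpace ℝ E] [CompleteSpace E]
  {G : Set (E × E)} {ω k₀ : ℝ}

/-- The growth bound for the semigroup generated by a Yosida approximation. -/
theorem norm_exp_yosida_le {R : E →L[ℝ] E} {k : ℝ} (hω : 0 ≤ ω) (hk : 2 * ω < k)
    (hR : ∀ h, ‖R h‖ ≤ (k - ω)⁻¹ * ‖h‖) {t : ℝ} (ht : 0 ≤ t) (f : E) :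
    ‖NormedSpace.exp (t • (k ^ 2 • R - k • (1 : E →L[ℝ] E))) f‖
      ≤ Real.exp (2 * ω * t) * ‖f‖ := by
  set A : E →L[ℝ] E := k ^ 2 • R - k • (1 : E →L[ℝ] E) with hA
  have key := norm_le_exp_mul_of_backward_step (c := 2 * ω) ht
    (v := fun t => NormedSpace.exp (t • A) f) (v' := fun t => A (NormedSpace.exp (t • A) f))
    (fun s _ => (hasDerivAt_exp_smul_apply A f s).continuousAt.continuousWithinAt)
    (fun s _ => (hasDerivAt_exp_smul_apply A f s).hasDerivWithinAt) ?_
  · simpa using key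
  intro s _
  filter_upwards [eventually_ge_atTop 0] with j hj
  set y := NormedSpace.exp (s • A) f
  have e : j • y - A y = (j + k) • y - k ^ 2 • R y := by
    simp [hA, add_smul]
    abel
  have hkω : 0 < k - ω := by linarith
  -- After clearing the denominator this is `0 ≤ ω * (k - 2 * ω)`, the reason for the doubled
  -- exponent and for the condition on `k`.
  have h1 : k ^ 2 * ((k - ω)⁻¹ * ‖y‖) ≤ (k + 2 * ω) * ‖y‖ := by
    rw [← mul_assoc, ← div_eq_mul_inv]
    gcongr
    rw [div_le_iff₀ hkω]
    nlinarith
  rw [e]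
  calc (j - 2 * ω) * ‖y‖ ≤ (j + k) * ‖y‖ - k ^ 2 * ((k - ω)⁻¹ * ‖y‖) := by linarith
    _ ≤ ‖(j + k) • y‖ - ‖k ^ 2 • R y‖ := by
      rw [norm_smul, norm_smul, Real.norm_of_nonneg (by linarith : 0 ≤ j + k),
        Real.norm_of_nonneg (sq_nonneg k)]
      gcongr
      exact hR y
    _ ≤ _ := norm_sub_norm_le _ _

/-- The generation theorem for densely defined quasi-dissipative operators with full range. -/
theorem IsQuasiDissipativeGraph.exists_semigroup (hG : IsQuasiDissipativeGraph G ω k₀)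
    (hω : 0 ≤ ω) : ∃ S : ℝ → E →L[ℝ] E, IsSemigroupGeneratedBy S G := by
  -- The parameters exceed `k₀` so that resolvents exist, and exceed `2 * ω` strictly, which gives
  -- the growth bound and also the uniqueness at the end.
  set κ : ℕ → ℝ := fun n => max k₀ (2 * ω + 1) + n with hκ
  have hκ₀ : ∀ n, k₀ ≤ κ n := fun n => (le_max_left k₀ (2 * ω + 1)).trans (by simp [hκ])
  have hκω : ∀ n, 2 * ω < κ n := fun n =>
    (by linarith : 2 * ω < 2 * ω + 1).trans_le ((le_max_right k₀ (2 * ω + 1)).trans (by simp [hκ]))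
  have hκω' : ∀ n, 0 < κ n - ω := fun n => by linarith [hκω n]
  have hκ_lim : Tendsto κ atTop atTop :=
    tendsto_atTop_add_const_left _ _ tendsto_natCast_atTop_atTop
  choose R hR_norm hR_mem hR_inv using fun n =>
    hG.exists_resolvent (hκ₀ n) (by linarith [hκω n] : ω < κ n)
  -- Yosida approximations: on the domain they equal `κ n • R n` applied to the image, and `κ n • R
  -- n` tends strongly to the identity.
  set A : ℕ → E →L[ℝ] E := fun n => κ n ^ 2 • R n - κ n • (1 : E →L[ℝ] E) with hA
  have hA_mem : ∀ n {f g}, (f, g) ∈ G → A n f = κ n • R n g := fun n {f g} hfg => by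
    have h := hR_inv n hfg
    rw [map_sub, map_smul, sub_eq_iff_eq_add] at h
    simp only [hA, sub_apply, smul_apply, one_apply_eq_self]
    rw [pow_two, mul_smul, h, smul_add, add_sub_cancel_left]
  have hR_two : ∀ n h, ‖κ n • R n h‖ ≤ 2 * ‖h‖ := fun n h => by
    have hκp : 0 ≤ κ n := by linarith [hκω n]
    rw [norm_smul, Real.norm_of_nonneg hκp]
    calc κ n * ‖R n h‖ ≤ κ n * ((κ n - ω)⁻¹ * ‖h‖) := by gcongr; exact hR_norm n h
      _ = κ n / (κ n - ω) * ‖h‖ := by rw [← mul_assoc, div_eq_mul_inv]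
      _ ≤ 2 * ‖h‖ := by
        gcongr
        rw [div_le_iff₀ (hκω' n)]
        linarith [hκω n]
  have hR_lim_dom : ∀ {f g}, (f, g) ∈ G → Tendsto (fun n => κ n • R n f) atTop (𝓝 f) := by
    intro f g hfg
    rw [tendsto_iff_norm_sub_tendsto_zero]
    have h0 : Tendsto (fun n => (κ n - ω)⁻¹ * ‖g‖) atTop (𝓝 0) := by
      simpa [sub_eq_add_neg] using (tendsto_inv_atTop_zero.comp
        (tendsto_atTop_add_const_right atTop (-ω) hκ_lim)).mul_const ‖g‖
    refine squeeze_zero (fun _ => norm_nonneg _) (fun n => ?_) h0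
    have h := hR_inv n hfg
    rw [map_sub, map_smul, sub_eq_iff_eq_add] at h
    rw [h, add_sub_cancel_left]
    exact hR_norm n g
  have hR_lim : ∀ f, Tendsto (fun n => κ n • R n f) atTop (𝓝 f) := by
    intro f
    rw [Metric.tendsto_atTop]
    intro ε hε
    obtain ⟨f', g', hf', hd⟩ := hG.dense f (ε / 4) (by linarith)
    obtain ⟨N, hN⟩ := Metric.tendsto_atTop.1 (hR_lim_dom hf') (ε / 4) (by linarith)
    refine ⟨N, fun n hn => ?_⟩
    have h1 := hN n hn
    rw [dist_eq_norm] at h1 ⊢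
    have e : κ n • R n f - f = κ n • R n (f - f') + (κ n • R n f' - f') - (f - f') := by
      rw [map_sub, smul_sub]; abel
    rw [e]
    have h2 := hR_two n (f - f')
    have h3 := norm_sub_le (κ n • R n (f - f') + (κ n • R n f' - f')) (f - f')
    have h4 := norm_add_le (κ n • R n (f - f')) (κ n • R n f' - f')
    linarith
  have hR_comm : ∀ i j, Commute (R i) (R j) := by
    intro i j
    -- The resolvent identity. Its two orders together give commutation, as distinct indices have
    -- distinct parameters.
    have hid : ∀ i j h, R i h = R j h + (κ j - κ i) • R i (R j h) := fun i j h => by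
      have h1 := hR_inv i (hR_mem j h)
      have e : κ i • R j h - (κ j • R j h - h) = h - (κ j - κ i) • R j h := by module
      rw [e, map_sub, map_smul, sub_eq_iff_eq_add] at h1
      exact h1
    rcases eq_or_ne i j with rfl | hij
    · exact Commute.refl _
    · ext h
      have h1 := hid i j h
      have h2 := hid j i h
      have h3 : (κ j - κ i) • (R i (R j h) - R j (R i h)) = 0 := by
        linear_combination (norm := module) (-1 : ℝ) • h1 + (-1 : ℝ) • h2
      have hne : κ j - κ i ≠ 0 := by
        simp only [hκ, ne_eq]
        intro hc
        apply hij
        have : (j : ℝ) = i := by linarith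
        exact_mod_cast this.symm
      exact sub_eq_zero.1 ((smul_eq_zero.1 h3).resolve_left hne)
  have hA_comm : ∀ i j, Commute (A i) (A j) := fun i j => by
    refine Commute.sub_left (Commute.sub_right ?_ ?_) (Commute.sub_right ?_ ?_)
    · exact ((hR_comm i j).smul_left _).smul_right _
    · exact ((Commute.one_right (R i)).smul_left _).smul_right _
    · exact ((Commute.one_left (R j)).smul_left _).smul_right _
    · exact ((Commute.one_left (1 : E →L[ℝ] E)).smul_left _).smul_right _
  have hexp : ∀ n t, 0 ≤ t → ∀ f,
      ‖NormedSpace.exp (t • A n) f‖ ≤ Real.exp (2 * ω * t) * ‖f‖ := fun n t ht f =>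
    norm_exp_yosida_le hω (hκω n) (hR_norm n) ht f
  have hA_lim : ∀ {f g}, (f, g) ∈ G → Tendsto (fun n => A n f) atTop (𝓝 g) :=
    fun {f g} hfg => (hR_lim g).congr fun n => (hA_mem n hfg).symm
  have hcauchy : ∀ f (T : ℝ), UniformCauchySeqOn (fun n t => NormedSpace.exp (t • A n) f) atTop
      (Icc 0 T) := by
    intro f T
    rcases lt_or_ge T 0 with hT | hT
    · rw [Icc_eq_empty (not_le.2 hT), Metric.uniformCauchySeqOn_iff]
      exact fun ε _ => ⟨0, fun _ _ _ _ x hx => absurd hx (notMem_empty x)⟩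
    rw [Metric.uniformCauchySeqOn_iff]
    intro ε hε
    set M := Real.exp (2 * ω * T) with hM
    have hMpos : 0 < M := Real.exp_pos _
    obtain ⟨f', g', hf', hd⟩ := hG.dense f (ε / (4 * M)) (by positivity)
    obtain ⟨N, hN⟩ := Metric.cauchySeq_iff.1 (hA_lim hf').cauchySeq (ε / (4 * M * (T + 1)))
      (by positivity)
    refine ⟨N, fun i hi j hj t ht => ?_⟩
    have h1 := norm_exp_smul_sub_le (hA_comm i j) (by linarith) (hexp i) (hexp j) ht f'
    have h2 := hN i hi j hj
    rw [dist_eq_norm] at h2 ⊢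
    have hMt : Real.exp (2 * ω * t) ≤ M := by
      rw [hM]; gcongr; exact ht.2
    have h3 : ∀ n, ‖NormedSpace.exp (t • A n) (f - f')‖ ≤ ε / 4 := fun n => by
      calc _ ≤ Real.exp (2 * ω * t) * ‖f - f'‖ := hexp n t ht.1 _
        _ ≤ M * (ε / (4 * M)) := by gcongr
        _ = ε / 4 := by field_simp
    have h4 : M * ‖A i f' - A j f'‖ * T ≤ ε / 4 := by
      calc M * ‖A i f' - A j f'‖ * T ≤ M * (ε / (4 * M * (T + 1))) * (T + 1) := by
            gcongr; linarith
        _ = ε / 4 := by field_simp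
    have e : NormedSpace.exp (t • A i) f - NormedSpace.exp (t • A j) f
        = NormedSpace.exp (t • A i) (f - f') - NormedSpace.exp (t • A j) (f - f')
          + (NormedSpace.exp (t • A i) f' - NormedSpace.exp (t • A j) f') := by
      rw [map_sub, map_sub]; abel
    rw [e]
    have h5 := norm_add_le (NormedSpace.exp (t • A i) (f - f') - NormedSpace.exp (t • A j) (f - f'))
      (NormedSpace.exp (t • A i) f' - NormedSpace.exp (t • A j) f')
    have h6 := norm_sub_le (NormedSpace.exp (t • A i) (f - f')) (NormedSpace.exp (t • A j) (f - f'))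
    linarith [h3 i, h3 j]
  obtain ⟨S, hS, hSlim⟩ := exists_limit_semigroup hcauchy
  have hpt : ∀ {t}, 0 ≤ t → ∀ f,
      Tendsto (fun n => NormedSpace.exp (t • A n) f) atTop (𝓝 (S t f)) := fun {t} ht f =>
    (hSlim f t).tendsto_at ⟨ht, le_rfl⟩
  have hS_norm : ∀ t, 0 ≤ t → ∀ f, ‖S t f‖ ≤ Real.exp (2 * ω * t) * ‖f‖ := fun t ht f =>
    le_of_tendsto (hpt ht f).norm (Eventually.of_forall fun n => hexp n t ht f)
  have hforward : ∀ {f g}, (f, g) ∈ G →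
      Tendsto (fun h : ℝ => h⁻¹ • (S h f - f)) (𝓝[>] 0) (𝓝 g) := by
    intro f g hfg
    rw [Metric.tendsto_nhdsWithin_nhds]
    intro ε hε
    have hc : ContinuousWithinAt (fun t => S t g) (Ici 0) 0 := hS.cont g 0 self_mem_Ici
    obtain ⟨δ, hδ, hδg⟩ := Metric.continuousWithinAt_iff.1 hc (ε / 4) (by linarith)
    refine ⟨δ, hδ, fun {h} hh hhδ => ?_⟩
    have hh : 0 < h := hh
    rw [Real.dist_eq, sub_zero, abs_of_pos hh] at hhδ
    have hSg : ∀ s ∈ Icc 0 h, ‖S s g - g‖ < ε / 4 := fun s hs => by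
      have := hδg hs.1 (by rw [Real.dist_eq, sub_zero, abs_of_nonneg hs.1]; linarith [hs.2])
      simpa [dist_eq_norm, hS.zero] using this
    have hMpos : 0 < Real.exp (2 * ω * h) := Real.exp_pos _
    -- Mean value inequality for `exp (s A n) f - s g` on `[0, h]`. The derivative splits into three
    -- pieces of size at most `ε / 4`, and the fourth quarter keeps the inequality strict after the
    -- limit.
    have hbound : ∀ᶠ n in atTop,
        ‖NormedSpace.exp (h • A n) f - f - h • g‖ ≤ 3 * (ε / 4) * h := by
      have ev1 := (Metric.tendstoUniformlyOn_iff.1 (hSlim g h)) (ε / 4) (by linarith)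
      have ev2 := Metric.tendsto_nhds.1 (hA_lim hfg) (ε / (4 * Real.exp (2 * ω * h)))
        (by positivity)
      filter_upwards [ev1, ev2] with n hn1 hn2
      have hd : ∀ s ∈ Icc 0 h, HasDerivWithinAt (fun s : ℝ => NormedSpace.exp (s • A n) f - s • g)
          (NormedSpace.exp (s • A n) (A n f) - g) (Icc 0 h) s := fun s _ => by
        have c1 : A n (NormedSpace.exp (s • A n) f) = NormedSpace.exp (s • A n) (A n f) :=
          congrArg (fun L : E →L[ℝ] E => L f) (commute_exp_smul (Commute.refl (A n)) s).eq
        have := (hasDerivAt_exp_smul_apply (A n) f s).sub ((hasDerivAt_id s).smul_const g)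
        rw [c1, one_smul] at this
        exact this.hasDerivWithinAt
      have key := norm_image_sub_le_of_norm_deriv_le_segment' hd (C := 3 * (ε / 4))
        (fun s hs => ?_) h (right_mem_Icc.2 hh.le)
      · simp only [zero_smul, NormedSpace.exp_zero, one_apply_eq_self, sub_zero] at key
        rwa [sub_right_comm] at key
      have hs' : s ∈ Icc 0 h := Ico_subset_Icc_self hs
      have e : NormedSpace.exp (s • A n) (A n f) - g = NormedSpace.exp (s • A n) (A n f - g)
          - (S s g - NormedSpace.exp (s • A n) g) + (S s g - g) := by
        rw [map_sub]; abel
      have b1 : ‖NormedSpace.exp (s • A n) (A n f - g)‖ ≤ ε / 4 := by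
        rw [dist_eq_norm] at hn2
        calc _ ≤ Real.exp (2 * ω * s) * ‖A n f - g‖ := hexp n s hs.1 _
          _ ≤ Real.exp (2 * ω * h) * (ε / (4 * Real.exp (2 * ω * h))) := by
            gcongr
            exact hs.2.le
          _ = ε / 4 := by field_simp
      have b2 := hn1 s hs'
      rw [dist_eq_norm] at b2
      rw [e]
      have b3 := norm_add_le (NormedSpace.exp (s • A n) (A n f - g)
          - (S s g - NormedSpace.exp (s • A n) g)) (S s g - g)
      have b4 := norm_sub_le (NormedSpace.exp (s • A n) (A n f - g))
        (S s g - NormedSpace.exp (s • A n) g)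
      linarith [hSg s hs']
    have hfin : ‖S h f - f - h • g‖ ≤ 3 * (ε / 4) * h :=
      le_of_tendsto (((hpt hh.le f).sub_const f).sub_const (h • g)).norm hbound
    have e : h⁻¹ • (S h f - f) - g = h⁻¹ • (S h f - f - h • g) := by
      rw [smul_sub _ (S h f - f), smul_smul, inv_mul_cancel₀ hh.ne', one_smul]
    rw [dist_eq_norm, e, norm_smul, norm_inv, Real.norm_of_nonneg hh.le, inv_mul_lt_iff₀ hh]
    nlinarith
  refine ⟨S, hS, fun f g => ⟨hforward, fun hfg => ?_⟩⟩
  -- The generator has no larger domain than `G`: by surjectivity some `f'` in the domain has the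
  -- same image under `k` minus the operator. Then `f - f'` is an eigenvector of the generator with
  -- eigenvalue `k > 2 * ω`, and the growth bound forces it to vanish.
  set k := κ 0
  obtain ⟨f', g', hf', he⟩ := hG.range (hκ₀ 0) (k • f - g)
  have hd : Tendsto (fun h : ℝ => h⁻¹ • (S h (f - f') - (f - f'))) (𝓝[>] 0) (𝓝 (g - g')) := by
    refine (hfg.sub (hforward hf')).congr fun h => ?_
    rw [map_sub]
    module
  have hgg : g - g' = k • (f - f') := by
    rw [smul_sub, sub_eq_sub_iff_add_eq_add]
    have h1 := sub_eq_sub_iff_add_eq_add.1 he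
    rw [add_comm g, h1]
  rw [hgg] at hd
  have hzero : f - f' = 0 := by
    have h2 : Tendsto (fun h : ℝ => h⁻¹ * (Real.exp (2 * ω * h) - 1) * ‖f - f'‖) (𝓝[>] 0)
        (𝓝 (2 * ω * ‖f - f'‖)) := by
      have h3 : HasDerivAt (fun h : ℝ => Real.exp (2 * ω * h)) (2 * ω) 0 := by
        simpa using ((hasDerivAt_id (0 : ℝ)).const_mul (2 * ω)).exp
      have h4 := (hasDerivAt_iff_tendsto_slope_zero.1 h3).mono_left
        (nhdsWithin_mono 0 (fun x hx => ne_of_gt hx : Ioi (0 : ℝ) ⊆ {0}ᶜ))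
      simpa using h4.mul_const ‖f - f'‖
    have h5 : k * ‖f - f'‖ ≤ 2 * ω * ‖f - f'‖ := by
      have h7 : Tendsto (fun h : ℝ => ‖h⁻¹ • (S h (f - f') - (f - f')) - k • (f - f')‖) (𝓝[>] 0) (𝓝 0) :=
        tendsto_iff_norm_sub_tendsto_zero.1 hd
      have h8 := h2.add h7
      rw [add_zero] at h8
      refine ge_of_tendsto h8 ?_
      filter_upwards [self_mem_nhdsWithin] with h hh
      have hh : 0 < h := hh
      have hkp : 0 ≤ k := by linarith [hκω 0]
      have b1 := hS_norm h hh.le (f - f')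
      have e : h⁻¹ • S h (f - f') = (h⁻¹ + k) • (f - f')
          + (h⁻¹ • (S h (f - f') - (f - f')) - k • (f - f')) := by module
      have b2 : ‖(h⁻¹ + k) • (f - f')‖ ≤ ‖h⁻¹ • S h (f - f')‖
          + ‖h⁻¹ • (S h (f - f') - (f - f')) - k • (f - f')‖ := by
        rw [eq_sub_of_add_eq e.symm]
        exact norm_sub_le _ _
      rw [norm_smul, norm_smul, Real.norm_of_nonneg (by positivity), Real.norm_of_nonneg
        (by positivity)] at b2
      have b3 := mul_le_mul_of_nonneg_left b1 (inv_nonneg.2 hh.le)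
      linarith
    have h9 : ‖f - f'‖ ≤ 0 := by
      by_contra! hc
      nlinarith [hκω 0]
    exact norm_le_zero_iff.1 h9
  have hff := sub_eq_zero.1 hzero
  rw [hzero, smul_zero, sub_eq_zero] at hgg
  rwa [hff, hgg]

end HilleYosidaTheorem

/-! ### Weighted measures -/

section Weights

theorem measurable_weight (m : ℝ) : Measurable fun x : ℝ => ENNReal.ofReal (1 + x ^ m) := by
  fun_prop

theorem one_le_weight (m : ℝ) {x : ℝ} (hx : 0 < x) : 1 ≤ 1 + x ^ m := by
  have := Real.rpow_nonneg hx.le m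
  linarith

theorem weight_pos (m : ℝ) {x : ℝ} (hx : 0 < x) : 0 < 1 + x ^ m :=
  zero_lt_one.trans_le (one_le_weight m hx)

theorem rpow_le_weight {k m x : ℝ} (hk : 0 ≤ k) (hkm : k ≤ m) (hx : 0 < x) :
    x ^ k ≤ 1 + x ^ m := by
  rcases le_total x 1 with h | h
  · exact (Real.rpow_le_one hx.le h hk).trans (one_le_weight m hx)
  · have := Real.rpow_le_rpow_of_exponent_le h hkm
    linarith

/-- The density is positive on the half-line, so all these measures have the same null sets.
Statements almost everywhere thus move freely along the scale of spaces. -/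
theorem ae_weightMeasure (m : ℝ) :
    ae (weightMeasure m) = ae (volume.restrict (Ioi (0 : ℝ))) := by
  refine le_antisymm (withDensity_absolutelyContinuous _ _).ae_le ?_
  refine Measure.AbsolutelyContinuous.ae_le
    (withDensity_absolutelyContinuous' (measurable_weight m).aemeasurable ?_)
  filter_upwards [ae_restrict_mem measurableSet_Ioi] with x hx
  exact (ENNReal.ofReal_pos.2 (weight_pos m hx)).ne'

theorem aestronglyMeasurable_weightMeasure_iff {m : ℝ} {f : ℝ → ℝ} :
    AEStronglyMeasurable f (weightMeasure m) ↔
      AEStronglyMeasurable f (volume.restrict (Ioi (0 : ℝ))) :=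
  ⟨fun h => h.mono_ac (Measure.ae_le_iff_absolutelyContinuous.1 (ae_weightMeasure m).ge),
    fun h => h.mono_ac (Measure.ae_le_iff_absolutelyContinuous.1 (ae_weightMeasure m).le)⟩

theorem lintegral_weightMeasure (m : ℝ) {f : ℝ → ℝ≥0∞}
    (hf : AEMeasurable f (volume.restrict (Ioi (0 : ℝ)))) :
    ∫⁻ x, f x ∂weightMeasure m = ∫⁻ x in Ioi 0, ENNReal.ofReal (1 + x ^ m) * f x := by
  rw [weightMeasure, lintegral_withDensity_eq_lintegral_mul₀ (measurable_weight m).aemeasurable hf]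
  rfl

theorem integrable_weightMeasure_iff {m : ℝ} {f : ℝ → ℝ} :
    Integrable f (weightMeasure m) ↔ IntegrableOn (fun x => f x * (1 + x ^ m)) (Ioi 0) := by
  rw [weightMeasure, integrable_withDensity_iff (measurable_weight m)
    (Eventually.of_forall fun _ => ENNReal.ofReal_lt_top), IntegrableOn]
  refine integrable_congr ?_
  filter_upwards [ae_restrict_mem measurableSet_Ioi] with x hx
  rw [ENNReal.toReal_ofReal (weight_pos m hx).le]

theorem integral_weightMeasure (m : ℝ) (f : ℝ → ℝ) :
    ∫ x, f x ∂weightMeasure m = ∫ x in Ioi 0, f x * (1 + x ^ m) := by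
  rw [weightMeasure, integral_withDensity_eq_integral_toReal_smul (measurable_weight m)
    (Eventually.of_forall fun _ => ENNReal.ofReal_lt_top)]
  refine integral_congr_ae ?_
  filter_upwards [ae_restrict_mem measurableSet_Ioi] with x hx
  rw [ENNReal.toReal_ofReal (weight_pos m hx).le, smul_eq_mul, mul_comm]

theorem X.integrable {m : ℝ} (f : X m) : Integrable f (weightMeasure m) :=
  L1.integrable_coeFn f

theorem X.norm_eq {m : ℝ} (f : X m) : ‖f‖ = ∫ x, |f x| ∂weightMeasure m :=
  L1.norm_eq_integral_norm f

/-- Both `1` and `x ^ n` are at most `1 + x ^ m`, hence the factor `2`. -/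
theorem weightMeasure_le {n m : ℝ} (hn : 0 ≤ n) (hnm : n ≤ m) :
    weightMeasure n ≤ (2 : ℝ≥0∞) • weightMeasure m := by
  rw [weightMeasure, weightMeasure, ← withDensity_smul _ (measurable_weight m)]
  refine withDensity_mono ?_
  filter_upwards [ae_restrict_mem measurableSet_Ioi] with x hx
  simp only [Pi.smul_apply, smul_eq_mul]
  rw [← ENNReal.ofReal_ofNat 2, ← ENNReal.ofReal_mul (by norm_num)]
  refine ENNReal.ofReal_le_ofReal ?_
  linarith [rpow_le_weight hn hnm hx, one_le_weight m hx]

/-- The derivative of the weight is controlled by the weight along the growth rate. -/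
theorem growth_mul_deriv_weight_le {r : ℝ → ℝ} {r₀ r₁ m : ℝ} (hr₀ : 0 ≤ r₀) (hr₁ : 0 ≤ r₁)
    (hr : ∀ x : ℝ, 0 < x → 0 < r x ∧ r x ≤ r₀ + r₁ * x) (hm : 1 ≤ m) {x : ℝ} (hx : 0 < x) :
    r x * (m * x ^ (m - 1)) ≤ m * (r₀ + r₁) * (1 + x ^ m) := by
  have h1 : x ^ (m - 1) ≤ 1 + x ^ m := rpow_le_weight (by linarith) (by linarith) hx
  have h2 : x * x ^ (m - 1) = x ^ m := by
    rw [Real.rpow_sub_one hx.ne']; field_simp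
  have h3 : 0 ≤ x ^ (m - 1) := Real.rpow_nonneg hx.le _
  calc r x * (m * x ^ (m - 1)) ≤ (r₀ + r₁ * x) * (m * x ^ (m - 1)) := by
        gcongr; exact (hr x hx).2
    _ = m * (r₀ * x ^ (m - 1) + r₁ * (x * x ^ (m - 1))) := by ring
    _ ≤ m * (r₀ * (1 + x ^ m) + r₁ * (1 + x ^ m)) := by
        rw [h2]; gcongr; linarith
    _ = _ := by ring

theorem hasDerivAt_weight (m : ℝ) {x : ℝ} (hx : 0 < x) :
    HasDerivAt (fun x : ℝ => 1 + x ^ m) (m * x ^ (m - 1)) x :=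
  (Real.hasDerivAt_rpow_const (Or.inl hx.ne')).const_add 1

theorem absolutelyContinuousOnInterval_weight (m : ℝ) {x y : ℝ} (hx : 0 < x) (hxy : x ≤ y) :
    AbsolutelyContinuousOnInterval (fun x : ℝ => 1 + x ^ m) x y := by
  refine ContDiffOn.absolutelyContinuousOnInterval (contDiffOn_const.add ?_)
  intro z hz
  rw [uIcc_of_le hxy] at hz
  exact (Real.contDiffAt_rpow_const_of_ne (hx.trans_le hz.1).ne').contDiffWithinAt

end Weights

/-! ### Absolutely continuous functions and a Kato inequality -/

section AbsoluteContinuity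

variable {F w P : ℝ → ℝ} {s t : ℝ}

theorem absolutelyContinuousOnInterval_comp {φ : ℝ → ℝ} {K : NNReal} {u : Set ℝ}
    (hφ : LipschitzOnWith K φ u) (hF : AbsolutelyContinuousOnInterval F s t)
    (hu : MapsTo F (uIcc s t) u) : AbsolutelyContinuousOnInterval (fun x => φ (F x)) s t := by
  unfold AbsolutelyContinuousOnInterval at hF ⊢
  refine squeeze_zero' (Eventually.of_forall fun E => Finset.sum_nonneg fun _ _ => dist_nonneg) ?_
    (by simpa using hF.const_mul (K : ℝ))
  refine eventually_inf_principal.2 (Eventually.of_forall fun E hE => ?_)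
  rw [Finset.mul_sum]
  refine Finset.sum_le_sum fun i hi => ?_
  have h := hE.1 i hi
  exact hφ.dist_le_mul _ (hu h.1) _ (hu h.2)

theorem absolutelyContinuousOnInterval_abs (hF : AbsolutelyContinuousOnInterval F s t) :
    AbsolutelyContinuousOnInterval (fun x => |F x|) s t :=
  absolutelyContinuousOnInterval_comp (K := 1) (u := univ)
    (LipschitzWith.lipschitzOnWith (LipschitzWith.of_dist_le_mul fun x y => by
      simpa [Real.dist_eq] using abs_abs_sub_abs_le_abs_sub x y)) hF (mapsTo_univ _ _)

/-- At a zero of `F` both sides vanish. There `|F|` has a minimum, so its derivative is zero if it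
exists, and `deriv` is zero by default if it does not. -/
theorem deriv_abs_comp_of_differentiableAt {x : ℝ} (hF : DifferentiableAt ℝ F x) :
    deriv (fun x => |F x|) x = SignType.sign (F x) * deriv F x := by
  by_cases h0 : F x = 0
  · have hmin : IsLocalMin (fun x => |F x|) x :=
      Eventually.of_forall fun y => by simp [h0]
    simp [hmin.deriv_eq_zero, h0]
  · exact ((hasDerivAt_abs h0).comp x hF.hasDerivAt).deriv

/-- Kato-type inequality for the weighted modulus of an absolutely continuous function. -/
theorem neg_le_integral_of_sign_mul_deriv_le (hst : s ≤ t)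
    (hF : AbsolutelyContinuousOnInterval F s t) (hw : AbsolutelyContinuousOnInterval w s t)
    (hwt : 0 ≤ w t) (hP : IntervalIntegrable P volume s t)
    (hle : ∀ᵐ x, x ∈ Icc s t → DifferentiableAt ℝ F x →
      SignType.sign (F x) * deriv F x * w x + |F x| * deriv w x ≤ P x) :
    -(|F s| * w s) ≤ ∫ x in s..t, P x := by
  have hH := (absolutelyContinuousOnInterval_abs hF).mul hw
  have h1 := hH.integral_deriv_eq_sub
  have h2 : ∫ x in s..t, deriv ((fun x => |F x|) * w) x ≤ ∫ x in s..t, P x := by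
    refine intervalIntegral.integral_mono_ae_restrict hst hH.intervalIntegrable_deriv hP ?_
    refine (ae_restrict_iff' measurableSet_Icc).2 ?_
    filter_upwards [hle, hF.ae_differentiableAt, (absolutelyContinuousOnInterval_abs
      hF).ae_differentiableAt, hw.ae_differentiableAt] with x hx h3 h4 h5 hxs
    rw [uIcc_of_le hst] at h3 h4 h5
    rw [deriv_mul (h4 hxs) (h5 hxs), deriv_abs_comp_of_differentiableAt (h3 hxs)]
    exact hx hxs (h3 hxs)
  have h6 : 0 ≤ |F t| * w t := mul_nonneg (abs_nonneg _) hwt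
  simp only [Pi.mul_apply] at h1
  linarith

end AbsoluteContinuity

/-! ### Exhaustion of the half-line by compact intervals -/

section HalfLine

theorem one_div_natCast_add_one_pos (n : ℕ) : (0 : ℝ) < 1 / (n + 1) := by positivity

theorem one_div_natCast_add_one_le (n : ℕ) : (1 : ℝ) / (n + 1) ≤ n + 1 := by
  rw [div_le_iff₀ (by positivity)]
  nlinarith [(Nat.cast_nonneg n : (0 : ℝ) ≤ n)]

theorem aecover_Ioi_zero :
    AECover (volume.restrict (Ioi (0 : ℝ))) atTop
      fun n : ℕ => Ioc (1 / ((n : ℝ) + 1)) (n + 1) := by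
  have h1 : AECover (volume.restrict (Ioi (0 : ℝ))) atTop fun n : ℕ => Ioi (1 / ((n : ℝ) + 1)) :=
    aecover_Ioi_of_Ioi tendsto_one_div_add_atTop_nhds_zero_nat
  have h2 : AECover (volume.restrict (Ioi (0 : ℝ))) atTop fun n : ℕ => Iic ((n : ℝ) + 1) :=
    aecover_Iic (tendsto_atTop_add_const_right _ _ tendsto_natCast_atTop_atTop)
  exact h1.inter h2

theorem restrict_Ioi_zero_restrict_Ioc {s : ℝ} (hs : 0 ≤ s) (t : ℝ) :
    (volume.restrict (Ioi (0 : ℝ))).restrict (Ioc s t) = volume.restrict (Ioc s t) :=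
  Measure.restrict_restrict_of_subset fun _ hx => lt_of_le_of_lt hs hx.1

theorem iUnion_Ioc_eq_Ioi_zero :
    ⋃ n : ℕ, Ioc (1 / ((n : ℝ) + 1)) ((n : ℝ) + 1) = Ioi 0 := by
  ext x
  simp only [mem_iUnion, mem_Ioi]
  refine ⟨fun ⟨n, hn⟩ => (one_div_natCast_add_one_pos n).trans hn.1, fun hx => ?_⟩
  obtain ⟨i, hi⟩ := exists_nat_one_div_lt hx
  obtain ⟨j, hj⟩ := exists_nat_ge x
  refine ⟨max i j, ?_, ?_⟩
  · refine lt_of_le_of_lt ?_ hi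
    gcongr
    exact le_max_left i j
  · have : (j : ℝ) ≤ (max i j : ℕ) := by exact_mod_cast le_max_right i j
    linarith

theorem iUnion_Ioc_zero_eq_Ioi_zero : ⋃ n : ℕ, Ioc (0 : ℝ) n = Ioi 0 := by
  ext x
  simp only [mem_iUnion, mem_Ioi]
  refine ⟨fun ⟨n, hn⟩ => hn.1, fun hx => ?_⟩
  obtain ⟨j, hj⟩ := exists_nat_ge x
  exact ⟨j, hx, hj⟩

/-- A property that holds almost everywhere on compact subintervals of `(0, ∞)` holds almost
everywhere on `(0, ∞)`. -/
theorem ae_restrict_Ioi_zero_of_forall_Icc {p : ℝ → Prop}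
    (h : ∀ s t : ℝ, 0 < s → s < t → ∀ᵐ x, x ∈ Icc s t → p x) :
    ∀ᵐ x ∂volume.restrict (Ioi (0 : ℝ)), p x := by
  rw [← iUnion_Ioc_eq_Ioi_zero, ae_restrict_iUnion_iff]
  intro n
  rw [ae_restrict_iff' measurableSet_Ioc]
  filter_upwards [h (1 / ((n : ℝ) + 1)) (n + 2) (one_div_natCast_add_one_pos n)
    (by linarith [one_div_natCast_add_one_le n])] with x hx hxn
  exact hx ⟨hxn.1.le, by linarith [hxn.2]⟩

theorem ae_differentiableAt_Ioi_zero {F : ℝ → ℝ}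
    (hF : ∀ x y : ℝ, 0 < x → x < y → AbsolutelyContinuousOnInterval F x y) :
    ∀ᵐ x ∂volume.restrict (Ioi (0 : ℝ)), DifferentiableAt ℝ F x :=
  ae_restrict_Ioi_zero_of_forall_Icc fun s t hs hst => by
    simpa [uIcc_of_le hst.le] using (hF s t hs hst).ae_differentiableAt

theorem continuousOn_Ioi_zero_of_ac {F : ℝ → ℝ}
    (hF : ∀ x y : ℝ, 0 < x → x < y → AbsolutelyContinuousOnInterval F x y) :
    ContinuousOn F (Ioi 0) := by
  intro x hx
  have hx : 0 < x := hx
  have h := (hF (x / 2) (x + 1) (by linarith) (by linarith)).continuousOn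
  rw [uIcc_of_le (by linarith)] at h
  exact (h.continuousAt (Icc_mem_nhds (by linarith) (by linarith))).continuousWithinAt

theorem integrableOn_of_integrable_weightMeasure {m : ℝ} {f : ℝ → ℝ}
    (hf : Integrable f (weightMeasure m)) : IntegrableOn f (Ioi 0) := by
  refine Integrable.mono (integrable_weightMeasure_iff.1 hf)
    (aestronglyMeasurable_weightMeasure_iff.1 hf.aestronglyMeasurable) ?_
  filter_upwards [ae_restrict_mem measurableSet_Ioi] with x hx
  rw [norm_mul, Real.norm_of_nonneg (weight_pos m hx).le]
  exact le_mul_of_one_le_right (norm_nonneg _) (one_le_weight m hx)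

end HalfLine

/-! ### The transport operator and its dissipativity -/

/-- The standing assumptions on the growth rate `r` and on the total absorption rate `q`. -/
structure TransportData (r q : ℝ → ℝ) (r₀ r₁ : ℝ) : Prop where
  inv_growth : LocallyIntegrableOn (fun x => 1 / r x) (Ioi (0 : ℝ))
  r₀_nonneg : 0 ≤ r₀
  r₁_nonneg : 0 ≤ r₁
  growth : ∀ x : ℝ, 0 < x → 0 < r x ∧ r x ≤ r₀ + r₁ * x
  absorption : LocEssBounded q
  absorption_nonneg : ∀ x : ℝ, 0 < x → 0 ≤ q x

theorem LocEssBounded.aestronglyMeasurable {q : ℝ → ℝ} (hq : LocEssBounded q) :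
    AEStronglyMeasurable q (volume.restrict (Ioi (0 : ℝ))) := by
  rw [← iUnion_Ioc_zero_eq_Ioi_zero, aestronglyMeasurable_iUnion_iff]
  exact fun n => (hq n).aestronglyMeasurable

theorem LocEssBounded.exists_bound {q : ℝ → ℝ} (hq : LocEssBounded q) (R : ℝ) :
    ∃ C : ℝ, 0 ≤ C ∧ ∀ᵐ x, x ∈ Ioc 0 R → |q x| ≤ C := by
  refine ⟨(eLpNormEssSup q (volume.restrict (Ioc 0 R))).toReal, ENNReal.toReal_nonneg, ?_⟩
  have hfin : eLpNormEssSup q (volume.restrict (Ioc 0 R)) ≠ ∞ := by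
    have := (hq R).2
    rw [eLpNorm_exponent_top] at this
    exact this.ne
  rw [← ae_restrict_iff' measurableSet_Ioc]
  filter_upwards [ae_le_eLpNormEssSup (f := q) (μ := volume.restrict (Ioc 0 R))] with x hx
  have := ENNReal.toReal_mono hfin hx
  simpa using this

section Transport

variable {r q : ℝ → ℝ} {r₀ r₁ m : ℝ}

theorem TransportData.aestronglyMeasurable_growth (hd : TransportData r q r₀ r₁) :
    AEStronglyMeasurable r (volume.restrict (Ioi (0 : ℝ))) := by
  have h := hd.inv_growth.aestronglyMeasurable.aemeasurable.inv
  refine AEMeasurable.aestronglyMeasurable (h.congr (Eventually.of_forall fun x => ?_))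
  simp

theorem TransportData.integrableOn_inv_growth (hd : TransportData r q r₀ r₁) {s t : ℝ}
    (hs : 0 < s) : IntegrableOn (fun x => 1 / r x) (Icc s t) :=
  hd.inv_growth.integrableOn_compact_subset (fun _ hx => hs.trans_le hx.1) isCompact_Icc

/-- Local form of the dissipativity of the transport operator. -/
theorem TransportData.neg_le_integral (hd : TransportData r q r₀ r₁) (hm : 1 ≤ m) {F f h : ℝ → ℝ}
    {s t k : ℝ} (hs : 0 < s) (hst : s ≤ t) (hF : AbsolutelyContinuousOnInterval F s t)
    (hrep : ∀ᵐ x ∂volume.restrict (Ioi (0 : ℝ)), F x = r x * f x)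
    (hh : ∀ᵐ x ∂volume.restrict (Ioi (0 : ℝ)), deriv F x + (k + q x) * f x = h x)
    (hP : IntervalIntegrable
      (fun x => (|h x| + m * (r₀ + r₁) * |f x| - (k + q x) * |f x|) * (1 + x ^ m)) volume s t) :
    -(|F s| * (1 + s ^ m)) ≤
      ∫ x in s..t, (|h x| + m * (r₀ + r₁) * |f x| - (k + q x) * |f x|) * (1 + x ^ m) := by
  refine neg_le_integral_of_sign_mul_deriv_le hst hF
    (absolutelyContinuousOnInterval_weight m hs hst) (weight_pos m (hs.trans_le hst)).le hP ?_
  filter_upwards [(ae_restrict_iff' measurableSet_Ioi).1 hrep,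
    (ae_restrict_iff' measurableSet_Ioi).1 hh] with x h1 h2 hx _
  have hx0 : 0 < x := hs.trans_le hx.1
  have hr := hd.growth x hx0
  have e1 := h1 hx0
  have e2 : deriv F x = h x - (k + q x) * f x := by linarith [h2 hx0]
  -- Positivity of `r` lets the sign of the flux be replaced by the sign of the density.
  have e3 : (SignType.sign (F x) : ℝ) = SignType.sign (f x) := by
    rw [e1, sign_mul, sign_pos hr.1, one_mul]
  have e4 : |F x| = r x * |f x| := by rw [e1, abs_mul, abs_of_pos hr.1]
  rw [(hasDerivAt_weight m hx0).deriv, e2, e3, e4]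
  have h5 : (SignType.sign (f x) : ℝ) * f x = |f x| := sign_mul_self (f x)
  have h6 : (SignType.sign (f x) : ℝ) * h x ≤ |h x| := by
    rcases lt_trichotomy (f x) 0 with hf | hf | hf
    · simpa [sign_neg hf] using neg_le_abs (h x)
    · simp [hf]
    · simpa [sign_pos hf] using le_abs_self (h x)
  have h7 := growth_mul_deriv_weight_le hd.r₀_nonneg hd.r₁_nonneg hd.growth hm hx0
  have h8 := mul_le_mul_of_nonneg_right h6 (weight_pos m hx0).le
  have h9 := mul_le_mul_of_nonneg_right h7 (abs_nonneg (f x))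
  calc _ = (SignType.sign (f x) : ℝ) * h x * (1 + x ^ m)
        - (k + q x) * ((SignType.sign (f x) : ℝ) * f x) * (1 + x ^ m)
        + r x * (m * x ^ (m - 1)) * |f x| := by ring
    _ ≤ |h x| * (1 + x ^ m) - (k + q x) * |f x| * (1 + x ^ m)
        + m * (r₀ + r₁) * (1 + x ^ m) * |f x| := by rw [h5]; linarith
    _ = _ := by ring

/-- The flux always vanishes at the origin. -/
theorem IsTransportFlux.tendsto_zero (hd : TransportData r q r₀ r₁) {f : X m} {F : ℝ → ℝ}
    (hF : IsTransportFlux r q m f F) : Tendsto F (𝓝[>] (0 : ℝ)) (𝓝 0) := by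
  by_cases h_int : IntegrableAtFilter (fun x => 1 / r x) (𝓝[>] (0 : ℝ))
  · exact hF.boundary h_int
  -- Without an imposed condition, `F` still has a limit at `0` since `F'` is integrable. A nonzero
  -- limit would bound `1 / r` near `0` by a multiple of `|f|` and so make it integrable.
  have hF' : IntegrableOn (deriv F) (Ioi 0) :=
    integrableOn_of_integrable_weightMeasure (memLp_one_iff_integrable.1 hF.deriv_mem)
  have hii : IntervalIntegrable (deriv F) volume 0 1 :=
    (intervalIntegrable_iff_integrableOn_Ioc_of_le zero_le_one).2
      (hF'.mono_set Ioc_subset_Ioi_self)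
  have hcont := intervalIntegral.continuousOn_primitive_interval' hii (right_mem_uIcc)
  rw [uIcc_of_le zero_le_one] at hcont
  have hlim : Tendsto F (𝓝[>] (0 : ℝ)) (𝓝 (F 1 + ∫ x in (1 : ℝ)..0, deriv F x)) := by
    have h1 : Tendsto (fun y => ∫ x in (1 : ℝ)..y, deriv F x) (𝓝[>] (0 : ℝ))
        (𝓝 (∫ x in (1 : ℝ)..0, deriv F x)) := by
      refine (hcont 0 (left_mem_Icc.2 zero_le_one)).mono_left ?_
      refine le_inf inf_le_left (le_principal_iff.2 ?_)
      filter_upwards [Ioc_mem_nhdsGT (zero_lt_one' ℝ)] with x hx using ⟨hx.1.le, hx.2⟩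
    refine (h1.const_add (F 1)).congr' ?_
    filter_upwards [Ioo_mem_nhdsGT (zero_lt_one' ℝ)] with x hx
    rw [(hF.ac x 1 hx.1 hx.2).symm.integral_deriv_eq_sub]
    ring
  set c := F 1 + ∫ x in (1 : ℝ)..0, deriv F x
  by_cases hc : c = 0
  · rwa [hc] at hlim
  exfalso
  apply h_int
  have hev : ∀ᶠ x in 𝓝[>] (0 : ℝ), |c| / 2 < |F x| :=
    hlim.abs.eventually (lt_mem_nhds (by linarith [abs_pos.2 hc]))
  refine ⟨{x | |c| / 2 < |F x|} ∩ Ioi 0, inter_mem hev self_mem_nhdsWithin, ?_⟩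
  have hf : IntegrableOn (fun x => 2 / |c| * f x) (Ioi 0) :=
    (integrableOn_of_integrable_weightMeasure (X.integrable f)).const_mul _
  refine Integrable.mono (hf.mono_set inter_subset_right)
    (hd.inv_growth.aestronglyMeasurable.mono_measure
      (Measure.restrict_mono inter_subset_right le_rfl)) ?_
  have hopen : MeasurableSet ({x | |c| / 2 < |F x|} ∩ Ioi 0) := by
    have h2 : ContinuousOn (fun x => |F x|) (Ioi 0) := (continuousOn_Ioi_zero_of_ac hF.ac).abs
    rw [inter_comm]
    exact (h2.isOpen_inter_preimage isOpen_Ioi isOpen_Ioi).measurableSet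
  rw [ae_restrict_iff' hopen]
  filter_upwards [(ae_restrict_iff' measurableSet_Ioi).1 hF.rep] with x hx hxs
  have hr := (hd.growth x hxs.2).1
  have h3 := hxs.1
  simp only [mem_ofPred_eq, hx hxs.2, abs_mul, abs_of_pos hr] at h3
  have hcp := abs_pos.2 hc
  rw [norm_div, norm_one, norm_mul, Real.norm_eq_abs, Real.norm_eq_abs, Real.norm_eq_abs,
    abs_of_pos hr, abs_div, abs_abs, abs_two, div_le_iff₀ hr]
  rw [div_mul_eq_mul_div, div_mul_eq_mul_div, le_div_iff₀ hcp]
  linarith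

/-- Dissipativity of the transport operator. -/
theorem IsTransportFlux.dissipative (hd : TransportData r q r₀ r₁) (hm : 1 ≤ m) {f : X m}
    {F : ℝ → ℝ} (hF : IsTransportFlux r q m f F) (k : ℝ) :
    k * ‖f‖ + ∫ x, q x * |f x| ∂weightMeasure m ≤
      ∫ x, |deriv F x + (k + q x) * f x| ∂weightMeasure m + m * (r₀ + r₁) * ‖f‖ := by
  have i1 : Integrable (fun x => |f x|) (weightMeasure m) := (X.integrable f).abs
  have i2 : Integrable (fun x => q x * |f x|) (weightMeasure m) := by
    refine (memLp_one_iff_integrable.1 hF.absorption_mem).abs.congr ?_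
    rw [Filter.EventuallyEq, ae_weightMeasure]
    filter_upwards [ae_restrict_mem measurableSet_Ioi] with x hx
    rw [abs_mul, abs_of_nonneg (hd.absorption_nonneg x hx)]
  have i3 : Integrable (fun x => |deriv F x + (k + q x) * f x|) (weightMeasure m) := by
    refine (((memLp_one_iff_integrable.1 hF.deriv_mem).add (((X.integrable f).const_mul k).add
      (memLp_one_iff_integrable.1 hF.absorption_mem))).congr (Eventually.of_forall fun x => ?_)).abs
    simp only [Pi.add_apply]
    ring
  set h : ℝ → ℝ := fun x => deriv F x + (k + q x) * f x with hh
  have i4 : Integrable (fun x => |h x| + m * (r₀ + r₁) * |f x| - (k + q x) * |f x|)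
      (weightMeasure m) := by
    refine ((i3.add (i1.const_mul (m * (r₀ + r₁)))).sub ((i1.const_mul k).add i2)).congr
      (Eventually.of_forall fun x => ?_)
    simp only [Pi.add_apply, Pi.sub_apply]
    ring
  have i5 := integrable_weightMeasure_iff.1 i4
  have hlim := aecover_Ioi_zero.integral_tendsto_of_countably_generated i5
  have hlim2 : Tendsto (fun n : ℕ => -(|F (1 / ((n : ℝ) + 1))| * (1 + (1 / ((n : ℝ) + 1)) ^ m)))
      atTop (𝓝 0) := by
    have t1 : Tendsto (fun n : ℕ => 1 / ((n : ℝ) + 1)) atTop (𝓝[>] 0) :=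
      tendsto_nhdsWithin_iff.2 ⟨tendsto_one_div_add_atTop_nhds_zero_nat,
        Eventually.of_forall one_div_natCast_add_one_pos⟩
    have t2 := ((hF.tendsto_zero hd).comp t1).abs
    have t3 : Tendsto (fun n : ℕ => 1 + (1 / ((n : ℝ) + 1)) ^ m) atTop (𝓝 (1 + 0 ^ m)) :=
      ((tendsto_one_div_add_atTop_nhds_zero_nat (𝕜 := ℝ)).rpow_const
        (Or.inr (by linarith))).const_add 1
    simpa using (t2.mul t3).neg
  -- The boundary term at the lower end tends to zero with the flux. The one at the upper end has
  -- the favourable sign and is already dropped in the local inequality.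
  have hnn : 0 ≤ ∫ x, |h x| + m * (r₀ + r₁) * |f x| - (k + q x) * |f x| ∂weightMeasure m := by
    rw [integral_weightMeasure]
    refine le_of_tendsto_of_tendsto' hlim2 hlim fun n => ?_
    rw [restrict_Ioi_zero_restrict_Ioc (one_div_natCast_add_one_pos n).le,
      ← intervalIntegral.integral_of_le (one_div_natCast_add_one_le n)]
    refine hd.neg_le_integral hm (one_div_natCast_add_one_pos n) (one_div_natCast_add_one_le n) ?_
      hF.rep (Eventually.of_forall fun x => rfl) ?_
    · have h2 := hF.ac (1 / ((n : ℝ) + 1)) (n + 2) (one_div_natCast_add_one_pos n)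
        (by linarith [one_div_natCast_add_one_le n])
      refine h2.mono ?_
      rw [uIcc_of_le (one_div_natCast_add_one_le n), uIcc_of_le
        (by linarith [one_div_natCast_add_one_le n])]
      exact Icc_subset_Icc_right (by linarith)
    · rw [intervalIntegrable_iff_integrableOn_Ioc_of_le (one_div_natCast_add_one_le n)]
      exact i5.mono_set fun x hx => (one_div_natCast_add_one_pos n).trans hx.1
  have e : ∫ x, |h x| + m * (r₀ + r₁) * |f x| - (k + q x) * |f x| ∂weightMeasure m
      = ∫ x, |h x| ∂weightMeasure m + m * (r₀ + r₁) * ‖f‖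
        - (k * ‖f‖ + ∫ x, q x * |f x| ∂weightMeasure m) := by
    rw [X.norm_eq, ← integral_const_mul, ← integral_const_mul, ← integral_add (i1.const_mul k) i2,
      ← integral_add i3 (i1.const_mul _), ← integral_sub]
    · refine integral_congr_ae (Eventually.of_forall fun x => ?_)
      simp only
      ring
    · exact i3.add (i1.const_mul _)
    · exact (i1.const_mul k).add i2
  linarith

theorem IsTransportFlux.ae_deriv_lincomb {f₁ f₂ : X m} {F₁ F₂ : ℝ → ℝ}
    (h₁ : IsTransportFlux r q m f₁ F₁) (h₂ : IsTransportFlux r q m f₂ F₂) (c d : ℝ) :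
    ∀ᵐ x ∂volume.restrict (Ioi (0 : ℝ)),
      deriv (fun x => c * F₁ x + d * F₂ x) x = c * deriv F₁ x + d * deriv F₂ x := by
  filter_upwards [ae_differentiableAt_Ioi_zero h₁.ac, ae_differentiableAt_Ioi_zero h₂.ac]
    with x hx1 hx2
  exact ((hx1.hasDerivAt.const_mul c).add (hx2.hasDerivAt.const_mul d)).deriv

theorem X.coeFn_lincomb (c d : ℝ) (f₁ f₂ : X m) :
    ∀ᵐ x ∂volume.restrict (Ioi (0 : ℝ)), (c • f₁ + d • f₂ : X m) x = c * f₁ x + d * f₂ x := by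
  rw [← ae_weightMeasure m]
  filter_upwards [Lp.coeFn_add (c • f₁) (d • f₂), Lp.coeFn_smul c f₁, Lp.coeFn_smul d f₂]
    with x h1 h2 h3
  rw [h1, Pi.add_apply, h2, h3]
  rfl

theorem IsTransportFlux.lincomb {f₁ f₂ : X m} {F₁ F₂ : ℝ → ℝ}
    (h₁ : IsTransportFlux r q m f₁ F₁) (h₂ : IsTransportFlux r q m f₂ F₂) (c d : ℝ) :
    IsTransportFlux r q m (c • f₁ + d • f₂) (fun x => c * F₁ x + d * F₂ x) where
  rep := by
    filter_upwards [X.coeFn_lincomb c d f₁ f₂, h₁.rep, h₂.rep] with x e1 e2 e3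
    rw [e1, e2, e3]
    ring
  ac x y hx hxy := ((h₁.ac x y hx hxy).const_mul c).add ((h₂.ac x y hx hxy).const_mul d)
  deriv_mem := by
    refine ((h₁.deriv_mem.const_mul c).add (h₂.deriv_mem.const_mul d)).ae_eq ?_
    rw [Filter.EventuallyEq, ae_weightMeasure]
    filter_upwards [h₁.ae_deriv_lincomb h₂ c d] with x hx
    simp [hx]
  absorption_mem := by
    refine ((h₁.absorption_mem.const_mul c).add (h₂.absorption_mem.const_mul d)).ae_eq ?_
    rw [Filter.EventuallyEq, ae_weightMeasure]
    filter_upwards [X.coeFn_lincomb c d f₁ f₂] with x hx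
    rw [hx]
    simp only [Pi.add_apply]
    ring
  boundary h_int := by
    simpa using ((h₁.boundary h_int).const_mul c).add ((h₂.boundary h_int).const_mul d)

end Transport

/-! ### First order linear equations on the half-line -/

section LinearODE

variable {ρ g : ℝ → ℝ}

theorem uIcc_subset_Icc_min_max {s t c : ℝ} (hst : s ≤ t) :
    uIcc s t ⊆ uIcc (min s c) (max t c) := by
  rw [uIcc_of_le hst, uIcc_of_le ((min_le_left s c).trans (hst.trans (le_max_left t c)))]
  exact Icc_subset_Icc (min_le_left _ _) (le_max_left _ _)

/-- A primitive on `(0, ∞)` of a locally integrable function. -/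
theorem ac_primitive (hρ : ∀ s t : ℝ, 0 < s → s ≤ t → IntervalIntegrable ρ volume s t) {s t : ℝ}
    (hs : 0 < s) (hst : s ≤ t) :
    AbsolutelyContinuousOnInterval (fun x => ∫ y in (1 : ℝ)..x, ρ y) s t := by
  have hle : min s 1 ≤ max t 1 := (min_le_left _ _).trans (hst.trans (le_max_left _ _))
  refine (IntervalIntegrable.absolutelyContinuousOnInterval_intervalIntegral
    (hρ (min s 1) (max t 1) (lt_min hs one_pos) hle) ?_).mono (uIcc_subset_Icc_min_max hst)
  rw [uIcc_of_le hle]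
  exact ⟨min_le_right _ _, le_max_right _ _⟩

theorem ae_hasDerivAt_primitive
    (hρ : ∀ s t : ℝ, 0 < s → s ≤ t → IntervalIntegrable ρ volume s t) :
    ∀ᵐ x ∂volume.restrict (Ioi (0 : ℝ)), HasDerivAt (fun x => ∫ y in (1 : ℝ)..x, ρ y) (ρ x) x := by
  refine ae_restrict_Ioi_zero_of_forall_Icc fun s t hs hst => ?_
  have hle : min s 1 ≤ max t 1 := (min_le_left _ _).trans (hst.le.trans (le_max_left _ _))
  filter_upwards [(hρ (min s 1) (max t 1) (lt_min hs one_pos) hle).ae_hasDerivAt_integral]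
    with x hx hxs
  rw [← uIcc_of_le hst.le] at hxs
  refine hx (uIcc_subset_Icc_min_max hst.le hxs) 1 ?_
  rw [uIcc_of_le hle]
  exact ⟨min_le_right _ _, le_max_right _ _⟩

theorem monotoneOn_primitive
    (hρ : ∀ s t : ℝ, 0 < s → s ≤ t → IntervalIntegrable ρ volume s t)
    (hρ0 : ∀ x, 0 < x → 0 ≤ ρ x) : MonotoneOn (fun x => ∫ y in (1 : ℝ)..x, ρ y) (Ioi 0) := by
  have hi : ∀ x : ℝ, 0 < x → IntervalIntegrable ρ volume 1 x := fun x hx => by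
    rcases le_total 1 x with h | h
    · exact hρ 1 x one_pos h
    · exact (hρ x 1 hx h).symm
  intro x hx y hy hxy
  have h1 := intervalIntegral.integral_interval_sub_left (hi y hy) (hi x hx)
  have h2 : 0 ≤ ∫ z in x..y, ρ z :=
    intervalIntegral.integral_nonneg hxy fun z hz => hρ0 z (lt_of_lt_of_le hx hz.1)
  simp only
  linarith

/-- Solution of `F' + ρ F = g` on `(0, ∞)` with `F(0+) = 0` for `ρ ≥ 0`. -/
theorem exists_ac_solution (hρ : ∀ s t : ℝ, 0 < s → s ≤ t → IntervalIntegrable ρ volume s t)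
    (hρ0 : ∀ x, 0 < x → 0 ≤ ρ x) (hg : IntegrableOn g (Ioi 0)) :
    ∃ F : ℝ → ℝ, (∀ x y : ℝ, 0 < x → x < y → AbsolutelyContinuousOnInterval F x y) ∧
      (∀ᵐ x ∂volume.restrict (Ioi (0 : ℝ)), deriv F x + ρ x * F x = g x) ∧
      ∀ x, 0 < x → |F x| ≤ ∫ y in (0 : ℝ)..x, |g y| := by
  -- The primitive starts at `1` because `ρ` need not be integrable near `0`. Since `Q` is
  -- increasing, `exp Q` stays bounded near `0`, so the integral of `exp Q * g` can start at `0`.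
  set Q : ℝ → ℝ := fun x => ∫ y in (1 : ℝ)..x, ρ y with hQ
  have hQac : ∀ x y : ℝ, 0 < x → x < y → AbsolutelyContinuousOnInterval Q x y :=
    fun x y hx hxy => ac_primitive hρ hx hxy.le
  have hQmono : MonotoneOn Q (Ioi 0) := monotoneOn_primitive hρ hρ0
  have hQc : ContinuousOn Q (Ioi 0) := continuousOn_Ioi_zero_of_ac hQac
  have hEi : ∀ R, 0 < R → IntegrableOn (fun y => Real.exp (Q y) * g y) (Ioc 0 R) := fun R hR => by
    have hsub : Ioc 0 R ⊆ Ioi (0 : ℝ) := Ioc_subset_Ioi_self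
    refine Integrable.bdd_mul (c := Real.exp (Q R)) (hg.mono_set hsub)
      ((hQc.rexp.mono hsub).aestronglyMeasurable measurableSet_Ioc) ?_
    filter_upwards [ae_restrict_mem measurableSet_Ioc] with y hy
    rw [Real.norm_of_nonneg (Real.exp_pos _).le]
    exact Real.exp_le_exp.2 (hQmono hy.1 hR hy.2)
  have hEii : ∀ R, 0 < R → IntervalIntegrable (fun y => Real.exp (Q y) * g y) volume 0 R :=
    fun R hR => (intervalIntegrable_iff_integrableOn_Ioc_of_le hR.le).2 (hEi R hR)
  set J : ℝ → ℝ := fun x => ∫ y in (0 : ℝ)..x, Real.exp (Q y) * g y with hJ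
  have hJac : ∀ x y : ℝ, 0 < x → x < y → AbsolutelyContinuousOnInterval J x y := fun x y hx hxy => by
    refine ((hEii y (hx.trans hxy)).absolutelyContinuousOnInterval_intervalIntegral
      left_mem_uIcc).mono ?_
    rw [uIcc_of_le hxy.le, uIcc_of_le (hx.trans hxy).le]
    exact Icc_subset_Icc_left hx.le
  have hJd : ∀ᵐ x ∂volume.restrict (Ioi (0 : ℝ)), HasDerivAt J (Real.exp (Q x) * g x) x := by
    refine ae_restrict_Ioi_zero_of_forall_Icc fun s t hs hst => ?_
    filter_upwards [(hEii t (hs.trans hst)).ae_hasDerivAt_integral] with x hx hxs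
    refine hx ?_ 0 left_mem_uIcc
    rw [uIcc_of_le (hs.trans hst).le]
    exact ⟨hs.le.trans hxs.1, hxs.2⟩
  refine ⟨fun x => Real.exp (-Q x) * J x, fun x y hx hxy => ?_, ?_, fun x hx => ?_⟩
  -- The exponential is Lipschitz only on half-lines `(-∞, c]`. Monotonicity of `Q` keeps `-Q` below
  -- `-Q x` on the interval.
  · have hlip : LipschitzOnWith (Real.toNNReal (Real.exp (-Q x))) Real.exp (Iic (-Q x)) := by
      refine Convex.lipschitzOnWith_of_nnnorm_deriv_le
        (fun z _ => Real.differentiableAt_exp) (fun z hz => ?_) (convex_Iic _)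
      rw [Real.deriv_exp, ← NNReal.coe_le_coe, coe_nnnorm, Real.norm_of_nonneg (Real.exp_pos _).le,
        Real.coe_toNNReal _ (Real.exp_pos _).le]
      exact Real.exp_le_exp.2 hz
    refine (absolutelyContinuousOnInterval_comp hlip (hQac x y hx hxy).fun_neg ?_).fun_mul
      (hJac x y hx hxy)
    intro z hz
    rw [uIcc_of_le hxy.le] at hz
    exact neg_le_neg (hQmono hx (hx.trans_le hz.1) hz.1)
  · filter_upwards [ae_hasDerivAt_primitive hρ, hJd] with x h1 h2
    have h3 := (h1.neg.exp.mul h2).deriv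
    have h4 : Real.exp (-Q x) * (Real.exp (Q x) * g x) = g x := by
      rw [← mul_assoc, ← Real.exp_add]; simp
    change deriv (fun x => Real.exp (-Q x) * J x) x = _ at h3
    rw [h3]
    change Real.exp (-Q x) * -ρ x * J x + Real.exp (-Q x) * (Real.exp (Q x) * g x) + _ = _
    rw [h4]
    ring
  · have hgi : IntervalIntegrable (fun y => |g y|) volume 0 x :=
      (intervalIntegrable_iff_integrableOn_Ioc_of_le hx.le).2
        (hg.mono_set Ioc_subset_Ioi_self).abs
    have h1 : |J x| ≤ ∫ y in (0 : ℝ)..x, Real.exp (Q x) * |g y| := by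
      refine (intervalIntegral.abs_integral_le_integral_abs hx.le).trans ?_
      refine intervalIntegral.integral_mono_on_of_le_Ioo hx.le (hEii x hx).abs
        (hgi.const_mul _) fun y hy => ?_
      rw [abs_mul, abs_of_pos (Real.exp_pos _)]
      gcongr
      exact hQmono hy.1 hx hy.2.le
    rw [intervalIntegral.integral_const_mul] at h1
    rw [abs_mul, abs_of_pos (Real.exp_pos _)]
    calc Real.exp (-Q x) * |J x| ≤ Real.exp (-Q x) * (Real.exp (Q x) * ∫ y in (0 : ℝ)..x, |g y|) := by
          gcongr
      _ = _ := by rw [← mul_assoc, ← Real.exp_add]; simp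

end LinearODE

/-! ### Resolvent of the transport operator -/

section TransportResolvent

variable {r q : ℝ → ℝ} {r₀ r₁ m : ℝ}

theorem TransportData.integrableOn_mul_inv_growth (hd : TransportData r q r₀ r₁) {u : ℝ → ℝ}
    (hu : LocEssBounded u) {s t : ℝ} (hs : 0 < s) :
    IntegrableOn (fun x => u x / r x) (Ioc s t) := by
  obtain ⟨C, -, hC⟩ := hu.exists_bound t
  have hsub : Ioc s t ⊆ Ioi 0 := fun x hx => hs.trans hx.1
  refine (Integrable.bdd_mul (f := u) (c := C)
    ((hd.integrableOn_inv_growth (t := t) hs).mono_set Ioc_subset_Icc_self)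
    (hu.aestronglyMeasurable.mono_measure (Measure.restrict_mono hsub le_rfl)) ?_).congr
    (Eventually.of_forall fun x => by simp [div_eq_mul_inv])
  rw [ae_restrict_iff' measurableSet_Ioc]
  filter_upwards [hC] with x hx hxs using hx ⟨hs.trans hxs.1, hxs.2⟩

theorem LocEssBounded.const_add {u : ℝ → ℝ} (hu : LocEssBounded u) (k : ℝ) :
    LocEssBounded fun x => k + u x := fun R =>
  (memLp_top_const k).add (hu R)

theorem locEssBounded_const (k : ℝ) : LocEssBounded fun _ => k := fun _ => memLp_top_const k

/-- The resolvent equation of the transport operator is solvable. -/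
theorem TransportData.exists_flux (hd : TransportData r q r₀ r₁) (hm : 1 ≤ m) {k : ℝ}
    (hk : m * (r₀ + r₁) < k) (g : X m) :
    ∃ (f : X m) (F : ℝ → ℝ), IsTransportFlux r q m f F ∧
      ∀ᵐ x ∂volume.restrict (Ioi (0 : ℝ)), deriv F x + (k + q x) * f x = g x := by
  have hK0 : 0 ≤ m * (r₀ + r₁) :=
    mul_nonneg (by linarith) (add_nonneg hd.r₀_nonneg hd.r₁_nonneg)
  have hk0 : 0 < k := hK0.trans_lt hk
  have hg1 : IntegrableOn g (Ioi 0) := integrableOn_of_integrable_weightMeasure (X.integrable g)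
  -- In terms of the flux `F = r f` the resolvent equation reads `F' + ((k + q) / r) F = g`.
  obtain ⟨F, hFac, hFode, hFle⟩ := exists_ac_solution (ρ := fun x => (k + q x) / r x)
    (fun s t hs hst => (intervalIntegrable_iff_integrableOn_Ioc_of_le hst).2
      (hd.integrableOn_mul_inv_growth (hd.absorption.const_add k) hs))
    (fun x hx => div_nonneg (add_nonneg hk0.le (hd.absorption_nonneg x hx)) (hd.growth x hx).1.le)
    hg1
  have hFc := continuousOn_Ioi_zero_of_ac hFac
  set f : ℝ → ℝ := fun x => F x / r x with hf
  have hfm : AEStronglyMeasurable f (volume.restrict (Ioi 0)) :=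
    ((hFc.aestronglyMeasurable measurableSet_Ioi).aemeasurable.div
      hd.aestronglyMeasurable_growth.aemeasurable).aestronglyMeasurable
  have hrep : ∀ᵐ x ∂volume.restrict (Ioi (0 : ℝ)), F x = r x * f x := by
    filter_upwards [ae_restrict_mem measurableSet_Ioi] with x hx
    rw [hf]
    field_simp [(hd.growth x hx).1.ne']
  have hode : ∀ᵐ x ∂volume.restrict (Ioi (0 : ℝ)), deriv F x + (k + q x) * f x = g x := by
    filter_upwards [hFode] with x hx
    rw [← hx, hf]
    ring
  -- integrability on compact subintervals
  have hloc : ∀ {u : ℝ → ℝ}, LocEssBounded u → ∀ {s t : ℝ}, 0 < s → s ≤ t →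
      IntegrableOn (fun x => u x * |f x| * (1 + x ^ m)) (Ioc s t) := by
    intro u hu s t hs hst
    have hsub : Icc s t ⊆ Ioi 0 := fun x hx => hs.trans_le hx.1
    have hc : ContinuousOn (fun x => |F x| * (1 + x ^ m)) (Icc s t) :=
      (hFc.mono hsub).abs.mul (continuousOn_const.add (continuousOn_id.rpow_const
        fun x hx => Or.inl (hsub hx).ne'))
    obtain ⟨C, hC⟩ := isCompact_Icc.exists_bound_of_continuousOn hc
    refine (Integrable.bdd_mul (c := C) (hd.integrableOn_mul_inv_growth hu (t := t) hs)
      ((hc.mono Ioc_subset_Icc_self).aestronglyMeasurable measurableSet_Ioc) ?_).congr ?_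
    · filter_upwards [ae_restrict_mem measurableSet_Ioc] with x hx
        using hC x (Ioc_subset_Icc_self hx)
    · filter_upwards [ae_restrict_mem measurableSet_Ioc] with x hx
      rw [hf]
      simp only
      rw [abs_div, abs_of_pos (hd.growth x (hs.trans hx.1)).1]
      ring
  have hgw : IntegrableOn (fun x => |g x| * (1 + x ^ m)) (Ioi 0) :=
    integrable_weightMeasure_iff.1 (X.integrable g).abs
  set K := m * (r₀ + r₁) with hK
  -- An a priori bound uniform in the interval gives global integrability of `f` and `q f` at once.
  -- The condition `s ≤ 1` only bounds the boundary weight `1 + s ^ m` by `2`.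
  have hbound : ∀ s t : ℝ, 0 < s → s ≤ t → s ≤ 1 →
      ∫ x in Ioc s t, (k - K + q x) * |f x| * (1 + x ^ m) ≤
        (∫ x in Ioi 0, |g x| * (1 + x ^ m)) + (∫ x in Ioi 0, |g x|) * 2 := by
    intro s t hs hst hs1
    have hsub : Ioc s t ⊆ Ioi 0 := fun x hx => hs.trans hx.1
    have i1 := hloc (hd.absorption.const_add (k - K)) hs hst
    have i2 : IntegrableOn (fun x => |g x| * (1 + x ^ m)) (Ioc s t) := hgw.mono_set hsub
    have e : (fun x => (|g x| + m * (r₀ + r₁) * |f x| - (k + q x) * |f x|) * (1 + x ^ m))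
        = fun x => |g x| * (1 + x ^ m) - (k - K + q x) * |f x| * (1 + x ^ m) := by
      funext x; rw [hK]; ring
    have hac : AbsolutelyContinuousOnInterval F s t := by
      refine (hFac s (t + 1) hs (by linarith)).mono ?_
      rw [uIcc_of_le hst, uIcc_of_le (by linarith)]
      exact Icc_subset_Icc_right (by linarith)
    have h1 := hd.neg_le_integral hm hs hst hac hrep hode (by
      rw [e, intervalIntegrable_iff_integrableOn_Ioc_of_le hst]
      exact i2.sub i1)
    rw [e, intervalIntegral.integral_of_le hst, integral_sub i2 i1] at h1
    have h2 : ∫ x in Ioc s t, |g x| * (1 + x ^ m) ≤ ∫ x in Ioi 0, |g x| * (1 + x ^ m) := by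
      refine setIntegral_mono_set hgw ?_ (LE.le.eventuallyLE hsub)
      filter_upwards [ae_restrict_mem measurableSet_Ioi] with x hx
      exact mul_nonneg (abs_nonneg _) (weight_pos m hx).le
    have h3 : |F s| ≤ ∫ x in Ioi 0, |g x| := by
      refine (hFle s hs).trans ?_
      rw [intervalIntegral.integral_of_le hs.le]
      exact setIntegral_mono_set hg1.abs (Eventually.of_forall fun x => abs_nonneg _)
        (LE.le.eventuallyLE Ioc_subset_Ioi_self)
    have h4 : |F s| * (1 + s ^ m) ≤ (∫ x in Ioi 0, |g x|) * 2 := by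
      refine mul_le_mul h3 ?_ (weight_pos m hs).le ((abs_nonneg _).trans h3)
      linarith [Real.rpow_le_one hs.le hs1 (by linarith : 0 ≤ m)]
    linarith
  have hmeasw : AEStronglyMeasurable (fun x : ℝ => 1 + x ^ m) (volume.restrict (Ioi 0)) := by
    fun_prop
  have h_int : IntegrableOn (fun x => (k - K + q x) * |f x| * (1 + x ^ m)) (Ioi 0) := by
    refine aecover_Ioi_zero.integrable_of_integral_norm_bounded
      ((∫ x in Ioi 0, |g x| * (1 + x ^ m)) + (∫ x in Ioi 0, |g x|) * 2) (fun n => ?_)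
      (Eventually.of_forall fun n => ?_)
    · rw [IntegrableOn, restrict_Ioi_zero_restrict_Ioc (one_div_natCast_add_one_pos n).le]
      exact hloc (hd.absorption.const_add (k - K)) (one_div_natCast_add_one_pos n)
        (one_div_natCast_add_one_le n)
    · rw [restrict_Ioi_zero_restrict_Ioc (one_div_natCast_add_one_pos n).le]
      refine le_trans (le_of_eq ?_) (hbound _ _ (one_div_natCast_add_one_pos n)
        (one_div_natCast_add_one_le n) ?_)
      · refine setIntegral_congr_fun measurableSet_Ioc fun x hx => ?_
        have hx0 : 0 < x := (one_div_natCast_add_one_pos n).trans hx.1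
        refine Real.norm_of_nonneg (mul_nonneg (mul_nonneg ?_ (abs_nonneg _)) (weight_pos m hx0).le)
        linarith [hd.absorption_nonneg x hx0]
      · rw [div_le_one (by positivity)]
        linarith [(Nat.cast_nonneg n : (0 : ℝ) ≤ n)]
  have hfi : Integrable f (weightMeasure m) := by
    rw [integrable_weightMeasure_iff]
    refine Integrable.mono (h_int.const_mul (k - K)⁻¹) (hfm.mul hmeasw) ?_
    filter_upwards [ae_restrict_mem measurableSet_Ioi] with x hx
    have hx : 0 < x := hx
    have hq := hd.absorption_nonneg x hx
    have hw := weight_pos m hx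
    have hnn : 0 ≤ (k - K)⁻¹ * ((k - K + q x) * |f x| * (1 + x ^ m)) :=
      mul_nonneg (inv_nonneg.2 (by linarith)) (mul_nonneg (mul_nonneg (by linarith)
        (abs_nonneg _)) hw.le)
    rw [norm_mul, Real.norm_of_nonneg hw.le, Real.norm_of_nonneg hnn, Real.norm_eq_abs,
      ← mul_assoc, ← mul_assoc]
    refine mul_le_mul_of_nonneg_right (le_mul_of_one_le_left (abs_nonneg _) ?_) hw.le
    rw [inv_mul_eq_div, one_le_div (by linarith)]
    linarith
  have hqfi : Integrable (fun x => q x * f x) (weightMeasure m) := by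
    rw [integrable_weightMeasure_iff]
    refine Integrable.mono h_int ((hd.absorption.aestronglyMeasurable.mul hfm).mul hmeasw) ?_
    filter_upwards [ae_restrict_mem measurableSet_Ioi] with x hx
    have hx : 0 < x := hx
    have hq := hd.absorption_nonneg x hx
    have hw := weight_pos m hx
    rw [norm_mul, norm_mul, norm_mul, norm_mul, Real.norm_of_nonneg hq,
      Real.norm_of_nonneg (by linarith : 0 ≤ k - K + q x), norm_abs_eq_norm]
    gcongr
    linarith
  have hcoe : ∀ᵐ x ∂volume.restrict (Ioi (0 : ℝ)),
      ((memLp_one_iff_integrable.2 hfi).toLp f : X m) x = f x := by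
    rw [← ae_weightMeasure m]
    exact MemLp.coeFn_toLp _
  refine ⟨(memLp_one_iff_integrable.2 hfi).toLp f, F, ⟨?_, hFac, ?_, ?_, fun _ => ?_⟩, ?_⟩
  · filter_upwards [hrep, hcoe] with x h1 h2
    rw [h1, h2]
  · rw [memLp_one_iff_integrable]
    refine ((X.integrable g).sub ((hfi.const_mul k).add hqfi)).congr ?_
    rw [Filter.EventuallyEq, ae_weightMeasure]
    filter_upwards [hode] with x hx
    simp only [Pi.sub_apply, Pi.add_apply]
    linarith
  · rw [memLp_one_iff_integrable]
    refine hqfi.congr ?_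
    rw [Filter.EventuallyEq, ae_weightMeasure]
    filter_upwards [hcoe] with x hx
    rw [hx]
  · have hgi : IntervalIntegrable (fun y => |g y|) volume 0 1 :=
      (intervalIntegrable_iff_integrableOn_Ioc_of_le zero_le_one).2
        (hg1.mono_set Ioc_subset_Ioi_self).abs
    have hc := intervalIntegral.continuousOn_primitive_interval' hgi left_mem_uIcc
    rw [uIcc_of_le zero_le_one] at hc
    have h1 : Tendsto (fun x => ∫ y in (0 : ℝ)..x, |g y|) (𝓝[>] 0) (𝓝 0) := by
      have h2 := hc 0 (left_mem_Icc.2 zero_le_one)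
      rw [ContinuousWithinAt, intervalIntegral.integral_same] at h2
      refine h2.mono_left (le_inf inf_le_left (le_principal_iff.2 ?_))
      filter_upwards [Ioc_mem_nhdsGT (zero_lt_one' ℝ)] with x hx using ⟨hx.1.le, hx.2⟩
    refine squeeze_zero_norm' ?_ h1
    filter_upwards [self_mem_nhdsWithin] with x hx using hFle x hx
  · filter_upwards [hode, hcoe] with x h1 h2
    rw [h2, h1]

end TransportResolvent

/-! ### Moments of the fragmentation kernel -/

/-- The standing assumptions on the fragmentation kernel. -/
structure KernelData (b : ℝ → ℝ → ℝ) (b₀ l : ℝ) : Prop where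
  measurable : Measurable (Function.uncurry b)
  nonneg : ∀ x y : ℝ, 0 < x → 0 < y → 0 ≤ b x y
  mass : ∀ y : ℝ, 0 < y → daughterMoment b 1 y = ENNReal.ofReal y
  b₀_nonneg : 0 ≤ b₀
  l_nonneg : 0 ≤ l
  number : ∀ y : ℝ, 0 < y → daughterMoment b 0 y ≤ ENNReal.ofReal (b₀ * (1 + y ^ l))
  loss : ∃ m₀ : ℝ, 1 < m₀ ∧ 0 < liminf (fun y : ℝ => momentLoss b m₀ y / y ^ m₀) atTop

section Moments

variable {b : ℝ → ℝ → ℝ} {b₀ l : ℝ}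

theorem KernelData.measurable_left (hb : KernelData b b₀ l) (y : ℝ) : Measurable fun x => b x y :=
  hb.measurable.comp (measurable_id.prodMk measurable_const)

/-- A pointwise bound for powers integrates to a bound for daughter moments. -/
theorem KernelData.daughterMoment_le (hb : KernelData b b₀ l) {m m₀ y c d : ℝ} (hy : 0 < y)
    (hc : 0 ≤ c) (hd : 0 ≤ d) (h : ∀ x, 0 < x → x ≤ y → x ^ m ≤ c * x ^ (1 : ℝ) + d * x ^ m₀) :
    daughterMoment b m y ≤ ENNReal.ofReal c * ENNReal.ofReal y +
      ENNReal.ofReal d * daughterMoment b m₀ y := by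
  rw [← hb.mass y hy, daughterMoment, daughterMoment, daughterMoment]
  have hmeas : ∀ k : ℝ, Measurable fun x => ENNReal.ofReal (b x y * x ^ k) := fun k =>
    ((hb.measurable_left y).mul (measurable_id.pow_const k)).ennreal_ofReal
  rw [← lintegral_const_mul _ (hmeas 1), ← lintegral_const_mul _ (hmeas m₀),
    ← lintegral_add_left ((hmeas 1).const_mul _)]
  refine setLIntegral_mono' measurableSet_Ioc fun x hx => ?_
  have hbx := hb.nonneg x y hx.1 hy
  rw [← ENNReal.ofReal_mul hc, ← ENNReal.ofReal_mul hd, ← ENNReal.ofReal_add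
    (mul_nonneg hc (mul_nonneg hbx (Real.rpow_nonneg hx.1.le _)))
    (mul_nonneg hd (mul_nonneg hbx (Real.rpow_nonneg hx.1.le _)))]
  refine ENNReal.ofReal_le_ofReal ?_
  calc b x y * x ^ m ≤ b x y * (c * x ^ (1 : ℝ) + d * x ^ m₀) := by
        gcongr; exact h x hx.1 hx.2
    _ = _ := by ring

/-- Fragments are no larger than the parent, so `x ^ m ≤ y ^ (m - 1) * x`, and mass is conserved. -/
theorem KernelData.daughterMoment_le_rpow (hb : KernelData b b₀ l) {m y : ℝ} (hm : 1 ≤ m)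
    (hy : 0 < y) : daughterMoment b m y ≤ ENNReal.ofReal (y ^ m) := by
  have h := hb.daughterMoment_le (m := m) (m₀ := 1) hy (c := y ^ (m - 1)) (d := 0)
    (Real.rpow_nonneg hy.le _) le_rfl fun x hx hxy => by
      have e : x ^ m = x ^ (m - 1) * x := by
        rw [Real.rpow_sub_one hx.ne']; field_simp
      rw [zero_mul, add_zero, Real.rpow_one, e]
      gcongr
  rw [ENNReal.ofReal_zero, zero_mul, add_zero,
    ← ENNReal.ofReal_mul (Real.rpow_nonneg hy.le _), Real.rpow_sub_one hy.ne',
    div_mul_cancel₀ _ hy.ne'] at h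
  exact h

/-- Interpolation of powers between the exponents `1` and `m₀`. -/
theorem rpow_le_interpolate {m m₀ κ x y : ℝ} (hκ0 : 0 ≤ κ) (hκ1 : κ ≤ 1)
    (hκ : κ * (m₀ - 1) ≤ m - 1) (hx : 0 < x) (hxy : x ≤ y) :
    x ^ m ≤ (1 - κ) * y ^ (m - 1) * x ^ (1 : ℝ) + κ * y ^ (m - m₀) * x ^ m₀ := by
  have hy : 0 < y := hx.trans_le hxy
  set z := x / y with hz
  have hz0 : 0 < z := div_pos hx hy
  have hz1 : z ≤ 1 := (div_le_one hy).2 hxy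
  have hxz : x = z * y := by rw [hz, div_mul_cancel₀ _ hy.ne']
  -- Bernoulli's inequality with exponent `κ ≤ 1`, applied to `z ^ (m₀ - 1)`. All other factors are
  -- homogeneous in `y`.
  have h1 : z ^ (m - 1) ≤ 1 - κ + κ * z ^ (m₀ - 1) := by
    calc z ^ (m - 1) ≤ z ^ ((m₀ - 1) * κ) :=
          Real.rpow_le_rpow_of_exponent_ge hz0 hz1 (by linarith)
      _ = (1 + (z ^ (m₀ - 1) - 1)) ^ κ := by rw [Real.rpow_mul hz0.le]; congr 1; ring
      _ ≤ 1 + κ * (z ^ (m₀ - 1) - 1) :=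
          rpow_one_add_le_one_add_mul_self
            (by linarith [Real.rpow_nonneg hz0.le (m₀ - 1)]) hκ0 hκ1
      _ = _ := by ring
  have e1 : x ^ m = z ^ (m - 1) * (z * y ^ m) := by
    rw [hxz, Real.mul_rpow hz0.le hy.le, Real.rpow_sub_one hz0.ne']; field_simp
  have e2 : y ^ (m - 1) * x ^ (1 : ℝ) = z * y ^ m := by
    rw [Real.rpow_one, hxz, Real.rpow_sub_one hy.ne']; field_simp
  have e3 : y ^ (m - m₀) * x ^ m₀ = z ^ (m₀ - 1) * (z * y ^ m) := by
    rw [hxz, Real.mul_rpow hz0.le hy.le, Real.rpow_sub_one hz0.ne', Real.rpow_sub hy]; field_simp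
  rw [mul_assoc, mul_assoc, e1, e2, e3]
  have := mul_le_mul_of_nonneg_right h1 (mul_nonneg hz0.le (Real.rpow_nonneg hy.le m))
  linarith

/-- A relative loss `δ` at the one exponent `m₀` passes to every exponent above `1`: interpolation
between the conserved moment `1` and the moment `m₀` keeps a fraction `κ` of it. -/
theorem KernelData.exists_daughterMoment_le_mul_rpow (hb : KernelData b b₀ l) {m : ℝ}
    (hm : 1 < m) : ∃ δ R : ℝ, 0 < δ ∧ δ ≤ 1 ∧ 0 < R ∧ ∀ y, R ≤ y →
      daughterMoment b m y ≤ ENNReal.ofReal ((1 - δ) * y ^ m) := by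
  obtain ⟨m₀, hm₀, hlim⟩ := hb.loss
  set c := liminf (fun y : ℝ => momentLoss b m₀ y / y ^ m₀) atTop
  have hbdd : IsBoundedUnder (· ≥ ·) atTop fun y : ℝ => momentLoss b m₀ y / y ^ m₀ := by
    refine isBoundedUnder_of_eventually_ge (a := 0) ?_
    filter_upwards [eventually_gt_atTop 0] with y hy
    refine div_nonneg ?_ (Real.rpow_nonneg hy.le _)
    rw [momentLoss, sub_nonneg]
    exact ENNReal.toReal_le_of_le_ofReal (Real.rpow_nonneg hy.le _)
      (hb.daughterMoment_le_rpow hm₀.le hy)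
  have hev : ∀ᶠ y in atTop, min (c / 2) 1 < momentLoss b m₀ y / y ^ m₀ :=
    eventually_lt_of_lt_liminf (lt_of_le_of_lt (min_le_left _ _) (by linarith)) hbdd
  obtain ⟨R, hR⟩ := eventually_atTop.1 hev
  set δ := min (c / 2) 1
  have hδ : 0 < δ := lt_min (by linarith) one_pos
  have hδ1 : δ ≤ 1 := min_le_right _ _
  -- The quotient is the largest `κ` that the interpolation allows; the cap at `1` acts when `m >
  -- m₀`.
  set κ := min 1 ((m - 1) / (m₀ - 1))
  have hκ : 0 < κ := lt_min one_pos (div_pos (by linarith) (by linarith))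
  have hκ1 : κ ≤ 1 := min_le_left _ _
  have hκm : κ * (m₀ - 1) ≤ m - 1 := by
    rw [← le_div_iff₀ (by linarith)]
    exact min_le_right _ _
  refine ⟨κ * δ, max R 1, mul_pos hκ hδ, mul_le_one₀ hκ1 hδ.le hδ1,
    lt_max_of_lt_right one_pos, fun y hy => ?_⟩
  have hy0 : 0 < y := lt_of_lt_of_le one_pos ((le_max_right _ _).trans hy)
  have hyp : ∀ k : ℝ, 0 ≤ y ^ k := Real.rpow_nonneg hy0.le
  have h0 : daughterMoment b m₀ y ≤ ENNReal.ofReal ((1 - δ) * y ^ m₀) := by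
    have h1 := hR y ((le_max_left _ _).trans hy)
    rw [lt_div_iff₀ (Real.rpow_pos_of_pos hy0 _), momentLoss] at h1
    rw [← ENNReal.ofReal_toReal (ne_top_of_le_ne_top ENNReal.ofReal_ne_top
      (hb.daughterMoment_le_rpow hm₀.le hy0))]
    exact ENNReal.ofReal_le_ofReal (by linarith)
  have h2 := hb.daughterMoment_le (m := m) (m₀ := m₀) hy0 (c := (1 - κ) * y ^ (m - 1))
    (d := κ * y ^ (m - m₀)) (mul_nonneg (by linarith) (hyp _)) (mul_nonneg hκ.le (hyp _))
    fun x hx hxy => rpow_le_interpolate hκ.le hκ1 hκm hx hxy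
  refine h2.trans ((add_le_add le_rfl (mul_le_mul_right h0 _)).trans (le_of_eq ?_))
  rw [← ENNReal.ofReal_mul (mul_nonneg (by linarith) (hyp _)),
    ← ENNReal.ofReal_mul (mul_nonneg hκ.le (hyp _)), ← ENNReal.ofReal_add]
  · congr 1
    have e1 : y ^ (m - 1) * y = y ^ m := by
      rw [Real.rpow_sub_one hy0.ne', div_mul_cancel₀ _ hy0.ne']
    have e2 : y ^ (m - m₀) * y ^ m₀ = y ^ m := by rw [← Real.rpow_add hy0, sub_add_cancel]
    calc _ = (1 - κ) * (y ^ (m - 1) * y) + κ * (1 - δ) * (y ^ (m - m₀) * y ^ m₀) := by ring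
      _ = _ := by rw [e1, e2]; ring
  · exact mul_nonneg (mul_nonneg (by linarith) (hyp _)) hy0.le
  · exact mul_nonneg (mul_nonneg hκ.le (hyp _)) (mul_nonneg (by linarith) (hyp _))

theorem eventually_mul_one_add_rpow_le {b₀ l m c : ℝ} (hc : 0 < c) (hm : 0 < m) (hlm : l < m) :
    ∀ᶠ y : ℝ in atTop, b₀ * (1 + y ^ l) ≤ c * y ^ m := by
  have h1 : Tendsto (fun y : ℝ => b₀ * (y ^ (-m) + y ^ (-(m - l)))) atTop (𝓝 0) := by
    simpa using ((tendsto_rpow_neg_atTop hm).add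
      (tendsto_rpow_neg_atTop (sub_pos.2 hlm))).const_mul b₀
  filter_upwards [h1.eventually (gt_mem_nhds hc), eventually_gt_atTop 0] with y hy hy0
  have h2 := mul_le_mul_of_nonneg_right hy.le (Real.rpow_nonneg hy0.le m)
  have e1 : y ^ (-m) * y ^ m = 1 := by rw [← Real.rpow_add hy0]; simp
  have e2 : y ^ (-(m - l)) * y ^ m = y ^ l := by rw [← Real.rpow_add hy0]; congr 1; ring
  calc b₀ * (1 + y ^ l) = b₀ * (y ^ (-m) + y ^ (-(m - l))) * y ^ m := by
        rw [mul_assoc, add_mul, e1, e2]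
    _ ≤ _ := h2

/-- Fragmentation strictly dissipates the weight at large sizes. -/
theorem KernelData.exists_gain_weight_le (hb : KernelData b b₀ l) {a : ℝ → ℝ}
    (ha : LocEssBounded a) (ha0 : ∀ x, 0 < x → 0 ≤ a x) {m : ℝ} (hm : max 1 l < m) :
    ∃ c C : ℝ, 0 < c ∧ c ≤ 1 ∧ 0 ≤ C ∧ ∀ᵐ y ∂volume.restrict (Ioi (0 : ℝ)),
      ENNReal.ofReal (a y) * (daughterMoment b 0 y + daughterMoment b m y) ≤
        ENNReal.ofReal (((1 - c) * a y + C) * (1 + y ^ m)) := by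
  have hm1 : 1 < m := (le_max_left _ _).trans_lt hm
  have hml : l < m := (le_max_right _ _).trans_lt hm
  obtain ⟨δ, R, hδ, hδ1, hR, hδR⟩ := hb.exists_daughterMoment_le_mul_rpow hm1
  obtain ⟨R', hR'⟩ := eventually_atTop.1
    (eventually_mul_one_add_rpow_le (b₀ := b₀) (half_pos hδ) (by linarith) hml)
  obtain ⟨A, hA, hAR⟩ := ha.exists_bound (max R R')
  have hb₀ := hb.b₀_nonneg
  -- At large sizes half of the loss `δ` pays for the number of fragments, which is of lower order
  -- as `l < m`, and the other half is `c`. At bounded sizes `a ≤ A` and everything goes into `C`.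
  refine ⟨δ / 2, A * (2 * b₀ + 1), by linarith, by linarith, by positivity, ?_⟩
  rw [ae_restrict_iff' measurableSet_Ioi]
  filter_upwards [hAR] with y hy hy0
  have hy0 : 0 < y := hy0
  have hw := weight_pos m hy0
  have hay := ha0 y hy0
  have hyl := Real.rpow_nonneg hy0.le l
  have hym := Real.rpow_nonneg hy0.le m
  have hn0 := hb.number y hy0
  rcases le_total y (max R R') with h | h
  · have hn : daughterMoment b 0 y + daughterMoment b m y ≤
        ENNReal.ofReal ((2 * b₀ + 1) * (1 + y ^ m)) := by
      refine (add_le_add hn0 (hb.daughterMoment_le_rpow hm1.le hy0)).trans ?_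
      rw [← ENNReal.ofReal_add (by positivity) hym]
      refine ENNReal.ofReal_le_ofReal ?_
      have h1 := mul_le_mul_of_nonneg_left (rpow_le_weight hb.l_nonneg hml.le hy0) hb₀
      have h2 := mul_le_mul_of_nonneg_left (one_le_weight m hy0) hb₀
      linarith
    refine (mul_le_mul_right hn _).trans ?_
    rw [← ENNReal.ofReal_mul hay]
    refine ENNReal.ofReal_le_ofReal ?_
    have h3 : a y ≤ A := (le_abs_self _).trans (hy ⟨hy0, h⟩)
    have h4 : 0 ≤ (1 - δ / 2) * a y := mul_nonneg (by linarith) hay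
    calc a y * ((2 * b₀ + 1) * (1 + y ^ m)) ≤ A * ((2 * b₀ + 1) * (1 + y ^ m)) := by gcongr
      _ = (0 + A * (2 * b₀ + 1)) * (1 + y ^ m) := by ring
      _ ≤ _ := by gcongr
  · have hn : daughterMoment b 0 y + daughterMoment b m y ≤
        ENNReal.ofReal ((1 - δ / 2) * (1 + y ^ m)) := by
      refine (add_le_add hn0 (hδR y ((le_max_left _ _).trans h))).trans ?_
      rw [← ENNReal.ofReal_add (by positivity) (mul_nonneg (by linarith) hym)]
      refine ENNReal.ofReal_le_ofReal ?_
      have h1 := hR' y ((le_max_right _ _).trans h)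
      linarith
    refine (mul_le_mul_right hn _).trans ?_
    rw [← ENNReal.ofReal_mul hay]
    refine ENNReal.ofReal_le_ofReal ?_
    have h4 : 0 ≤ A * (2 * b₀ + 1) * (1 + y ^ m) := by positivity
    linarith

end Moments

/-! ### The gain operator -/

section Gain

variable {a : ℝ → ℝ} {b : ℝ → ℝ → ℝ} {b₀ l : ℝ}

/-- The integrand of the gain operator, extended by zero below the diagonal. -/
def gainIntegrand (b : ℝ → ℝ → ℝ) (u : ℝ → ℝ) (x y : ℝ) : ℝ :=
  (Ioi x).indicator (fun y => b x y * u y) y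

theorem KernelData.measurable_gainIntegrand (hb : KernelData b b₀ l) {u : ℝ → ℝ}
    (hu : Measurable u) : Measurable (Function.uncurry (gainIntegrand b u)) := by
  have h : Function.uncurry (gainIntegrand b u) =
      {p : ℝ × ℝ | p.1 < p.2}.indicator fun p => Function.uncurry b p * u p.2 := by
    ext ⟨x, y⟩
    by_cases hxy : x < y
    · simp [gainIntegrand, hxy]
    · simp [gainIntegrand, hxy]
  rw [h]
  exact (hb.measurable.mul (hu.comp measurable_snd)).indicator
    (measurableSet_lt measurable_fst measurable_snd)

variable {f u : ℝ → ℝ}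

theorem gainIntegrand_ae_eq (huf : ∀ᵐ y ∂volume.restrict (Ioi (0 : ℝ)), a y * f y = u y) {x : ℝ}
    (hx : 0 < x) : (fun y => a y * b x y * f y) =ᵐ[volume.restrict (Ioi x)]
      fun y => b x y * u y := by
  have hsub : Ioi x ⊆ Ioi 0 := fun y hy => hx.trans hy
  filter_upwards [ae_restrict_of_ae_restrict_of_subset hsub huf] with y hy
  rw [← hy]
  ring

theorem gain_eq_integral (huf : ∀ᵐ y ∂volume.restrict (Ioi (0 : ℝ)), a y * f y = u y) {x : ℝ}
    (hx : 0 < x) : gain a b f x = ∫ y in Ioi 0, gainIntegrand b u x y := by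
  have hsub : Ioi x ⊆ Ioi 0 := fun y hy => hx.trans hy
  rw [gain, integral_congr_ae (gainIntegrand_ae_eq huf hx)]
  simp only [gainIntegrand]
  rw [setIntegral_indicator measurableSet_Ioi, inter_eq_self_of_subset_right hsub]

/-- By Tonelli: integrating the weight against the fragments of a fixed parent `y` gives the moments
of order `0` and `m`. -/
theorem KernelData.lintegral_gainIntegrand_le (hb : KernelData b b₀ l) (hu : Measurable u) (m : ℝ) :
    ∫⁻ x in Ioi 0, ENNReal.ofReal (1 + x ^ m) * ∫⁻ y in Ioi 0, ‖gainIntegrand b u x y‖ₑ ≤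
      ∫⁻ y in Ioi 0, ‖u y‖ₑ * (daughterMoment b 0 y + daughterMoment b m y) := by
  have hmeas := hb.measurable_gainIntegrand hu
  have hmeas' : Measurable fun p : ℝ × ℝ => ‖gainIntegrand b u p.1 p.2‖ₑ := hmeas.enorm
  have e1 : ∀ x, ENNReal.ofReal (1 + x ^ m) * ∫⁻ y in Ioi 0, ‖gainIntegrand b u x y‖ₑ =
      ∫⁻ y in Ioi 0, ENNReal.ofReal (1 + x ^ m) * ‖gainIntegrand b u x y‖ₑ := fun x =>
    (lintegral_const_mul _ (hmeas'.comp (measurable_const.prodMk measurable_id))).symm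
  simp_rw [e1]
  rw [lintegral_lintegral_swap
    (((measurable_weight m).comp measurable_fst).mul hmeas').aemeasurable]
  refine setLIntegral_mono' measurableSet_Ioi fun y hy => ?_
  have hy : 0 < y := hy
  have hmb : ∀ k : ℝ, Measurable fun x => ENNReal.ofReal (b x y * x ^ k) := fun k =>
    ((hb.measurable_left y).mul (measurable_id.pow_const k)).ennreal_ofReal
  rw [daughterMoment, daughterMoment, ← lintegral_add_left (hmb 0),
    ← lintegral_const_mul _ (by exact (hmb 0).add (hmb m))]
  have e2 : Ioc 0 y ⊆ Ioi 0 := Ioc_subset_Ioi_self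
  rw [← inter_eq_self_of_subset_left e2, ← Measure.restrict_restrict measurableSet_Ioc,
    ← lintegral_indicator measurableSet_Ioc]
  refine setLIntegral_mono' measurableSet_Ioi fun x hx => ?_
  have hx : 0 < x := hx
  by_cases hxy : x < y
  · have hbx := hb.nonneg x y hx hy
    have hmem : x ∈ Ioc 0 y := ⟨hx, hxy.le⟩
    have hmem' : y ∈ Ioi x := hxy
    rw [indicator_of_mem hmem, gainIntegrand,
      indicator_of_mem hmem', enorm_mul, Real.enorm_of_nonneg hbx,
      ← ENNReal.ofReal_add (mul_nonneg hbx (Real.rpow_nonneg hx.le _))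
        (mul_nonneg hbx (Real.rpow_nonneg hx.le _)), Real.rpow_zero, ← mul_add,
      ENNReal.ofReal_mul hbx]
    exact le_of_eq (by ring)
  · rw [gainIntegrand, indicator_of_notMem (by exact hxy)]
    simp

/-- Integrability, linearity domain and weighted bound for the gain operator. -/
theorem KernelData.gain_spec (hb : KernelData b b₀ l) {m c C : ℝ} (hC : 0 ≤ C) (hc1 : c ≤ 1)
    (ha0 : ∀ x, 0 < x → 0 ≤ a x)
    (hcC : ∀ᵐ y ∂volume.restrict (Ioi (0 : ℝ)),
      ENNReal.ofReal (a y) * (daughterMoment b 0 y + daughterMoment b m y) ≤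
        ENNReal.ofReal (((1 - c) * a y + C) * (1 + y ^ m)))
    (hf : Integrable f (weightMeasure m)) (haf : Integrable (fun y => a y * f y) (weightMeasure m)) :
    Integrable (gain a b f) (weightMeasure m) ∧
      (∀ᵐ x ∂volume.restrict (Ioi (0 : ℝ)),
        IntegrableOn (fun y => a y * b x y * f y) (Ioi x)) ∧
      ∫ x, |gain a b f x| ∂weightMeasure m ≤
        (1 - c) * ∫ x, a x * |f x| ∂weightMeasure m + C * ∫ x, |f x| ∂weightMeasure m := by
  have hm1 : AEStronglyMeasurable (fun y => a y * f y) (volume.restrict (Ioi (0 : ℝ))) :=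
    aestronglyMeasurable_weightMeasure_iff.1 haf.aestronglyMeasurable
  -- Joint measurability of the integrand needs a Borel representative of `a f`, which is known only
  -- to be almost everywhere measurable.
  set u := hm1.mk with hu_def
  have hu : Measurable u := hm1.stronglyMeasurable_mk.measurable
  have huf : ∀ᵐ y ∂volume.restrict (Ioi (0 : ℝ)), a y * f y = u y := hm1.ae_eq_mk
  have hmeas := hb.measurable_gainIntegrand hu
  have i1 : Integrable (fun y => a y * |f y|) (weightMeasure m) := by
    refine haf.abs.congr ?_
    rw [Filter.EventuallyEq, ae_weightMeasure]
    filter_upwards [ae_restrict_mem measurableSet_Ioi] with x hx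
    rw [abs_mul, abs_of_nonneg (ha0 x hx)]
  have i2 : Integrable (fun y => (1 - c) * (a y * |f y|) + C * |f y|) (weightMeasure m) :=
    (i1.const_mul _).add (hf.abs.const_mul _)
  have hnn : ∀ y, 0 < y → 0 ≤ (1 - c) * (a y * |f y|) + C * |f y| := fun y hy =>
    add_nonneg (mul_nonneg (by linarith) (mul_nonneg (ha0 y hy) (abs_nonneg _)))
      (mul_nonneg hC (abs_nonneg _))
  -- the bound as a lower integral
  have hL : ∫⁻ x in Ioi 0, ENNReal.ofReal (1 + x ^ m) * ∫⁻ y in Ioi 0, ‖gainIntegrand b u x y‖ₑ ≤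
      ENNReal.ofReal (∫ x, (1 - c) * (a x * |f x|) + C * |f x| ∂weightMeasure m) := by
    refine (hb.lintegral_gainIntegrand_le hu m).trans ?_
    rw [ofReal_integral_eq_lintegral_ofReal i2 (by
      rw [Filter.EventuallyLE, ae_weightMeasure]
      filter_upwards [ae_restrict_mem measurableSet_Ioi] with x hx using hnn x hx),
      lintegral_weightMeasure m
        (aestronglyMeasurable_weightMeasure_iff.1 i2.aestronglyMeasurable).aemeasurable.ennreal_ofReal]
    refine lintegral_mono_ae ?_
    filter_upwards [huf, hcC, ae_restrict_mem measurableSet_Ioi] with y h1 h2 hy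
    rw [← h1, enorm_mul, Real.enorm_of_nonneg (ha0 y hy), mul_right_comm]
    refine (mul_le_mul_left h2 _).trans (le_of_eq ?_)
    rw [Real.enorm_eq_ofReal_abs, ← ENNReal.ofReal_mul' (abs_nonneg _),
      ← ENNReal.ofReal_mul (weight_pos m hy).le]
    congr 1
    ring
  have hfin := hL.trans_lt ENNReal.ofReal_lt_top
  have hgm : AEStronglyMeasurable (gain a b f) (volume.restrict (Ioi (0 : ℝ))) := by
    refine AEStronglyMeasurable.congr
      (hmeas.stronglyMeasurable.integral_prod_right' (ν := volume.restrict (Ioi (0 : ℝ))) |>.aestronglyMeasurable) ?_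
    filter_upwards [ae_restrict_mem measurableSet_Ioi] with x hx
    exact (gain_eq_integral huf hx).symm
  have hle : ∫⁻ x, ‖gain a b f x‖ₑ ∂weightMeasure m ≤
      ENNReal.ofReal (∫ x, (1 - c) * (a x * |f x|) + C * |f x| ∂weightMeasure m) := by
    rw [lintegral_weightMeasure m hgm.enorm]
    refine le_trans (setLIntegral_mono' measurableSet_Ioi fun x hx => ?_) hL
    gcongr
    rw [gain_eq_integral huf hx]
    exact enorm_integral_le_lintegral_enorm _
  have h_int : Integrable (gain a b f) (weightMeasure m) :=
    ⟨aestronglyMeasurable_weightMeasure_iff.2 hgm, hle.trans_lt ENNReal.ofReal_lt_top⟩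
  refine ⟨h_int, ?_, ?_⟩
  · have hmw : Measurable fun x => ENNReal.ofReal (1 + x ^ m) *
        ∫⁻ y in Ioi 0, ‖gainIntegrand b u x y‖ₑ :=
      (measurable_weight m).mul (hmeas.enorm.lintegral_prod_right')
    filter_upwards [ae_lt_top hmw hfin.ne, ae_restrict_mem measurableSet_Ioi] with x h1 hx
    have hx : 0 < x := hx
    have h2 : ∫⁻ y in Ioi 0, ‖gainIntegrand b u x y‖ₑ < ∞ := by
      refine ENNReal.lt_top_of_mul_ne_top_right h1.ne ?_
      exact (ENNReal.ofReal_pos.2 (weight_pos m hx)).ne'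
    have h3 : IntegrableOn (gainIntegrand b u x) (Ioi 0) :=
      ⟨(hmeas.comp (measurable_const.prodMk measurable_id)).aestronglyMeasurable, h2⟩
    refine Integrable.congr ?_ (gainIntegrand_ae_eq huf hx).symm
    refine (h3.mono_set (fun y hy => hx.trans hy : Ioi x ⊆ Ioi 0)).congr ?_
    filter_upwards [ae_restrict_mem measurableSet_Ioi] with y hy
    rw [gainIntegrand, indicator_of_mem hy]
  · have h1 : ENNReal.ofReal (∫ x, |gain a b f x| ∂weightMeasure m) ≤
        ENNReal.ofReal (∫ x, (1 - c) * (a x * |f x|) + C * |f x| ∂weightMeasure m) := by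
      refine le_trans (le_of_eq ?_) hle
      rw [ofReal_integral_eq_lintegral_ofReal h_int.abs (Eventually.of_forall fun x => abs_nonneg _)]
      simp only [Real.enorm_eq_ofReal_abs]
    have h2 := (ENNReal.ofReal_le_ofReal_iff (integral_nonneg_of_ae (by
      rw [Filter.EventuallyLE, ae_weightMeasure]
      filter_upwards [ae_restrict_mem measurableSet_Ioi] with x hx using hnn x hx))).1 h1
    refine h2.trans (le_of_eq ?_)
    rw [integral_add (i1.const_mul _) (hf.abs.const_mul _), integral_const_mul, integral_const_mul]

end Gain

/-! ### The full generator: dissipativity and range -/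

/-- The standing assumptions of the growth--fragmentation model. -/
structure ModelData (r a a₁ : ℝ → ℝ) (b : ℝ → ℝ → ℝ) (r₀ r₁ b₀ l : ℝ) : Prop where
  transport : TransportData r (fun x => a x + a₁ x) r₀ r₁
  kernel : KernelData b b₀ l
  frag : LocEssBounded a
  frag_nonneg : ∀ x : ℝ, 0 < x → 0 ≤ a x
  death_nonneg : ∀ x : ℝ, 0 < x → 0 ≤ a₁ x

/-- Constants for which the gain is dominated by the loss in `X m`. -/
structure GainBound (a : ℝ → ℝ) (b : ℝ → ℝ → ℝ) (m c C : ℝ) : Prop where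
  c_pos : 0 < c
  c_le : c ≤ 1
  C_nonneg : 0 ≤ C
  le : ∀ᵐ y ∂volume.restrict (Ioi (0 : ℝ)),
    ENNReal.ofReal (a y) * (daughterMoment b 0 y + daughterMoment b m y) ≤
      ENNReal.ofReal (((1 - c) * a y + C) * (1 + y ^ m))

section Generator

variable {r a a₁ : ℝ → ℝ} {b : ℝ → ℝ → ℝ} {r₀ r₁ b₀ l m c C : ℝ}

theorem ModelData.exists_gainBound (hM : ModelData r a a₁ b r₀ r₁ b₀ l) (hm : max 1 l < m) :
    ∃ c C, GainBound a b m c C := by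
  obtain ⟨c, C, h1, h2, h3, h4⟩ := hM.kernel.exists_gain_weight_le hM.frag hM.frag_nonneg hm
  exact ⟨c, C, h1, h2, h3, h4⟩

theorem ModelData.integrable_frag_mul (hM : ModelData r a a₁ b r₀ r₁ b₀ l) {f : X m} {F : ℝ → ℝ}
    (hF : IsTransportFlux r (fun x => a x + a₁ x) m f F) :
    Integrable (fun x => a x * f x) (weightMeasure m) := by
  refine (memLp_one_iff_integrable.1 hF.absorption_mem).mono
    ((aestronglyMeasurable_weightMeasure_iff.2 hM.frag.aestronglyMeasurable).mul
      (X.integrable f).aestronglyMeasurable) ?_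
  rw [ae_weightMeasure]
  filter_upwards [ae_restrict_mem measurableSet_Ioi] with x hx
  have h1 := hM.frag_nonneg x hx
  have h2 := hM.death_nonneg x hx
  rw [norm_mul, norm_mul, Real.norm_of_nonneg h1, Real.norm_of_nonneg (add_nonneg h1 h2)]
  gcongr
  linarith

theorem ModelData.integrable_frag_mul_abs (hM : ModelData r a a₁ b r₀ r₁ b₀ l) {f : X m}
    {F : ℝ → ℝ} (hF : IsTransportFlux r (fun x => a x + a₁ x) m f F) :
    Integrable (fun x => a x * |f x|) (weightMeasure m) := by
  refine (hM.integrable_frag_mul hF).abs.congr ?_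
  rw [Filter.EventuallyEq, ae_weightMeasure]
  filter_upwards [ae_restrict_mem measurableSet_Ioi] with x hx
  rw [abs_mul, abs_of_nonneg (hM.frag_nonneg x hx)]

theorem ModelData.integral_frag_le (hM : ModelData r a a₁ b r₀ r₁ b₀ l) {f : X m} {F : ℝ → ℝ}
    (hF : IsTransportFlux r (fun x => a x + a₁ x) m f F) :
    ∫ x, a x * |f x| ∂weightMeasure m ≤ ∫ x, (a x + a₁ x) * |f x| ∂weightMeasure m := by
  refine integral_mono_ae (hM.integrable_frag_mul_abs hF) ?_ ?_
  · refine (memLp_one_iff_integrable.1 hF.absorption_mem).abs.congr ?_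
    rw [Filter.EventuallyEq, ae_weightMeasure]
    filter_upwards [ae_restrict_mem measurableSet_Ioi] with x hx
    rw [abs_mul, abs_of_nonneg (add_nonneg (hM.frag_nonneg x hx) (hM.death_nonneg x hx))]
  · rw [Filter.EventuallyLE, ae_weightMeasure]
    filter_upwards [ae_restrict_mem measurableSet_Ioi] with x hx
    have := hM.death_nonneg x hx
    gcongr
    linarith

theorem ModelData.integrable_gain (hM : ModelData r a a₁ b r₀ r₁ b₀ l) (hcC : GainBound a b m c C)
    {f : X m} {F : ℝ → ℝ} (hF : IsTransportFlux r (fun x => a x + a₁ x) m f F) :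
    Integrable (gain a b f) (weightMeasure m) :=
  (hM.kernel.gain_spec hcC.C_nonneg hcC.c_le hM.frag_nonneg hcC.le (X.integrable f)
    (hM.integrable_frag_mul hF)).1

theorem ModelData.ae_gain_integrand (hM : ModelData r a a₁ b r₀ r₁ b₀ l)
    (hcC : GainBound a b m c C) {f : X m} {F : ℝ → ℝ}
    (hF : IsTransportFlux r (fun x => a x + a₁ x) m f F) :
    ∀ᵐ x ∂volume.restrict (Ioi (0 : ℝ)), IntegrableOn (fun y => a y * b x y * f y) (Ioi x) :=
  (hM.kernel.gain_spec hcC.C_nonneg hcC.c_le hM.frag_nonneg hcC.le (X.integrable f)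
    (hM.integrable_frag_mul hF)).2.1

theorem ModelData.integral_gain_le (hM : ModelData r a a₁ b r₀ r₁ b₀ l)
    (hcC : GainBound a b m c C) {f : X m} {F : ℝ → ℝ}
    (hF : IsTransportFlux r (fun x => a x + a₁ x) m f F) :
    ∫ x, |gain a b f x| ∂weightMeasure m ≤
      (1 - c) * ∫ x, a x * |f x| ∂weightMeasure m + C * ‖f‖ := by
  rw [X.norm_eq]
  exact (hM.kernel.gain_spec hcC.C_nonneg hcC.c_le hM.frag_nonneg hcC.le (X.integrable f)
    (hM.integrable_frag_mul hF)).2.2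

theorem gain_congr {f g : ℝ → ℝ} (hfg : f =ᵐ[volume.restrict (Ioi (0 : ℝ))] g) {x : ℝ}
    (hx : 0 < x) : gain a b f x = gain a b g x := by
  refine integral_congr_ae ?_
  filter_upwards [ae_restrict_of_ae_restrict_of_subset
    (fun y hy => hx.trans hy : Ioi x ⊆ Ioi 0) hfg] with y hy
  rw [hy]

/-- Only almost everywhere, because additivity of the integral needs both integrands integrable, and
this is known for almost every `x`. -/
theorem ModelData.gain_lincomb (hM : ModelData r a a₁ b r₀ r₁ b₀ l)
    (hcC : GainBound a b m c C) {f₁ f₂ : X m} {F₁ F₂ : ℝ → ℝ}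
    (h₁ : IsTransportFlux r (fun x => a x + a₁ x) m f₁ F₁)
    (h₂ : IsTransportFlux r (fun x => a x + a₁ x) m f₂ F₂) (s t : ℝ) :
    ∀ᵐ x ∂volume.restrict (Ioi (0 : ℝ)),
      gain a b (s • f₁ + t • f₂ : X m) x = s * gain a b f₁ x + t * gain a b f₂ x := by
  filter_upwards [hM.ae_gain_integrand hcC h₁, hM.ae_gain_integrand hcC h₂,
    ae_restrict_mem measurableSet_Ioi] with x i1 i2 hx
  rw [gain_congr (X.coeFn_lincomb s t f₁ f₂) hx, gain, gain, gain, ← integral_const_mul,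
    ← integral_const_mul, ← integral_add (i1.const_mul s) (i2.const_mul t)]
  refine integral_congr_ae (Eventually.of_forall fun y => ?_)
  simp only
  ring

theorem ModelData.graph_lincomb (hM : ModelData r a a₁ b r₀ r₁ b₀ l) (hcC : GainBound a b m c C)
    (s t : ℝ) {f₁ g₁ f₂ g₂ : X m} (h₁ : (f₁, g₁) ∈ generatorGraph r a a₁ b m)
    (h₂ : (f₂, g₂) ∈ generatorGraph r a a₁ b m) :
    (s • f₁ + t • f₂, s • g₁ + t • g₂) ∈ generatorGraph r a a₁ b m := by
  obtain ⟨F₁, hF₁, e₁⟩ := h₁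
  obtain ⟨F₂, hF₂, e₂⟩ := h₂
  refine ⟨_, hF₁.lincomb hF₂ s t, ?_⟩
  filter_upwards [e₁, e₂, hF₁.ae_deriv_lincomb hF₂ s t, hM.gain_lincomb hcC hF₁ hF₂ s t,
    X.coeFn_lincomb s t f₁ f₂, X.coeFn_lincomb s t g₁ g₂] with x h1 h2 h3 h4 h5 h6
  rw [h6, h1, h2, h3, h4, h5]
  ring

/-- The generator is quasi-dissipative with an extra gain from the fragmentation rate. -/
theorem ModelData.graph_dissipative (hM : ModelData r a a₁ b r₀ r₁ b₀ l) (hm : 1 ≤ m)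
    (hcC : GainBound a b m c C) {f g : X m} (hfg : (f, g) ∈ generatorGraph r a a₁ b m) (k : ℝ) :
    Integrable (fun x => a x * |f x|) (weightMeasure m) ∧
    (k - (m * (r₀ + r₁) + C)) * ‖f‖ + c * ∫ x, a x * |f x| ∂weightMeasure m ≤ ‖k • f - g‖ := by
  obtain ⟨F, hF, e⟩ := hfg
  refine ⟨hM.integrable_frag_mul_abs hF, ?_⟩
  have h1 := hF.dissipative hM.transport hm k
  have h2 := hM.integral_frag_le hF
  have h3 := hM.integral_gain_le hcC hF
  -- The pair is read as a solution of the transport resolvent equation with right side `k f - g`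
  -- plus the gain.
  have h4 : ∫ x, |deriv F x + (k + (a x + a₁ x)) * f x| ∂weightMeasure m ≤
      ‖k • f - g‖ + ∫ x, |gain a b f x| ∂weightMeasure m := by
    rw [X.norm_eq, ← integral_add (X.integrable _).abs (hM.integrable_gain hcC hF).abs]
    refine integral_mono_of_nonneg (Eventually.of_forall fun x => abs_nonneg _)
      ((X.integrable _).abs.add (hM.integrable_gain hcC hF).abs) ?_
    have h5 := X.coeFn_lincomb k (-1) f g
    rw [neg_one_smul, ← sub_eq_add_neg] at h5
    rw [Filter.EventuallyLE, ae_weightMeasure]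
    filter_upwards [h5, e] with x h6 h7
    have h8 : deriv F x + (k + (a x + a₁ x)) * f x = (k • f - g : X m) x + gain a b f x := by
      rw [h6, h7]
      ring
    rw [h8]
    exact abs_add_le _ _
  linarith

/-- Perturbation of the transport resolvent `R`: if `h = g + B R h`, then `f = R h` solves the
equation. The map `B R` contracts because transport controls `∫ a |f|` with constant `1`, while the
gain uses only `1 - c` of it and the term `C ‖f‖` is beaten by a large `k`. -/
theorem ModelData.graph_range (hM : ModelData r a a₁ b r₀ r₁ b₀ l) (hm : 1 ≤ m)
    (hcC : GainBound a b m c C) {k : ℝ} (hk : m * (r₀ + r₁) + 2 * C + 1 ≤ k) (g : X m) :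
    ∃ f h, (f, h) ∈ generatorGraph r a a₁ b m ∧ k • f - h = g := by
  have hC := hcC.C_nonneg
  have hc := hcC.c_pos
  have hc1 := hcC.c_le
  choose R F hF hRF using hM.transport.exists_flux hm (by linarith : m * (r₀ + r₁) < k)
  have h_int : ∀ h, Integrable (gain a b (R h)) (weightMeasure m) :=
    fun h => hM.integrable_gain hcC (hF h)
  let B : X m → X m := fun h => (memLp_one_iff_integrable.2 (h_int h)).toLp (gain a b (R h))
  have hB : ∀ h, ∀ᵐ x ∂volume.restrict (Ioi (0 : ℝ)), B h x = gain a b (R h) x := fun h => by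
    rw [← ae_weightMeasure m]
    exact MemLp.coeFn_toLp _
  have hlip : ∀ h₁ h₂, ‖B h₁ - B h₂‖ ≤ (1 - c / 2) * ‖h₁ - h₂‖ := by
    intro h₁ h₂
    have hfl := (hF h₁).lincomb (hF h₂) 1 (-1)
    have e0 : ∀ u v : X m, (1 : ℝ) • u + (-1 : ℝ) • v = u - v := fun u v => by
      rw [one_smul, neg_one_smul, sub_eq_add_neg]
    have h1 := hfl.dissipative hM.transport hm k
    have h2 := hM.integral_frag_le hfl
    have h3 := hM.integral_gain_le hcC hfl
    have h4 : ‖B h₁ - B h₂‖ =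
        ∫ x, |gain a b ((1 : ℝ) • R h₁ + (-1 : ℝ) • R h₂ : X m) x| ∂weightMeasure m := by
      rw [X.norm_eq, ← e0]
      refine integral_congr_ae ?_
      rw [Filter.EventuallyEq, ae_weightMeasure]
      filter_upwards [X.coeFn_lincomb 1 (-1) (B h₁) (B h₂),
        hM.gain_lincomb hcC (hF h₁) (hF h₂) 1 (-1), hB h₁, hB h₂] with x e1 e2 e3 e4
      rw [e1, e2, e3, e4]
    have h5 : ∫ x, |deriv (fun x => 1 * F h₁ x + -1 * F h₂ x) x
          + (k + (a x + a₁ x)) * ((1 : ℝ) • R h₁ + (-1 : ℝ) • R h₂ : X m) x| ∂weightMeasure m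
        = ‖h₁ - h₂‖ := by
      rw [X.norm_eq, ← e0]
      refine integral_congr_ae ?_
      rw [Filter.EventuallyEq, ae_weightMeasure]
      filter_upwards [X.coeFn_lincomb 1 (-1) h₁ h₂, X.coeFn_lincomb 1 (-1) (R h₁) (R h₂),
        (hF h₁).ae_deriv_lincomb (hF h₂) 1 (-1), hRF h₁, hRF h₂] with x e1 e2 e3 e4 e5
      rw [e1, e2, e3, ← e4, ← e5]
      congr 1
      ring
    rw [h5] at h1
    rw [h4]
    set N := ‖(1 : ℝ) • R h₁ + (-1 : ℝ) • R h₂‖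
    set A := ∫ x, a x * |((1 : ℝ) • R h₁ + (-1 : ℝ) • R h₂ : X m) x| ∂weightMeasure m
    have hN : 0 ≤ N := norm_nonneg _
    have hA : 0 ≤ A := integral_nonneg_of_ae (by
      rw [Filter.EventuallyLE, ae_weightMeasure]
      filter_upwards [ae_restrict_mem measurableSet_Ioi] with x hx
      exact mul_nonneg (hM.frag_nonneg x hx) (abs_nonneg _))
    have h6 : (k - m * (r₀ + r₁)) * N + A ≤ ‖h₁ - h₂‖ := by linarith
    -- The lower bound on `k` was chosen for this: since `1 - c / 2 ≥ 1 / 2`, the factor `2 * C + 1`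
    -- is enough to absorb `C * N`.
    have h7 : (2 * C + 1) * N ≤ (k - m * (r₀ + r₁)) * N := by gcongr; linarith
    have h8 : (1 - c / 2) * ((2 * C + 1) * N + A) ≤ (1 - c / 2) * ‖h₁ - h₂‖ := by
      gcongr
      · linarith
      · linarith
    have h9 : 1 / 2 * ((2 * C + 1) * N) ≤ (1 - c / 2) * ((2 * C + 1) * N) := by
      gcongr
      linarith
    have h10 : 0 ≤ c * A := mul_nonneg hc.le hA
    linarith
  have hcontr : ContractingWith (Real.toNNReal (1 - c / 2)) fun h => g + B h := by
    refine ⟨?_, LipschitzWith.of_dist_le_mul fun h₁ h₂ => ?_⟩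
    · rw [← Real.toNNReal_one, Real.toNNReal_lt_toNNReal_iff one_pos]
      linarith
    · rw [dist_eq_norm, dist_eq_norm, Real.coe_toNNReal _ (by linarith), add_sub_add_left_eq_sub]
      exact hlip h₁ h₂
  set h := hcontr.fixedPoint with hh
  have hfix : g + B h = h := hcontr.fixedPoint_isFixedPt
  refine ⟨R h, k • R h - g, ⟨F h, hF h, ?_⟩, by abel⟩
  have e1 := X.coeFn_lincomb k (-1) (R h) g
  have e2 := X.coeFn_lincomb 1 1 g (B h)
  rw [one_smul, one_smul, hfix] at e2
  rw [neg_one_smul, ← sub_eq_add_neg] at e1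
  filter_upwards [e1, e2, hRF h, hB h] with x h1 h2 h3 h4
  rw [h1]
  rw [h2, h4] at h3
  linarith

end Generator

/-! ### Density of the domain and generation -/

section TestFunctions

variable {r a a₁ : ℝ → ℝ} {b : ℝ → ℝ → ℝ} {r₀ r₁ b₀ l m c C s t M : ℝ} {φ h : ℝ → ℝ}

theorem weight_le_of_mem_Icc (hm : 0 ≤ m) (hs : 0 < s) {x : ℝ} (hx : x ∈ Icc s t) :
    1 + x ^ m ≤ 1 + t ^ m := by
  have := Real.rpow_le_rpow (hs.le.trans hx.1) hx.2 hm
  linarith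

theorem integrable_weightMeasure_of_bounded_support (hm : 0 ≤ m) (hφ : Measurable φ)
    (hM : ∀ x, |φ x| ≤ M) (hs : 0 < s) (hsupp : ∀ x, x ∉ Icc s t → φ x = 0) :
    Integrable φ (weightMeasure m) := by
  rw [integrable_weightMeasure_iff]
  have h1 : IntegrableOn (fun x => φ x * (1 + x ^ m)) (Icc s t) := by
    refine Measure.integrableOn_of_bounded (M := M * (1 + t ^ m)) (by simp)
      (by fun_prop : Measurable fun x => φ x * (1 + x ^ m)).aestronglyMeasurable ?_
    filter_upwards [ae_restrict_mem measurableSet_Icc] with x hx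
    have hx0 : 0 < x := hs.trans_le hx.1
    rw [norm_mul, Real.norm_of_nonneg (weight_pos m hx0).le]
    exact mul_le_mul (hM x) (weight_le_of_mem_Icc hm hs hx) (weight_pos m hx0).le
      ((abs_nonneg _).trans (hM x))
  refine h1.of_forall_sdiff_eq_zero measurableSet_Ioi fun x hx => ?_
  rw [hsupp x hx.2, zero_mul]

theorem TransportData.integrable_mul_div_growth {q : ℝ → ℝ} (hd : TransportData r q r₀ r₁)
    (hm : 0 ≤ m) {u : ℝ → ℝ} (hu : LocEssBounded u) (hφ : Measurable φ)
    (hM : ∀ x, |φ x| ≤ M) (hs : 0 < s) (hsupp : ∀ x, x ∉ Icc s t → φ x = 0) :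
    Integrable (fun x => u x * (φ x / r x)) (weightMeasure m) := by
  rw [integrable_weightMeasure_iff]
  have h1 : IntegrableOn (fun x => u x * (φ x / r x) * (1 + x ^ m)) (Ioc (s / 2) t) := by
    refine (Integrable.bdd_mul (c := M * (1 + t ^ m))
      (hd.integrableOn_mul_inv_growth hu (t := t) (half_pos hs))
      (by fun_prop : Measurable fun x => φ x * (1 + x ^ m)).aestronglyMeasurable ?_).congr
      (Eventually.of_forall fun x => by simp only; ring)
    filter_upwards [ae_restrict_mem measurableSet_Ioc] with x hx
    have hx0 : 0 < x := (half_pos hs).trans hx.1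
    rw [norm_mul, Real.norm_of_nonneg (weight_pos m hx0).le]
    exact mul_le_mul (hM x) (weight_le_of_mem_Icc hm (half_pos hs) (Ioc_subset_Icc_self hx))
      (weight_pos m hx0).le ((abs_nonneg _).trans (hM x))
  refine h1.of_forall_sdiff_eq_zero measurableSet_Ioi fun x hx => ?_
  rw [hsupp x fun hx' => hx.2 ⟨by linarith [hx'.1], hx'.2⟩]
  simp

theorem TransportData.integrable_div_growth {q : ℝ → ℝ} (hd : TransportData r q r₀ r₁)
    (hm : 0 ≤ m) (hφ : Measurable φ) (hM : ∀ x, |φ x| ≤ M) (hs : 0 < s)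
    (hsupp : ∀ x, x ∉ Icc s t → φ x = 0) :
    Integrable (fun x => φ x / r x) (weightMeasure m) := by
  simpa using hd.integrable_mul_div_growth hm (locEssBounded_const 1) hφ hM hs hsupp

/-- Quotients of compactly supported Lipschitz functions by the growth rate belong to the domain of
the generator in every `X m`. -/
theorem ModelData.exists_mem_graph_of_lipschitz (hMd : ModelData r a a₁ b r₀ r₁ b₀ l)
    (hcC : GainBound a b m c C) (hm : 0 ≤ m) {K : NNReal} (hφ : LipschitzWith K φ)
    (hM : ∀ x, |φ x| ≤ M) (hs : 0 < s) (hsupp : ∀ x, x ∉ Icc s t → φ x = 0) :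
    ∃ f g : X m, (f, g) ∈ generatorGraph r a a₁ b m ∧
      ∀ᵐ x ∂volume.restrict (Ioi (0 : ℝ)), f x = φ x / r x := by
  have hd := hMd.transport
  have hφm := hφ.continuous.measurable
  have i1 := memLp_one_iff_integrable.2 (hd.integrable_div_growth hm hφm hM hs hsupp)
  set f : X m := i1.toLp _ with hf
  have hfe : ∀ᵐ x ∂volume.restrict (Ioi (0 : ℝ)), f x = φ x / r x := by
    rw [← ae_weightMeasure m]
    exact MemLp.coeFn_toLp _
  -- The flux of `φ / r` is `φ` itself, so no regularity of `r` is required.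
  have hF : IsTransportFlux r (fun x => a x + a₁ x) m f φ := by
    refine ⟨?_, fun x y _ _ => (hφ.lipschitzOnWith).absolutelyContinuousOnInterval, ?_, ?_,
      fun _ => ?_⟩
    · filter_upwards [hfe, ae_restrict_mem measurableSet_Ioi] with x hx hx0
      rw [hx, mul_div_cancel₀ _ (hd.growth x hx0).1.ne']
    · rw [memLp_one_iff_integrable]
      refine integrable_weightMeasure_of_bounded_support (M := K) hm (measurable_deriv φ)
        (fun x => norm_deriv_le_of_lipschitz hφ) hs (t := t) fun x hx => ?_
      have : φ =ᶠ[𝓝 x] fun _ => 0 := by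
        filter_upwards [isClosed_Icc.isOpen_compl.mem_nhds hx] with y hy using hsupp y hy
      rw [this.deriv_eq, deriv_const]
    · rw [memLp_one_iff_integrable]
      refine (hd.integrable_mul_div_growth hm hd.absorption hφm hM hs hsupp).congr ?_
      rw [Filter.EventuallyEq, ae_weightMeasure]
      filter_upwards [hfe] with x hx
      rw [hx]
    · refine tendsto_const_nhds.congr' ?_
      filter_upwards [Ioo_mem_nhdsGT hs] with x hx
      exact (hsupp x fun h => absurd h.1 (not_le.2 hx.2)).symm
  have i2 : Integrable (fun x => -deriv φ x - (a x + a₁ x) * f x + gain a b f x)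
      (weightMeasure m) :=
    ((memLp_one_iff_integrable.1 hF.deriv_mem).neg.sub
      (memLp_one_iff_integrable.1 hF.absorption_mem)).add (hMd.integrable_gain hcC hF)
  refine ⟨f, (memLp_one_iff_integrable.2 i2).toLp _, ⟨φ, hF, ?_⟩, hfe⟩
  rw [Filter.EventuallyEq, ← ae_weightMeasure m]
  exact MemLp.coeFn_toLp (memLp_one_iff_integrable.2 i2)

/-- Lipschitz approximation by averages of a bounded function with compact support. -/
theorem exists_lipschitz_approx (hh : Measurable h) (hM : ∀ x, |h x| ≤ M)
    (hs : 0 < s) (hsupp : ∀ x, x ∉ Icc s t → h x = 0) :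
    ∃ φ : ℕ → ℝ → ℝ, (∀ j, ∃ K, LipschitzWith K (φ j)) ∧ (∀ j x, |φ j x| ≤ M) ∧
      (∀ᶠ j in atTop, ∀ x, x ∉ Icc (s / 2) t → φ j x = 0) ∧
      ∀ᵐ x, Tendsto (fun j => φ j x) atTop (𝓝 (h x)) := by
  have hM0 : 0 ≤ M := (abs_nonneg _).trans (hM 0)
  have hloc : LocallyIntegrable h := by
    refine (locallyIntegrable_const M).mono hh.aestronglyMeasurable
      (Eventually.of_forall fun x => ?_)
    rw [Real.norm_eq_abs, Real.norm_of_nonneg hM0]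
    exact hM x
  have hii : ∀ x y, IntervalIntegrable h volume x y := fun x y => (hloc.integrableOn_isCompact isCompact_uIcc).intervalIntegrable
  set P : ℝ → ℝ := fun x => ∫ y in (0 : ℝ)..x, h y with hP
  have hPd : ∀ x y, P y - P x = ∫ z in x..y, h z := fun x y =>
    intervalIntegral.integral_interval_sub_left (hii 0 y) (hii 0 x)
  have hPle : ∀ x y, |P y - P x| ≤ M * |y - x| := fun x y => by
    rw [hPd]
    exact intervalIntegral.norm_integral_le_of_norm_le_const (f := h) fun z _ => hM z
  have hPlip : LipschitzWith (Real.toNNReal M) P := LipschitzWith.of_dist_le_mul fun x y => by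
    rw [Real.dist_eq, Real.dist_eq, Real.coe_toNNReal _ hM0]
    exact hPle y x
  have hδ : ∀ j : ℕ, (0 : ℝ) < 1 / (j + 1) := one_div_natCast_add_one_pos
  -- Forward averages over length `1 / (j + 1)`: the support spreads only to the left, and
  -- convergence is Lebesgue differentiation.
  refine ⟨fun j x => ((j : ℝ) + 1) * (P (x + 1 / (j + 1)) - P x), fun j => ?_, fun j x => ?_,
    ?_, ?_⟩
  · have h1 : LipschitzWith 1 fun x : ℝ => x + 1 / ((j : ℝ) + 1) :=
      LipschitzWith.of_dist_le_mul fun x y => by simp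
    exact ⟨_, (lipschitzWith_smul ((j : ℝ) + 1)).comp ((hPlip.comp h1).sub hPlip)⟩
  · rw [abs_mul, abs_of_pos (by positivity : (0 : ℝ) < (j : ℝ) + 1)]
    have h1 := hPle x (x + 1 / (j + 1))
    rw [add_sub_cancel_left, abs_of_pos (hδ j)] at h1
    calc ((j : ℝ) + 1) * |P (x + 1 / (j + 1)) - P x|
        ≤ ((j : ℝ) + 1) * (M * (1 / (j + 1))) := by gcongr
      _ = M := by field_simp
  · have h1 : ∀ᶠ j : ℕ in atTop, 1 / ((j : ℝ) + 1) < s / 2 :=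
      tendsto_one_div_add_atTop_nhds_zero_nat.eventually (gt_mem_nhds (half_pos hs))
    filter_upwards [h1] with j hj x hx
    have h2 : ∫ z in x..x + 1 / ((j : ℝ) + 1), h z = 0 := by
      refine intervalIntegral.integral_zero_ae (Eventually.of_forall fun z hz => ?_)
      rw [uIoc_of_le (by linarith [hδ j])] at hz
      refine hsupp z fun hz' => hx ⟨?_, ?_⟩
      · linarith [hz.2, hz'.1]
      · linarith [hz.1, hz'.2]
    rw [hPd, h2, mul_zero]
  · filter_upwards [_root_.LocallyIntegrable.ae_hasDerivAt_integral hloc] with x hx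
    have h1 := hasDerivAt_iff_tendsto_slope_zero.1 (hx 0)
    have h2 : Tendsto (fun j : ℕ => 1 / ((j : ℝ) + 1)) atTop (𝓝[≠] 0) :=
      tendsto_nhdsWithin_iff.2 ⟨tendsto_one_div_add_atTop_nhds_zero_nat,
        Eventually.of_forall fun j => (hδ j).ne'⟩
    refine (h1.comp h2).congr fun j => ?_
    simp [hP]

/-- Density of the quotients of Lipschitz functions by the growth rate. -/
theorem TransportData.exists_lipschitz_approx {q : ℝ → ℝ} (hd : TransportData r q r₀ r₁)
    (hm : 0 ≤ m) (f : X m) {ε : ℝ} (hε : 0 < ε) :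
    ∃ (φ : ℝ → ℝ) (K : NNReal) (M s t : ℝ), LipschitzWith K φ ∧ (∀ x, |φ x| ≤ M) ∧ 0 < s ∧
      (∀ x, x ∉ Icc s t → φ x = 0) ∧ ∫ x, |f x - φ x / r x| ∂weightMeasure m < ε := by
  have hm1 : AEStronglyMeasurable (fun x => r x * f x) (volume.restrict (Ioi (0 : ℝ))) :=
    hd.aestronglyMeasurable_growth.mul
      (aestronglyMeasurable_weightMeasure_iff.1 (X.integrable f).aestronglyMeasurable)
  set h := hm1.mk with hh_def
  have hh : Measurable h := hm1.stronglyMeasurable_mk.measurable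
  have hhf : ∀ᵐ x ∂volume.restrict (Ioi (0 : ℝ)), r x * f x = h x := hm1.ae_eq_mk
  -- Truncation is done on `r f`, in size and in value, since it is the flux that must become
  -- Lipschitz.
  let A : ℕ → Set ℝ := fun N => Icc (1 / ((N : ℝ) + 1)) (N + 1) ∩ {x | |h x| ≤ N + 1}
  have hA : ∀ N, MeasurableSet (A N) := fun N =>
    measurableSet_Icc.inter (measurableSet_le (by fun_prop) measurable_const)
  have htrunc : Tendsto (fun N => ∫ x, |f x - (A N).indicator h x / r x| ∂weightMeasure m) atTop
      (𝓝 0) := by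
    have h0 : (0 : ℝ) = ∫ _, (0 : ℝ) ∂weightMeasure m := by simp
    rw [h0]
    refine tendsto_integral_of_dominated_convergence (fun x => |f x|) (fun N => ?_)
      (X.integrable f).abs (fun N => ?_) ?_
    · have h1 : AEStronglyMeasurable (fun x => (A N).indicator h x / r x)
          (volume.restrict (Ioi (0 : ℝ))) :=
        ((hh.indicator (hA N)).aemeasurable.div
          hd.aestronglyMeasurable_growth.aemeasurable).aestronglyMeasurable
      exact ((X.integrable f).aestronglyMeasurable.sub
        (aestronglyMeasurable_weightMeasure_iff.2 h1)).norm
    · rw [ae_weightMeasure]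
      filter_upwards [hhf, ae_restrict_mem measurableSet_Ioi] with x hx hx0
      rw [Real.norm_eq_abs, abs_abs]
      by_cases hxA : x ∈ A N
      · rw [indicator_of_mem hxA, ← hx, mul_div_cancel_left₀ _ (hd.growth x hx0).1.ne']
        simp
      · rw [indicator_of_notMem hxA]
        simp
    · rw [ae_weightMeasure]
      filter_upwards [hhf, ae_restrict_mem measurableSet_Ioi] with x hx hx0
      refine tendsto_const_nhds.congr' ?_
      have e1 : ∀ᶠ N : ℕ in atTop, 1 / ((N : ℝ) + 1) < x :=
        tendsto_one_div_add_atTop_nhds_zero_nat.eventually (gt_mem_nhds hx0)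
      have e2 : ∀ᶠ N : ℕ in atTop, max x |h x| ≤ N :=
        tendsto_natCast_atTop_atTop.eventually (eventually_ge_atTop _)
      filter_upwards [e1, e2] with N h1 h2
      have hxA : x ∈ A N := ⟨⟨h1.le, by linarith [le_max_left x |h x|]⟩, by
        simp only [mem_ofPred_eq]
        linarith [le_max_right x |h x|]⟩
      rw [indicator_of_mem hxA, ← hx, mul_div_cancel_left₀ _ (hd.growth x hx0).1.ne']
      simp
  obtain ⟨N, hN⟩ := (htrunc.eventually (gt_mem_nhds (half_pos hε))).exists
  set h' := (A N).indicator h with hh'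
  have hh'm : Measurable h' := hh.indicator (hA N)
  have hh'M : ∀ x, |h' x| ≤ N + 1 := fun x => by
    by_cases hxA : x ∈ A N
    · rw [hh', indicator_of_mem hxA]
      exact hxA.2
    · rw [hh', indicator_of_notMem hxA, abs_zero]
      positivity
  have hh's : ∀ x, x ∉ Icc (1 / ((N : ℝ) + 1)) (N + 1) → h' x = 0 := fun x hx =>
    indicator_of_notMem (fun hxA => hx hxA.1) _
  have hs := one_div_natCast_add_one_pos N
  obtain ⟨φ, hφ1, hφ2, hφ3, hφ4⟩ := GrowthFragmentation.exists_lipschitz_approx hh'm hh'M hs hh's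
  set s : ℝ := 1 / ((N : ℝ) + 1) / 2 with hs_def
  have hs' : 0 < s := half_pos hs
  have hφm : ∀ j, Measurable (φ j) := fun j => (hφ1 j).choose_spec.continuous.measurable
  have hsub : ∀ x, x ∉ Icc s ((N : ℝ) + 1) → h' x = 0 := fun x hx =>
    hh's x fun hx' => hx ⟨by linarith [hx'.1], hx'.2⟩
  have hrm := hd.aestronglyMeasurable_growth.aemeasurable
  have hφlim : Tendsto (fun j => ∫ x, |h' x / r x - φ j x / r x| ∂weightMeasure m) atTop
      (𝓝 0) := by
    have h0 : (0 : ℝ) = ∫ _, (0 : ℝ) ∂weightMeasure m := by simp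
    rw [h0]
    have hbm : Measurable ((Icc s ((N : ℝ) + 1)).indicator fun _ => 2 * ((N : ℝ) + 1)) :=
      measurable_const.indicator measurableSet_Icc
    -- The majorant is a constant over `r` on a fixed compact interval, integrable because `1 / r`
    -- is locally integrable.
    refine tendsto_integral_filter_of_dominated_convergence
      (fun x => (Icc s ((N : ℝ) + 1)).indicator (fun _ => 2 * ((N : ℝ) + 1)) x / r x)
      (Eventually.of_forall fun j => ?_) ?_
      (hd.integrable_div_growth (M := 2 * ((N : ℝ) + 1)) hm hbm (fun x => ?_) hs'
        (fun x hx => indicator_of_notMem hx _)) ?_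
    · have h1 : AEStronglyMeasurable (fun x => h' x / r x - φ j x / r x)
          (volume.restrict (Ioi (0 : ℝ))) :=
        ((hh'm.aemeasurable.div hrm).sub ((hφm j).aemeasurable.div hrm)).aestronglyMeasurable
      exact (aestronglyMeasurable_weightMeasure_iff.2 h1).norm
    · filter_upwards [hφ3] with j hj
      rw [ae_weightMeasure]
      filter_upwards [ae_restrict_mem measurableSet_Ioi] with x hx0
      have hr := (hd.growth x hx0).1
      rw [Real.norm_eq_abs, abs_abs, ← sub_div, abs_div, abs_of_pos hr]
      gcongr
      by_cases hx : x ∈ Icc s ((N : ℝ) + 1)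
      · rw [indicator_of_mem hx]
        have h1 := abs_sub (h' x) (φ j x)
        linarith [hh'M x, hφ2 j x]
      · rw [indicator_of_notMem hx, hsub x hx, hj x hx]
        simp
    · by_cases hx : x ∈ Icc s ((N : ℝ) + 1)
      · rw [indicator_of_mem hx, abs_of_nonneg (by positivity)]
      · rw [indicator_of_notMem hx, abs_zero]
        positivity
    · rw [ae_weightMeasure]
      refine ae_restrict_of_ae ?_
      filter_upwards [hφ4] with x hx
      have h1 := ((hx.div_const (r x)).const_sub (h' x / r x)).abs
      rwa [sub_self, abs_zero] at h1
  obtain ⟨j, hj, hjs⟩ := ((hφlim.eventually (gt_mem_nhds (half_pos hε))).and hφ3).exists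
  obtain ⟨K, hK⟩ := hφ1 j
  refine ⟨φ j, K, N + 1, s, N + 1, hK, hφ2 j, hs', hjs, ?_⟩
  have i1 := hd.integrable_div_growth hm hh'm hh'M hs hh's
  have i2 := hd.integrable_div_growth hm (hφm j) (hφ2 j) hs' hjs
  have i3 : Integrable (fun x => |f x - h' x / r x|) (weightMeasure m) :=
    ((X.integrable f).sub i1).abs
  have i4 : Integrable (fun x => |h' x / r x - φ j x / r x|) (weightMeasure m) := (i1.sub i2).abs
  calc ∫ x, |f x - φ j x / r x| ∂weightMeasure m
      ≤ ∫ x, |f x - h' x / r x| + |h' x / r x - φ j x / r x| ∂weightMeasure m :=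
        integral_mono ((X.integrable f).sub i2).abs (i3.add i4) fun x => abs_sub_le _ _ _
    _ = ∫ x, |f x - h' x / r x| ∂weightMeasure m
        + ∫ x, |h' x / r x - φ j x / r x| ∂weightMeasure m := integral_add i3 i4
    _ < ε := by linarith

/-- The domain of the generator in `X m` is dense in `X p`. -/
theorem ModelData.exists_mem_graph_approx (hMd : ModelData r a a₁ b r₀ r₁ b₀ l) {p : ℝ}
    (hp : 0 ≤ p) (hm : 0 ≤ m) (hcC : GainBound a b m c C) (f : X p) {ε : ℝ} (hε : 0 < ε) :
    ∃ f' g' : X m, (f', g') ∈ generatorGraph r a a₁ b m ∧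
      ∫ x, |f x - f' x| ∂weightMeasure p < ε := by
  obtain ⟨φ, K, M, s, t, hK, hM, hs, hsupp, hlt⟩ :=
    hMd.transport.exists_lipschitz_approx hp f hε
  obtain ⟨f', g', hfg, he⟩ := hMd.exists_mem_graph_of_lipschitz hcC hm hK hM hs hsupp
  refine ⟨f', g', hfg, lt_of_eq_of_lt (integral_congr_ae ?_) hlt⟩
  rw [Filter.EventuallyEq, ae_weightMeasure]
  filter_upwards [he] with x hx
  rw [hx]

theorem ModelData.graph_dissipative_norm (hM : ModelData r a a₁ b r₀ r₁ b₀ l) (hm : 1 ≤ m)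
    (hcC : GainBound a b m c C) {f g : X m} (hfg : (f, g) ∈ generatorGraph r a a₁ b m) (k : ℝ) :
    (k - (m * (r₀ + r₁) + C)) * ‖f‖ ≤ ‖k • f - g‖ := by
  have h1 := (hM.graph_dissipative hm hcC hfg k).2
  have h2 : 0 ≤ ∫ x, a x * |f x| ∂weightMeasure m := integral_nonneg_of_ae (by
    rw [Filter.EventuallyLE, ae_weightMeasure]
    filter_upwards [ae_restrict_mem measurableSet_Ioi] with x hx
    exact mul_nonneg (hM.frag_nonneg x hx) (abs_nonneg _))
  linarith [mul_nonneg hcC.c_pos.le h2]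

/-- The generator satisfies the assumptions of the generation theorem. -/
theorem ModelData.isQuasiDissipativeGraph (hMd : ModelData r a a₁ b r₀ r₁ b₀ l) (hm : 1 ≤ m)
    (hcC : GainBound a b m c C) :
    IsQuasiDissipativeGraph (generatorGraph r a a₁ b m) (m * (r₀ + r₁) + C)
      (m * (r₀ + r₁) + 2 * C + 1) where
  lincomb c d _ _ _ _ h₁ h₂ := hMd.graph_lincomb hcC c d h₁ h₂
  dissipative {k} _ f g hfg := hMd.graph_dissipative_norm hm hcC hfg k
  range hk h := hMd.graph_range hm hcC hk h
  dense f ε hε := by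
    obtain ⟨f', g', hfg, hlt⟩ :=
      hMd.exists_mem_graph_approx (by linarith) (by linarith : 0 ≤ m) hcC f hε
    refine ⟨f', g', hfg, lt_of_eq_of_lt ?_ hlt⟩
    rw [X.norm_eq]
    refine integral_congr_ae ?_
    filter_upwards [Lp.coeFn_sub f f'] with x hx
    rw [hx, Pi.sub_apply]

theorem ModelData.exists_semigroup (hMd : ModelData r a a₁ b r₀ r₁ b₀ l) (hm : max 1 l < m) :
    ∃ S : ℝ → X m →L[ℝ] X m, IsSemigroupGeneratedBy S (generatorGraph r a a₁ b m) := by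
  obtain ⟨c, C, hcC⟩ := hMd.exists_gainBound hm
  have hm1 : 1 ≤ m := ((le_max_left _ _).trans_lt hm).le
  refine (hMd.isQuasiDissipativeGraph hm1 hcC).exists_semigroup ?_
  exact add_nonneg (mul_nonneg (by linarith)
    (add_nonneg hMd.transport.r₀_nonneg hMd.transport.r₁_nonneg)) hcC.C_nonneg

end TestFunctions

/-! ### The scale of spaces -/

section Inclusion

variable {n m : ℝ}

theorem memLp_of_le (hn : 0 ≤ n) (hnm : n ≤ m) {f : ℝ → ℝ} (hf : MemLp f 1 (weightMeasure m)) :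
    MemLp f 1 (weightMeasure n) :=
  hf.of_measure_le_smul (by simp) (weightMeasure_le hn hnm)

theorem integral_abs_le_two_mul (hn : 0 ≤ n) (hnm : n ≤ m) {f : ℝ → ℝ}
    (hf : Integrable f (weightMeasure m)) :
    ∫ x, |f x| ∂weightMeasure n ≤ 2 * ∫ x, |f x| ∂weightMeasure m := by
  have h1 := integral_mono_measure (weightMeasure_le hn hnm)
    (Eventually.of_forall fun x => abs_nonneg (f x)) (hf.abs.smul_measure (c := 2) (by simp))
  rwa [integral_smul_measure, ENNReal.toReal_ofNat, smul_eq_mul] at h1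

/-- The continuous inclusion of `X m` in `X n` for `n ≤ m`. -/
def inclusion (hn : 0 ≤ n) (hnm : n ≤ m) : X m →L[ℝ] X n :=
  LinearMap.mkContinuous
    { toFun := fun f => (memLp_of_le hn hnm (Lp.memLp f)).toLp f
      map_add' := fun f g => by
        rw [← MemLp.toLp_add]
        refine MemLp.toLp_congr _ _ ?_
        rw [Filter.EventuallyEq, ae_weightMeasure, ← ae_weightMeasure m]
        exact Lp.coeFn_add f g
      map_smul' := fun c f => by
        rw [RingHom.id_apply, ← MemLp.toLp_const_smul]
        refine MemLp.toLp_congr _ _ ?_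
        rw [Filter.EventuallyEq, ae_weightMeasure, ← ae_weightMeasure m]
        exact Lp.coeFn_smul c f } 2 fun f => by
    simp only [LinearMap.coe_mk, AddHom.coe_mk]
    rw [X.norm_eq, X.norm_eq]
    refine le_trans (le_of_eq (integral_congr_ae ?_))
      (integral_abs_le_two_mul hn hnm (X.integrable f))
    filter_upwards [MemLp.coeFn_toLp (memLp_of_le hn hnm (Lp.memLp f))] with x hx
    rw [hx]

theorem coeFn_inclusion (hn : 0 ≤ n) (hnm : n ≤ m) (f : X m) :
    ∀ᵐ x ∂volume.restrict (Ioi (0 : ℝ)), inclusion hn hnm f x = f x := by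
  rw [← ae_weightMeasure n]
  exact MemLp.coeFn_toLp (memLp_of_le hn hnm (Lp.memLp f))

theorem norm_inclusion (hn : 0 ≤ n) (hnm : n ≤ m) (f : X m) :
    ‖inclusion hn hnm f‖ = ∫ x, |f x| ∂weightMeasure n := by
  rw [X.norm_eq]
  refine integral_congr_ae ?_
  rw [Filter.EventuallyEq, ae_weightMeasure]
  filter_upwards [coeFn_inclusion hn hnm f] with x hx
  rw [hx]

variable {r a a₁ : ℝ → ℝ} {b : ℝ → ℝ → ℝ}

theorem inclusion_mem_graph (hn : 0 ≤ n) (hnm : n ≤ m) {f g : X m}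
    (hfg : (f, g) ∈ generatorGraph r a a₁ b m) :
    (inclusion hn hnm f, inclusion hn hnm g) ∈ generatorGraph r a a₁ b n := by
  obtain ⟨F, hF, e⟩ := hfg
  refine ⟨F, ⟨?_, hF.ac, memLp_of_le hn hnm hF.deriv_mem, ?_, hF.boundary⟩, ?_⟩
  · filter_upwards [hF.rep, coeFn_inclusion hn hnm f] with x h1 h2
    rw [h1, h2]
  · refine (memLp_of_le hn hnm hF.absorption_mem).ae_eq ?_
    rw [Filter.EventuallyEq, ae_weightMeasure]
    filter_upwards [coeFn_inclusion hn hnm f] with x h2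
    rw [h2]
  · filter_upwards [e, coeFn_inclusion hn hnm f, coeFn_inclusion hn hnm g,
      ae_restrict_mem measurableSet_Ioi] with x h1 h2 h3 hx
    rw [h3, h1, h2, gain_congr (coeFn_inclusion hn hnm f) hx]

end Inclusion

/-! ### Moment regularization -/

section MomentRegularization

variable {r a a₁ : ℝ → ℝ} {b : ℝ → ℝ → ℝ} {r₀ r₁ b₀ l n m p c C c' C' : ℝ}

theorem hasDerivWithinAt_inclusion (hn : 0 ≤ n) (hnm : n ≤ m) {u : ℝ → X m} {u' : X m}
    {s : Set ℝ} {t : ℝ} (hu : HasDerivWithinAt u u' s t) :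
    HasDerivWithinAt (fun t => inclusion hn hnm (u t)) (inclusion hn hnm u') s t :=
  (inclusion hn hnm).hasFDerivAt.comp_hasDerivWithinAt t hu

/-- The semigroups on the scale of spaces are consistent. -/
theorem ModelData.apply_inclusion_eq (hM : ModelData r a a₁ b r₀ r₁ b₀ l) (hp : 1 ≤ p)
    (hpm : p ≤ m) (hcC : GainBound a b p c C) {S : ℝ → X p →L[ℝ] X p} {Sm : ℝ → X m →L[ℝ] X m}
    (hS : IsSemigroupGeneratedBy S (generatorGraph r a a₁ b p))
    (hSm : IsSemigroupGeneratedBy Sm (generatorGraph r a a₁ b m)) {f g : X m}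
    (hfg : (f, g) ∈ generatorGraph r a a₁ b m) {t : ℝ} (ht : 0 ≤ t) :
    S t (inclusion (by linarith : 0 ≤ p) hpm f) = inclusion (by linarith : 0 ≤ p) hpm (Sm t f) := by
  set ι := inclusion (by linarith : 0 ≤ p) hpm with hι
  have hmem := inclusion_mem_graph (by linarith : 0 ≤ p) hpm hfg
  -- The difference of the two orbits stays in the domain in `X p` and starts at zero, so
  -- dissipativity there keeps it zero.
  have key := norm_le_exp_mul_of_backward_step (c := p * (r₀ + r₁) + C) ht
    (v := fun t => S t (ι f) - ι (Sm t f)) (v' := fun t => S t (ι g) - ι (Sm t g)) ?_ ?_ ?_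
  · simp only [hS.1.zero, hSm.1.zero, ContinuousLinearMap.id_apply, sub_self, norm_zero,
      mul_zero] at key
    exact sub_eq_zero.1 (norm_le_zero_iff.1 key)
  · refine ((hS.1.cont _).sub (ι.continuous.comp_continuousOn (hSm.1.cont f))).mono ?_
    exact fun s hs => hs.1
  · exact fun s hs => (hS.hasDerivWithinAt_Iic hmem hs.1).sub
      (hasDerivWithinAt_inclusion _ _ (hSm.hasDerivWithinAt_Iic hfg hs.1))
  · intro s hs
    refine Eventually.of_forall fun k => ?_
    refine hM.graph_dissipative_norm hp hcC ?_ k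
    have h1 := hM.graph_lincomb hcC 1 (-1) (hS.apply_mem hmem hs.1.le)
      (inclusion_mem_graph (by linarith : 0 ≤ p) hpm (hSm.apply_mem hfg hs.1.le))
    simpa only [one_smul, neg_one_smul, ← sub_eq_add_neg] using h1

/-- Dissipativity in `X n`, applied to an orbit living in `X m`; no semigroup on `X n` is involved.
-/
theorem ModelData.norm_inclusion_apply_le (hM : ModelData r a a₁ b r₀ r₁ b₀ l) (hn : 1 ≤ n)
    (hnm : n ≤ m) (hcC : GainBound a b n c C) {Sm : ℝ → X m →L[ℝ] X m}
    (hSm : IsSemigroupGeneratedBy Sm (generatorGraph r a a₁ b m)) {f g : X m}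
    (hfg : (f, g) ∈ generatorGraph r a a₁ b m) {t : ℝ} (ht : 0 ≤ t) :
    ‖inclusion (by linarith : 0 ≤ n) hnm (Sm t f)‖ ≤
      Real.exp ((n * (r₀ + r₁) + C) * t) * ‖inclusion (by linarith : 0 ≤ n) hnm f‖ := by
  set ι := inclusion (by linarith : 0 ≤ n) hnm with hι
  have key := norm_le_exp_mul_of_backward_step (c := n * (r₀ + r₁) + C) ht
    (v := fun t => ι (Sm t f)) (v' := fun t => ι (Sm t g))
    ((ι.continuous.comp_continuousOn (hSm.1.cont f)).mono fun s hs => hs.1)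
    (fun s hs => hasDerivWithinAt_inclusion _ _ (hSm.hasDerivWithinAt_Iic hfg hs.1))
    (fun s hs => Eventually.of_forall fun k => hM.graph_dissipative_norm hn hcC
      (inclusion_mem_graph (by linarith : 0 ≤ n) hnm (hSm.apply_mem hfg hs.1.le)) k)
  simpa only [hSm.1.zero, ContinuousLinearMap.id_apply] using key

/-- Superlinear fragmentation trades a factor `1 / t` for a lower moment. -/
theorem exists_weight_interpolation {a₀ γ₀ x₀ : ℝ} (ha : ∀ x, 0 < x → 0 ≤ a x) (ha₀ : 0 < a₀)
    (hγ₀ : 0 < γ₀) (hx₀ : 0 < x₀) (ha_lower : ∀ x : ℝ, x₀ ≤ x → a₀ * x ^ γ₀ ≤ a x) (hc : 0 < c)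
    (hnm : n < m) : ∃ D : ℝ, 0 < D ∧ ∀ t x : ℝ, 0 < t → 0 < x →
      ((m - n) / γ₀ + 1) / t * (1 + x ^ m) ≤ c * a x * (1 + x ^ m) +
        D / t * (1 + t ^ (-((m - n) / γ₀))) * (1 + x ^ n) := by
  set β := (m - n) / γ₀ with hβ
  have hβ0 : 0 < β := div_pos (by linarith) hγ₀
  set q := (β + 1) / (c * a₀) with hq
  have hq0 : 0 < q := by positivity
  have hx₀p := Real.rpow_nonneg hx₀.le (m - n)
  have hqp := Real.rpow_nonneg hq0.le β
  refine ⟨(β + 1) * (1 + x₀ ^ (m - n) + q ^ β), by positivity, fun t x ht hx => ?_⟩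
  have htp := Real.rpow_nonneg ht.le (-β)
  have hxm := Real.rpow_nonneg hx.le m
  have hxn := Real.rpow_nonneg hx.le n
  have hax := ha x hx
  -- Either the fragmentation rate already dominates `(β + 1) / t`, or `x < x₀`, or `x ^ γ₀ < q /
  -- t`. In the last two cases `x ^ (m - n)` is at most a constant times `1 + t ^ (-β)`.
  by_cases hbig : x₀ ≤ x ∧ (β + 1) / t ≤ c * (a₀ * x ^ γ₀)
  · have h1 : (β + 1) / t ≤ c * a x :=
      hbig.2.trans (mul_le_mul_of_nonneg_left (ha_lower x hbig.1) hc.le)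
    have h2 : (β + 1) / t * (1 + x ^ m) ≤ c * a x * (1 + x ^ m) := by gcongr
    have h3 : 0 ≤ (β + 1) * (1 + x₀ ^ (m - n) + q ^ β) / t * (1 + t ^ (-β)) * (1 + x ^ n) := by
      positivity
    linarith
  · have h1 : x ^ (m - n) ≤ x₀ ^ (m - n) + q ^ β * t ^ (-β) := by
      by_cases hxx : x₀ ≤ x
      · have h2 : c * (a₀ * x ^ γ₀) < (β + 1) / t := not_le.1 fun h => hbig ⟨hxx, h⟩
        have h3 : x ^ γ₀ ≤ q * t⁻¹ := by
          rw [hq, div_mul_eq_mul_div, le_div_iff₀ (by positivity), ← div_eq_mul_inv]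
          linarith
        have h4 := Real.rpow_le_rpow (Real.rpow_nonneg hx.le γ₀) h3 hβ0.le
        rw [← Real.rpow_mul hx.le, Real.mul_rpow hq0.le (inv_nonneg.2 ht.le),
          Real.inv_rpow ht.le, ← Real.rpow_neg ht.le] at h4
        have e : γ₀ * β = m - n := by rw [hβ]; field_simp
        rw [e] at h4
        linarith
      · have h2 : x ^ (m - n) ≤ x₀ ^ (m - n) :=
          Real.rpow_le_rpow hx.le (not_le.1 hxx).le (by linarith)
        have h3 : 0 ≤ q ^ β * t ^ (-β) := mul_nonneg hqp htp
        linarith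
    have e : x ^ m = x ^ n * x ^ (m - n) := by rw [← Real.rpow_add hx]; congr 1; ring
    have h2 : 1 + x ^ m ≤ (1 + x₀ ^ (m - n) + q ^ β) * (1 + t ^ (-β)) * (1 + x ^ n) := by
      have h3 : 1 + x ^ m ≤ (1 + x ^ (m - n)) * (1 + x ^ n) := by
        rw [e]
        nlinarith [Real.rpow_nonneg hx.le (m - n)]
      refine h3.trans (mul_le_mul_of_nonneg_right ?_ (by linarith))
      nlinarith [mul_nonneg hx₀p htp]
    have h4 : 0 ≤ c * a x * (1 + x ^ m) := by positivity
    calc (β + 1) / t * (1 + x ^ m)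
        ≤ (β + 1) / t * ((1 + x₀ ^ (m - n) + q ^ β) * (1 + t ^ (-β)) * (1 + x ^ n)) := by gcongr
      _ = (β + 1) * (1 + x₀ ^ (m - n) + q ^ β) / t * (1 + t ^ (-β)) * (1 + x ^ n) := by ring
      _ ≤ _ := by linarith

theorem rpow_le_mul_exp {β t : ℝ} (hβ : 0 < β) (ht : 0 ≤ t) : t ^ β ≤ β ^ β * Real.exp t := by
  have h1 : t ≤ β * Real.exp (t / β) := by
    have := Real.add_one_le_exp (t / β)
    have h2 : t / β ≤ Real.exp (t / β) := by linarith
    rwa [div_le_iff₀ hβ, mul_comm] at h2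
  calc t ^ β ≤ (β * Real.exp (t / β)) ^ β := Real.rpow_le_rpow ht h1 hβ.le
    _ = β ^ β * Real.exp t := by
      rw [Real.mul_rpow hβ.le (Real.exp_pos _).le, ← Real.exp_mul, div_mul_cancel₀ _ hβ.ne']

/-- The integrated form of the weight interpolation. -/
theorem integral_weight_interpolation (hn : 0 ≤ n) (hnm : n ≤ m) {f : X m}
    (hf : Integrable (fun x => a x * |f x|) (weightMeasure m)) {A D : ℝ}
    (h : ∀ x : ℝ, 0 < x → A * (1 + x ^ m) ≤ c * a x * (1 + x ^ m) + D * (1 + x ^ n)) :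
    A * ‖f‖ ≤ c * ∫ x, a x * |f x| ∂weightMeasure m + D * ‖inclusion hn hnm f‖ := by
  have i1 := integrable_weightMeasure_iff.1 (X.integrable f).abs
  have i2 := integrable_weightMeasure_iff.1 hf
  have i3 := integrable_weightMeasure_iff.1
    (memLp_one_iff_integrable.1 (memLp_of_le hn hnm (Lp.memLp f))).abs
  rw [norm_inclusion, X.norm_eq, integral_weightMeasure, integral_weightMeasure,
    integral_weightMeasure, ← integral_const_mul, ← integral_const_mul, ← integral_const_mul,
    ← integral_add (i2.const_mul c) (i3.const_mul D)]
  refine setIntegral_mono_on (i1.const_mul A) ((i2.const_mul c).add (i3.const_mul D))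
    measurableSet_Ioi fun x hx => ?_
  have h1 := mul_le_mul_of_nonneg_left (h x hx) (abs_nonneg (f x))
  linarith

/-- Moment regularization for initial data in the domain of the generator in `X m`. -/
theorem ModelData.exists_norm_apply_le (hM : ModelData r a a₁ b r₀ r₁ b₀ l) {a₀ γ₀ x₀ : ℝ}
    (ha₀ : 0 < a₀) (hγ₀ : 0 < γ₀) (hx₀ : 0 < x₀)
    (ha_lower : ∀ x : ℝ, x₀ ≤ x → a₀ * x ^ γ₀ ≤ a x) (hn : 1 ≤ n) (hnm : n < m)
    (hcC : GainBound a b m c C) (hcC' : GainBound a b n c' C') :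
    ∃ θ D : ℝ, 0 < θ ∧ 0 < D ∧ ∀ {Sm : ℝ → X m →L[ℝ] X m},
      IsSemigroupGeneratedBy Sm (generatorGraph r a a₁ b m) → ∀ {f g : X m},
      (f, g) ∈ generatorGraph r a a₁ b m → ∀ {t : ℝ}, 0 < t →
        ‖Sm t f‖ ≤ D * Real.exp (θ * t) * t ^ ((n - m) / γ₀) *
          ‖inclusion (by linarith : 0 ≤ n) hnm.le f‖ := by
  have hm : 1 ≤ m := by linarith
  have hr : 0 ≤ r₀ + r₁ := add_nonneg hM.transport.r₀_nonneg hM.transport.r₁_nonneg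
  set ω := m * (r₀ + r₁) + C with hω
  set ω' := n * (r₀ + r₁) + C' with hω'
  have hω0 : 0 ≤ ω := add_nonneg (mul_nonneg (by linarith) hr) hcC.C_nonneg
  have hω'0 : 0 ≤ ω' := add_nonneg (mul_nonneg (by linarith) hr) hcC'.C_nonneg
  obtain ⟨D, hD, hDle⟩ := exists_weight_interpolation hM.frag_nonneg ha₀ hγ₀ hx₀ ha_lower
    hcC.c_pos hnm
  set β := (m - n) / γ₀ with hβ
  have hβ0 : 0 < β := div_pos (by linarith) hγ₀
  have hββ := Real.rpow_nonneg hβ0.le β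
  -- The rate covers the growth in `X m` and in `X n`, and the extra `1` absorbs `t ^ β` at large
  -- times.
  set θ := ω + ω' + 1 with hθ
  refine ⟨θ, D * (β ^ β + 1), by positivity, by positivity, ?_⟩
  intro Sm hSm f g hfg T hT
  set ι := inclusion (by linarith : 0 ≤ n) hnm.le with hι
  -- The weight vanishes at `0`, which removes the initial `m`-norm. Its extra power of `t` beyond
  -- `t ^ β` cancels the factor `1 / t` of the interpolation, and is divided out of the linear bound
  -- at the end.
  have key := mul_norm_le_of_backward_step (T := T) (v := fun t => Sm t f)
    (v' := fun t => Sm t g) (ρ := fun t => t ^ (β + 1) * Real.exp (-(θ * t)))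
    (ρ' := fun t => (β + 1) * t ^ β * Real.exp (-(θ * t))
      + t ^ (β + 1) * (Real.exp (-(θ * t)) * -θ))
    (D := fun t => c * ∫ x, a x * |Sm t f x| ∂weightMeasure m - ω * ‖Sm t f‖)
    (C := D * (β ^ β + 1) * ‖ι f‖) hT.le
    ((hSm.1.cont f).mono fun s hs => hs.1)
    (fun s hs => hSm.hasDerivWithinAt_Iic hfg hs.1) ?_ ?_ ?_ ?_ ?_ ?_
  · rw [Real.zero_rpow (by positivity), zero_mul, zero_mul, zero_add, Real.rpow_add_one hT.ne']
      at key
    have e1 : T ^ ((n - m) / γ₀) = (T ^ β)⁻¹ := by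
      rw [← Real.rpow_neg hT.le, hβ]
      congr 1
      ring
    have hTβ := Real.rpow_pos_of_pos hT β
    rw [e1]
    rw [Real.exp_neg] at key
    have hexp := Real.exp_pos (θ * T)
    have e2 : T ^ β * T * (Real.exp (θ * T))⁻¹ * ‖Sm T f‖
        = T * (T ^ β * ‖Sm T f‖ / Real.exp (θ * T)) := by
      field_simp
    rw [e2] at key
    have h2 := le_of_mul_le_mul_left (key.trans_eq (mul_comm _ T)) hT
    rw [div_le_iff₀ hexp] at h2
    have e3 : D * (β ^ β + 1) * Real.exp (θ * T) * (T ^ β)⁻¹ * ‖ι f‖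
        = D * (β ^ β + 1) * ‖ι f‖ * Real.exp (θ * T) / T ^ β := by
      field_simp
    rw [e3, le_div_iff₀ hTβ, mul_comm]
    exact h2
  · rw [Real.zero_rpow (by positivity), zero_mul]
  · exact fun t ht => mul_pos (Real.rpow_pos_of_pos ht.1 _) (Real.exp_pos _)
  · refine ContinuousOn.mul ?_ (by fun_prop)
    exact continuousOn_id.rpow_const fun x _ => Or.inr (by positivity)
  · intro t ht
    have h1 := Real.hasDerivAt_rpow_const (x := t) (p := β + 1) (Or.inl ht.1.ne')
    rw [add_sub_cancel_right] at h1
    have h2 : HasDerivAt (fun t => Real.exp (-(θ * t))) (Real.exp (-(θ * t)) * -θ) t := by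
      simpa using (((hasDerivAt_id t).const_mul θ).neg.exp)
    exact h1.mul h2
  · intro t ht
    refine Eventually.of_forall fun k => ?_
    have h1 := (hM.graph_dissipative hm hcC (hSm.apply_mem hfg ht.1.le) k).2
    linarith
  · intro t ht
    have ht0 : 0 < t := ht.1
    have h_int := (hM.graph_dissipative hm hcC (hSm.apply_mem hfg ht.1.le) 0).1
    have h1 := integral_weight_interpolation (by linarith : 0 ≤ n) hnm.le h_int
      (A := (β + 1) / t) (D := D / t * (1 + t ^ (-β))) fun x hx => hDle t x ht0 hx
    have h2 := hM.norm_inclusion_apply_le hn hnm.le hcC' hSm hfg ht0.le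
    rw [← hι] at h1 h2
    set N := ‖Sm t f‖ with hN
    set I := ∫ x, a x * |Sm t f x| ∂weightMeasure m
    have hN0 : 0 ≤ N := norm_nonneg _
    set e := Real.exp (-(θ * t)) with he
    have he0 : 0 < e := Real.exp_pos _
    have htβ := Real.rpow_pos_of_pos ht0 β
    have et : t ^ (β + 1) = t ^ β * t := Real.rpow_add_one ht0.ne' β
    have h3 : t ^ β * e * ((β + 1) * N) ≤
        t ^ β * t * e * (c * I) + D * (t ^ β + 1) * (e * ‖ι (Sm t f)‖) := by
      have h4 := mul_le_mul_of_nonneg_left h1 (by positivity : 0 ≤ t ^ β * t * e)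
      rw [Real.rpow_neg ht0.le] at h4
      calc t ^ β * e * ((β + 1) * N) = t ^ β * t * e * ((β + 1) / t * N) := by field_simp
        _ ≤ _ := h4
        _ = _ := by field_simp
    have h5 : (t ^ β + 1) * (e * ‖ι (Sm t f)‖) ≤ (β ^ β + 1) * ‖ι f‖ := by
      have h6 : e * ‖ι (Sm t f)‖ ≤ Real.exp (-t) * ‖ι f‖ := by
        calc e * ‖ι (Sm t f)‖ ≤ e * (Real.exp (ω' * t) * ‖ι f‖) := by gcongr
          _ = Real.exp (-(θ * t) + ω' * t) * ‖ι f‖ := by rw [← mul_assoc, he, ← Real.exp_add]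
          _ ≤ Real.exp (-t) * ‖ι f‖ := by
            gcongr
            rw [hθ]
            nlinarith [mul_nonneg hω0 ht0.le]
      have h7 := rpow_le_mul_exp hβ0 ht0.le
      have h8 : (1 : ℝ) ≤ Real.exp t := Real.one_le_exp ht0.le
      calc (t ^ β + 1) * (e * ‖ι (Sm t f)‖)
          ≤ (β ^ β * Real.exp t + Real.exp t) * (Real.exp (-t) * ‖ι f‖) := by gcongr
        _ = (β ^ β + 1) * (Real.exp t * Real.exp (-t)) * ‖ι f‖ := by ring
        _ = _ := by rw [← Real.exp_add]; simp
    have h9 := mul_le_mul_of_nonneg_left h5 hD.le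
    have h10 : 0 ≤ t ^ β * t * e * ((θ - ω) * N) := by
      have : 0 ≤ θ - ω := by rw [hθ]; linarith
      positivity
    rw [et]
    linarith

theorem momentNorm_eq_ofReal (f : X m) : momentNorm m f = ENNReal.ofReal ‖f‖ := by
  rw [Lp.norm_def, ENNReal.ofReal_toReal (Lp.eLpNorm_ne_top f), momentNorm]

theorem momentNorm_congr {f g : ℝ → ℝ} (hfg : f =ᵐ[volume.restrict (Ioi (0 : ℝ))] g) :
    momentNorm m f = momentNorm m g := by
  refine eLpNorm_congr_ae ?_
  rw [Filter.EventuallyEq, ae_weightMeasure]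
  exact hfg

/-- Lower semicontinuity of the moment norms with respect to convergence in `X p`. -/
theorem momentNorm_le_of_tendsto {f : ℕ → X p} {g : X p} (hfg : Tendsto f atTop (𝓝 g))
    (hmeas : ∀ k, AEStronglyMeasurable (f k) (weightMeasure m)) {A : ℕ → ℝ≥0∞} {B : ℝ≥0∞}
    (hA : ∀ k, momentNorm m (f k) ≤ A k) (hB : Tendsto A atTop (𝓝 B)) : momentNorm m g ≤ B := by
  obtain ⟨φ, hφ, hlim⟩ := (tendstoInMeasure_of_tendsto_Lp hfg).exists_seq_tendsto_ae
  have h1 := Lp.eLpNorm_lim_le_liminf_eLpNorm (p := 1) (fun k => hmeas (φ k)) g (by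
    rw [ae_weightMeasure, ← ae_weightMeasure p]
    exact hlim)
  refine h1.trans ?_
  rw [← (hB.comp hφ.tendsto_atTop).liminf_eq]
  exact liminf_le_liminf (Eventually.of_forall fun k => hA (φ k))

/-- Data from the domain in `X m` approximate `f` in `X p`. On them the two semigroups agree, and
the estimate survives the limit by lower semicontinuity. The factor `2` compares the `n`-norm with
the `p`-norm. -/
theorem ModelData.momentNorm_apply_le (hM : ModelData r a a₁ b r₀ r₁ b₀ l) {D : ℝ} (hD : 0 ≤ D)
    {t : ℝ} (ht : 0 ≤ t) (hn : 1 ≤ n) (hnp : n ≤ p) (hpm : p ≤ m)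
    (hcC : GainBound a b m c C) (hcC' : GainBound a b p c' C')
    {Sm : ℝ → X m →L[ℝ] X m} (hSm : IsSemigroupGeneratedBy Sm (generatorGraph r a a₁ b m))
    {S : ℝ → X p →L[ℝ] X p} (hS : IsSemigroupGeneratedBy S (generatorGraph r a a₁ b p))
    (hle : ∀ {f g : X m}, (f, g) ∈ generatorGraph r a a₁ b m →
      ‖Sm t f‖ ≤ D * ‖inclusion (by linarith : 0 ≤ n) (hnp.trans hpm) f‖) (f : X p) :
    momentNorm m (S t f) ≤ ENNReal.ofReal (D * 2 * ‖f‖) := by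
  have hp0 : 0 ≤ p := by linarith
  have hn0 : 0 ≤ n := by linarith
  choose u v huv hlt using fun k : ℕ =>
    hM.exists_mem_graph_approx hp0 (by linarith : 0 ≤ m) hcC f (one_div_natCast_add_one_pos k)
  set ι := inclusion hp0 hpm with hι
  have hu : Tendsto (fun k => ι (u k)) atTop (𝓝 f) := by
    rw [tendsto_iff_norm_sub_tendsto_zero]
    refine squeeze_zero (fun _ => norm_nonneg _) (fun k => ?_)
      (tendsto_one_div_add_atTop_nhds_zero_nat (𝕜 := ℝ))
    refine le_of_eq_of_le ?_ (hlt k).le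
    rw [norm_sub_rev, X.norm_eq]
    refine integral_congr_ae ?_
    rw [Filter.EventuallyEq, ae_weightMeasure]
    have h1 := Lp.coeFn_sub f (ι (u k))
    rw [Filter.EventuallyEq, ae_weightMeasure] at h1
    filter_upwards [h1, coeFn_inclusion hp0 hpm (u k)] with x h2 h3
    rw [h2, Pi.sub_apply, h3]
  have hcons : ∀ k, S t (ι (u k)) = ι (Sm t (u k)) := fun k =>
    hM.apply_inclusion_eq (by linarith) hpm hcC' hS hSm (huv k) ht
  refine momentNorm_le_of_tendsto (((S t).continuous.tendsto f).comp hu)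
    (A := fun k => ENNReal.ofReal (D * 2 * ‖ι (u k)‖)) (fun k => ?_) (fun k => ?_) ?_
  · rw [aestronglyMeasurable_weightMeasure_iff, ← aestronglyMeasurable_weightMeasure_iff (m := p)]
    exact Lp.aestronglyMeasurable _
  · simp only [Function.comp_apply]
    rw [hcons, momentNorm_congr (coeFn_inclusion hp0 hpm (Sm t (u k))), momentNorm_eq_ofReal]
    refine ENNReal.ofReal_le_ofReal ((hle (huv k)).trans ?_)
    rw [mul_assoc]
    refine mul_le_mul_of_nonneg_left ?_ hD
    rw [norm_inclusion, norm_inclusion]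
    exact integral_abs_le_two_mul hn0 hnp
      (memLp_one_iff_integrable.1 (memLp_of_le hp0 hpm (Lp.memLp (u k))))
  · exact ENNReal.tendsto_ofReal (hu.norm.const_mul _)

end MomentRegularization

end GrowthFragmentation

end

/-! ### Generation and regularization combined -/

theorem mainTheorem3
    (r a a₁ : ℝ → ℝ) (b : ℝ → ℝ → ℝ) (r₀ r₁ b₀ l a₀ γ₀ x₀ : ℝ)
    -- growth rate
    (hr_int : LocallyIntegrableOn (fun x => 1 / r x) (Ioi (0 : ℝ)))
    (hr₀ : 0 ≤ r₀) (hr₁ : 0 ≤ r₁)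
    (hr : ∀ x : ℝ, 0 < x → 0 < r x ∧ r x ≤ r₀ + r₁ * x)
    -- fragmentation rate and additional absorption rate
    (ha_loc : GrowthFragmentation.LocEssBounded a) (ha : ∀ x : ℝ, 0 < x → 0 ≤ a x)
    (ha₁_loc : GrowthFragmentation.LocEssBounded a₁) (ha₁ : ∀ x : ℝ, 0 < x → 0 ≤ a₁ x)
    (ha₁_bdd : a₁ =O[atTop] a)
    -- fragmentation kernel
    (hb_meas : Measurable (Function.uncurry b))
    (hb_nonneg : ∀ x y : ℝ, 0 < x → 0 < y → 0 ≤ b x y)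
    (hb_zero : ∀ x y : ℝ, 0 < y → y < x → b x y = 0)
    (hb_mass : ∀ y : ℝ, 0 < y →
      GrowthFragmentation.daughterMoment b 1 y = ENNReal.ofReal y)
    (hb₀ : 0 < b₀) (hl : 0 ≤ l)
    (hb_number : ∀ y : ℝ, 0 < y →
      GrowthFragmentation.daughterMoment b 0 y ≤ ENNReal.ofReal (b₀ * (1 + y ^ l)))
    (hb_loss : ∃ m₀ : ℝ, 1 < m₀ ∧
      0 < liminf (fun y : ℝ => GrowthFragmentation.momentLoss b m₀ y / y ^ m₀) atTop)
    -- growth of the fragmentation rate at infinity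
    (ha₀ : 0 < a₀) (hγ₀ : 0 < γ₀) (hx₀ : 0 < x₀)
    (ha_lower : ∀ x : ℝ, x₀ ≤ x → a₀ * x ^ γ₀ ≤ a x) :
    (∀ p : ℝ, max 1 l < p →
      ∃ S : ℝ → GrowthFragmentation.X p →L[ℝ] GrowthFragmentation.X p,
        GrowthFragmentation.IsSemigroupGeneratedBy S
          (GrowthFragmentation.generatorGraph r a a₁ b p)) ∧
    ∀ n m : ℝ, max 1 l < n → n < m →
      ∃ θ : ℝ, 0 < θ ∧ ∀ p : ℝ, n < p → p < m →
        ∃ C : ℝ, 0 < C ∧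
          ∀ S : ℝ → GrowthFragmentation.X p →L[ℝ] GrowthFragmentation.X p,
            GrowthFragmentation.IsSemigroupGeneratedBy S
              (GrowthFragmentation.generatorGraph r a a₁ b p) →
            ∀ t : ℝ, 0 < t → ∀ f : GrowthFragmentation.X p,
              GrowthFragmentation.momentNorm m (S t f) ≤
                ENNReal.ofReal (C * Real.exp (θ * t) * t ^ ((n - m) / γ₀) * ‖f‖) := by
  have hM : GrowthFragmentation.ModelData r a a₁ b r₀ r₁ b₀ l :=
    { transport := ⟨hr_int, hr₀, hr₁, hr, fun R => (ha_loc R).add (ha₁_loc R),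
        fun x hx => add_nonneg (ha x hx) (ha₁ x hx)⟩
      kernel := ⟨hb_meas, hb_nonneg, hb_mass, hb₀.le, hl, hb_number, hb_loss⟩
      frag := ha_loc
      frag_nonneg := ha
      death_nonneg := ha₁ }
  refine ⟨fun p hp => hM.exists_semigroup hp, fun n m hn hnm => ?_⟩
  have hn1 : 1 ≤ n := ((le_max_left _ _).trans_lt hn).le
  obtain ⟨c, C, hcC⟩ := hM.exists_gainBound (hn.trans hnm)
  obtain ⟨c', C', hcC'⟩ := hM.exists_gainBound hn
  obtain ⟨Sm, hSm⟩ := hM.exists_semigroup (hn.trans hnm)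
  -- These constants come from estimates in `X m` and `X n` alone and are fixed before `p`, so `θ`
  -- does not depend on `p`.
  obtain ⟨θ, D, hθ, hD, hle⟩ :=
    hM.exists_norm_apply_le ha₀ hγ₀ hx₀ ha_lower hn1 hnm hcC hcC'
  refine ⟨θ, hθ, fun p hnp hpm => ⟨D * 2, by positivity, fun S hS t ht f => ?_⟩⟩
  obtain ⟨c₂, C₂, hcC₂⟩ := hM.exists_gainBound (hn.trans hnp)
  have h := hM.momentNorm_apply_le (D := D * Real.exp (θ * t) * t ^ ((n - m) / γ₀))
    (by positivity) ht.le hn1 hnp.le hpm.le hcC hcC₂ hSm hS (fun hfg => hle hSm hfg ht) f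
  refine h.trans_eq ?_
  congr 1
  ring
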